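/- Theorem. Let $\theta\in(0,1)$, let $n\ge 3$ be an integer, let $P(\lambda)=\sum_{m=0}^n\alpha_m\lambda^m$ with $\alpha_m\in\mathbb Z$ and $\alpha_n\neq 0$, and let $p,q$ be coprime positive integers. For $u_0\in L^2(0,2\pi)$ consider the quasi-periodic problem $$\partial_t u=-iP(-i\partial_x)u,\quad u(x,0)=u_0(x),\quad e^{i2\pi\theta}\partial_x^m u(0,t)=\partial_x^m u(2\pi,t)\quad (m=0,\dots,n-1)$$ for $(x,t)\in[0,2\pi]\times[0,\infty)$. A solution is understood in the weak sense: $u\in C([0,\infty);L^2(0,2\pi))$, $u(\cdot,0)=u_0$, and $\frac{d}{dt}\langle u(t),\varphi\rangle=-i\langle u(t),P(-i\partial_x)\varphi\rangle$ for all $t\ge0$ and every $\varphi\in C^n([0,2\pi])$ with $e^{i2\pi\theta}\varphi^{(m)}(0)=\varphi^{(m)}(2\pi)$, $m=0,\dots,n-1$, where $\langle f,g\rangle=\int_0^{2\pi}f\,\overline g\,dx$. For every $u_0\in L^2(0,2\pi)$ there is exactly one such solution $u$, and at the rational time $t_r=2\pi p/q$ it has the following properties. (i) If $\theta\in\mathbb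 Q$, then $u(\cdot,t_r)$ is a finite linear combination of translated copies of $u_0$: there are $N\in\mathbb N$, $c_1,\dots,c_N\in\mathbb C$ and $s_1,\dots,s_N\in\mathbb R$, not depending on $u_0$, such that $u(x,t_r)=\sum_{k=1}^N c_k\,u_0^{\sharp}(x-s_k)$ for almost every $x\in(0,2\pi)$, where $u_0^{\sharp}$ is the quasi-periodic extension of $u_0$ to $\mathbb R$, $u_0^\sharp(x)=e^{i2\pi\theta m}u_0(x-2\pi m)$ for $2\pi m\le x<2\pi(m+1)$, $m\in\mathbb Z$. (ii) If $\theta\notin\mathbb Q$ and $u_0$ is of bounded variation over $[0,2\pi]$ (that is, has a representative of bounded variation), then $u(\cdot,t_r)$ is (almost everywhere equal to) a continuous function of $x\in[0,2\pi]$, and this function satisfies $e^{i2\pi\theta}u(0,t_r)=u(2\pi,t_r)$. -/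

import Mathlib

open MeasureTheory Set

noncomputable section

/-- Lebesgue measure on the interval `(0, 2π)` (endpoints are null sets). -/
def intervalMeasure : Measure ℝ := volume.restrict (Ioc 0 (2 * Real.pi))

/-- The complex Hilbert space `L²(0, 2π)`. -/
abbrev L2 : Type := Lp ℂ 2 intervalMeasure

/-- The differential operator `P(-i∂ₓ) = ∑ₘ αₘ (-i)^m ∂ₓ^m`, where `P = ∑ₘ αₘ X^m`. -/
def diffOp (P : Polynomial ℤ) (φ : ℝ → ℂ) (x : ℝ) : ℂ :=
  ∑ m ∈ Finset.range (P.natDegree + 1),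
    (P.coeff m : ℂ) * (-Complex.I) ^ m * iteratedDeriv m φ x

/-- Test functions of order `n`: functions of class `C^n` on `[0, 2π]` that satisfy the
quasi-periodic boundary conditions `e^{i2πθ} φ^(m)(0) = φ^(m)(2π)` for `m = 0, …, n - 1`. -/
structure IsQuasiPeriodicTest (θ : ℝ) (n : ℕ) (φ : ℝ → ℂ) : Prop where
  contDiff : ContDiff ℝ n φ
  boundary : ∀ m < n, Complex.exp (Complex.I * (2 * Real.pi * θ)) * iteratedDeriv m φ 0 =
    iteratedDeriv m φ (2 * Real.pi)

/-- `u` is a (weak) `L²(0, 2π)` solution on `[0, ∞)` of the quasi-periodic problem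
`∂ₜ u = -i P(-i∂ₓ) u`, `u(·, 0) = u₀`, `e^{i2πθ} ∂ₓ^m u(0, t) = ∂ₓ^m u(2π, t)` for
`m = 0, …, n - 1`, where `n` is the degree of `P`: it is continuous in time with values in
`L²(0, 2π)`, takes the initial value `u₀`, and for all test functions `φ` and times `t ≥ 0`
`d/dt ⟨u(t), φ⟩ = -i ⟨u(t), P(-i∂ₓ) φ⟩`, with `⟨f, g⟩ = ∫ f(x) conj(g(x)) dx` on `(0, 2π)`.
(The operator `P(-i∂ₓ)` with these boundary conditions is symmetric, `P` being real.) -/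
structure IsWeakSolution (θ : ℝ) (P : Polynomial ℤ) (u₀ : L2) (u : ℝ → L2) : Prop where
  continuousOn : ContinuousOn u (Ici 0)
  initial : u 0 = u₀
  weak : ∀ φ : ℝ → ℂ, IsQuasiPeriodicTest θ P.natDegree φ → ∀ t : ℝ, 0 ≤ t →
    HasDerivWithinAt
      (fun τ : ℝ => ∫ x, u τ x * (starRingEnd ℂ) (φ x) ∂intervalMeasure)
      (-Complex.I * ∫ x, u t x * (starRingEnd ℂ) (diffOp P φ x) ∂intervalMeasure)
      (Ici 0) t

/-- The quasi-periodic extension to `ℝ` of a function `f` on `[0, 2π)`: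
`e^{i2πθm} f(x - 2πm)` for `2πm ≤ x < 2π(m + 1)`, `m ∈ ℤ`. It equals
`e^{iθx} g*(x)`, where `g*` is the `2π`-periodic extension of `g(x) = e^{-iθx} f(x)`. -/
def quasiPeriodicExt (θ : ℝ) (f : ℝ → ℂ) (x : ℝ) : ℂ :=
  Complex.exp (Complex.I * (2 * Real.pi * θ * ⌊x / (2 * Real.pi)⌋)) *
    f (x - 2 * Real.pi * ⌊x / (2 * Real.pi)⌋)

/-- An element of `L²(0, 2π)` is of bounded variation over `[0, 2π]`: it has a representative
of bounded variation. -/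
def HasBoundedVariation (u₀ : L2) : Prop :=
  ∃ f : ℝ → ℂ, BoundedVariationOn f (Icc 0 (2 * Real.pi)) ∧ u₀ =ᵐ[intervalMeasure] f

end

open MeasureTheory Set

/-! The functions e^{i(j+θ)x}, j ∈ ℤ, form an orthogonal basis of L²(0, 2π) and satisfy the boundary
conditions. Testing against them turns the weak equation into one scalar ODE per mode: the j-th
coefficient is multiplied by exp(-iP(j+θ)t) (`IsWeakSolution.eigenCoeff_eq`). This gives uniqueness,
and the corresponding unitary multiplier gives existence (`isWeakSolution_evolution`). At t = 2πp/q
the multiplier is w_j = e(-(p/q)P(j+θ)), where e(y) = exp(2πiy).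

Rational θ = a/b. Here w is periodic in j with period q·b^n (`unitExp_eval_periodic`), hence a
finite combination of characters of j, and each character acts, up to a scalar, as a translation of
the quasi-periodic extension.

Irrational θ. Summation by parts against a function of bounded variation
(`norm_integral_deriv_mul_le`) reduces continuity to convergence of the dyadic partial sums of ∑ w_j
e(jz)/(j+θ), uniformly in z (`exists_forall_tail_le`). Nothing is assumed about how well rationals
approximate θ, so no decay rate of the dyadic blocks is available; large blocks are counted instead.
An inverse Weyl inequality (`exists_approx_of_large_sum`) is applied to the coefficient of the phase
just below the top one: the top one is rational, and the next is a rational multiple of θ plus a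
rational, free of z because n ≥ 3. So a block at scale 2^k of size at least 2^{-s} puts θ within
2^{O(s)}·2^{-k(n-1)} of a fraction with denominator at most 2^{O(s)}. Beyond k = O(s) this fraction
a/b is the same for all such k. Either 2^{k(n-1)}|θ - a/b| lies between 2^{-O(s)} and 2^{O(s)},
which happens for O(s) values of k, or θ may be replaced by a/b and the weight becomes periodic with
period Q ≤ 2^{O(s)}. Apart from O(s) small k, a periodic block is large only if 2^k times the
distance of Qz to ℤ lies in a similar window: geometric sums bound that quantity above, cancellation
between j and -j bounds it below. Thus O(s) blocks exceed 2^{-s}, uniformly in z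
(`exists_card_large_blocks_le`). Since the blocks also tend to zero uniformly
(`exists_forall_block_le`), convergence of ∑ s·2^{-s} finishes the proof. -/

noncomputable section

/-! ### The character e(y) of ℝ/ℤ. -/

/-- The character `y ↦ exp(2πiy)` of `ℝ / ℤ`. -/
def unitExp (y : ℝ) : ℂ := Complex.exp (2 * Real.pi * y * Complex.I)

lemma unitExp_add (x y : ℝ) : unitExp (x + y) = unitExp x * unitExp y := by
  rw [unitExp, unitExp, unitExp, ← Complex.exp_add]; congr 1; push_cast; ring

lemma unitExp_intCast (m : ℤ) : unitExp m = 1 := by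
  rw [unitExp, Complex.exp_eq_one_iff]; exact ⟨m, by push_cast; ring⟩

lemma norm_unitExp (y : ℝ) : ‖unitExp y‖ = 1 := by
  have : unitExp y = Complex.exp (((2 * Real.pi * y : ℝ) : ℂ) * Complex.I) := by
    rw [unitExp]; push_cast; rfl
  rw [this, Complex.norm_exp_ofReal_mul_I]

lemma unitExp_zero : unitExp 0 = 1 := by simp [unitExp]

lemma unitExp_neg (y : ℝ) : unitExp (-y) = (starRingEnd ℂ) (unitExp y) := by
  rw [unitExp, unitExp, ← Complex.exp_conj]; congr 1
  simp only [map_mul, Complex.conj_ofReal, Complex.conj_I, map_ofNat]; push_cast; ring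

lemma unitExp_sub (x y : ℝ) : unitExp (x - y) = unitExp x * (starRingEnd ℂ) (unitExp y) := by
  rw [sub_eq_add_neg, unitExp_add, unitExp_neg]

lemma unitExp_add_intCast (x : ℝ) (m : ℤ) : unitExp (x + m) = unitExp x := by
  rw [unitExp_add, unitExp_intCast, mul_one]

lemma norm_unitExp_sub_one_le (y : ℝ) : ‖unitExp y - 1‖ ≤ 7 * |y| := by
  have h := Real.norm_exp_I_mul_ofReal_sub_one_le (x := 2 * Real.pi * y)
  have e : unitExp y = Complex.exp (Complex.I * ((2 * Real.pi * y : ℝ) : ℂ)) := by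
    rw [unitExp]; push_cast; ring_nf
  rw [e]
  refine h.trans ?_
  rw [Real.norm_eq_abs, abs_mul, abs_of_pos Real.two_pi_pos]
  have := Real.pi_lt_d2
  gcongr; linarith

lemma norm_unitExp_sub_unitExp_le (x y : ℝ) : ‖unitExp x - unitExp y‖ ≤ 7 * |x - y| := by
  have : unitExp x - unitExp y = (unitExp (x - y) - 1) * unitExp y := by
    rw [sub_mul, ← unitExp_add, sub_add_cancel, one_mul]
  rw [this, norm_mul, norm_unitExp, mul_one]
  exact norm_unitExp_sub_one_le _

lemma le_norm_unitExp_sub_one {y : ℝ} (hy : |y| ≤ 1 / 2) : 4 * |y| ≤ ‖1 - unitExp y‖ := by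
  have e : unitExp y = Complex.exp (Complex.I * ((2 * Real.pi * y : ℝ) : ℂ)) := by
    rw [unitExp]; push_cast; ring_nf
  rw [norm_sub_rev, e, Complex.norm_exp_I_mul_ofReal_sub_one]
  have h1 : (2 * Real.pi * y) / 2 = Real.pi * y := by ring
  rw [h1, Real.norm_eq_abs, abs_mul, abs_two]
  have h2 := Real.mul_abs_le_abs_sin (x := Real.pi * y) (by
    rw [abs_mul, abs_of_pos Real.pi_pos]; nlinarith [Real.pi_pos])
  rw [abs_mul, abs_of_pos Real.pi_pos] at h2
  have : 2 / Real.pi * (Real.pi * |y|) = 2 * |y| := by field_simp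
  linarith

/-! ### Diophantine approximation from many near-integer multiples. -/

/-- Lattice points in a thin strip are collinear. -/
lemma exists_approx_of_many {γ ε L : ℝ} (H : Finset ℕ) (a : ℕ → ℤ)
    (ha : ∀ h ∈ H, |h * γ - a h| ≤ ε) (hL : ∀ h ∈ H, ∀ h' ∈ H, |(h : ℝ) - h'| ≤ L)
    (hε : 4 * ε * L < 1) (hH : 2 ≤ H.card) :
    ∃ q : ℕ, 1 ≤ q ∧ ∃ c : ℤ, q * ((H.card : ℝ) - 1) ≤ L ∧
      |q * γ - c| * ((H.card : ℝ) - 1) ≤ 2 * ε := by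
  have hne : H.Nonempty := Finset.card_pos.mp (by omega)
  have hmin := H.min'_mem hne
  have hmax := H.max'_mem hne
  set h₁ := H.min' hne with h1def
  set h₂ := H.max' hne with h2def
  have hlt : h₁ < h₂ := H.min'_lt_max'_of_card (by omega)
  have hdet : ∀ h ∈ H, ((h : ℤ) - h₁) * (a h₂ - a h₁) = ((h₂ : ℤ) - h₁) * (a h - a h₁) := by
    intro h hh
    -- The determinant of two difference vectors of points (h, a h) is an integer of size at most
    -- 4εL < 1, hence zero.
    have key : |(((h : ℤ) - h₁) * (a h₂ - a h₁) - ((h₂ : ℤ) - h₁) * (a h - a h₁) : ℤ)| < 1 := by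
      have : (|(((h : ℤ) - h₁) * (a h₂ - a h₁) - ((h₂ : ℤ) - h₁) * (a h - a h₁) : ℤ)| : ℝ) < 1 := by
        push_cast
        have e : ((h : ℝ) - h₁) * (a h₂ - a h₁) - ((h₂ : ℝ) - h₁) * (a h - a h₁) =
          ((h : ℝ) - h₁) * ((h₁ * γ - a h₁) - (h₂ * γ - a h₂)) +
          ((h₂ : ℝ) - h₁) * ((h * γ - a h) - (h₁ * γ - a h₁)) := by ring
        rw [e]
        have b1 : |(h₁ * γ - a h₁) - (h₂ * γ - a h₂)| ≤ 2 * ε := by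
          refine (abs_sub _ _).trans ?_
          linarith [ha _ hmin, ha _ hmax]
        have b2 : |(h * γ - a h) - (h₁ * γ - a h₁)| ≤ 2 * ε := by
          refine (abs_sub _ _).trans ?_
          linarith [ha _ hmin, ha _ hh]
        have hL0 : 0 ≤ L := (abs_nonneg _).trans (hL _ hmin _ hmin)
        calc _ ≤ _ := abs_add_le _ _
          _ ≤ L * (2 * ε) + L * (2 * ε) := by
            rw [abs_mul, abs_mul]
            exact add_le_add (mul_le_mul (hL _ hh _ hmin) b1 (abs_nonneg _) hL0)
              (mul_le_mul (hL _ hmax _ hmin) b2 (abs_nonneg _) hL0)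
          _ < 1 := by linarith
      exact_mod_cast this
    have := Int.abs_lt_one_iff.mp key
    linarith
  set D : ℤ := (h₂ : ℤ) - h₁ with hD
  set A : ℤ := a h₂ - a h₁ with hA
  have hDpos : 0 < D := by omega
  set g : ℕ := Int.gcd D A with hg
  have hgpos : 0 < g := Int.gcd_pos_of_ne_zero_left _ hDpos.ne'
  obtain ⟨D', A', hcop, hD', hA'⟩ := Int.exists_gcd_one (m := D) (n := A) hgpos
  rw [← hg] at hD' hA'
  have hgZ : (0 : ℤ) < g := by exact_mod_cast hgpos
  have hD'pos : 0 < D' := by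
    by_contra hcon
    have : D' * (g : ℤ) ≤ 0 := mul_nonpos_of_nonpos_of_nonneg (by omega) hgZ.le
    omega
  have hdvd : ∀ h ∈ H, D' ∣ ((h : ℤ) - h₁) := by
    intro h hh
    have := hdet h hh
    rw [hD', hA'] at this
    have e : ((h : ℤ) - h₁) * A' = D' * (a h - a h₁) := by
      apply mul_right_cancel₀ hgZ.ne'; linarith
    exact (Int.isCoprime_iff_gcd_eq_one.mpr hcop).dvd_of_dvd_mul_right ⟨_, e⟩
  -- All h - h₁ are multiples of D' in [0, gD'], so there are at most g + 1 of them. The primitive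
  -- vector (D', A') therefore gains a factor g ≥ #H - 1 over (D, A), both in length and in error.
  have hcard : H.card ≤ g + 1 := by
    have : H.card ≤ (Finset.range (g + 1)).card := by
      apply Finset.card_le_card_of_injOn (fun h : ℕ => (((h : ℤ) - h₁) / D').toNat)
      · intro h hh
        have h3 : h₁ ≤ h := H.min'_le _ hh
        have h4 : h ≤ h₂ := H.le_max' _ hh
        have : ((h : ℤ) - h₁) / D' ≤ g := by
          apply Int.ediv_le_of_le_mul hD'pos
          rw [mul_comm, ← hD']; omega
        simp only [Finset.coe_range, Set.mem_Iio]; omega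
      · intro h hh h' hh' heq
        simp only at heq
        have h3 : h₁ ≤ h := H.min'_le _ hh
        have h3' : h₁ ≤ h' := H.min'_le _ hh'
        have p1 : 0 ≤ ((h : ℤ) - h₁) / D' := Int.ediv_nonneg (by omega) hD'pos.le
        have p2 : 0 ≤ ((h' : ℤ) - h₁) / D' := Int.ediv_nonneg (by omega) hD'pos.le
        have heq' : ((h : ℤ) - h₁) / D' = ((h' : ℤ) - h₁) / D' := by omega
        have e1 := Int.ediv_mul_cancel (hdvd h hh)
        have e2 := Int.ediv_mul_cancel (hdvd h' hh')
        rw [heq'] at e1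
        omega
    simpa using this
  have hcardR : (H.card : ℝ) - 1 ≤ g := by
    have : (H.card : ℝ) ≤ g + 1 := by exact_mod_cast hcard
    linarith
  have hD'R : ((D'.toNat : ℕ) : ℝ) = D' := by
    have : ((D'.toNat : ℕ) : ℤ) = D' := Int.toNat_of_nonneg hD'pos.le
    exact_mod_cast this
  have hDR : (D : ℝ) = D' * g := by exact_mod_cast hD'
  have hAR : (A : ℝ) = A' * g := by exact_mod_cast hA'
  refine ⟨D'.toNat, by omega, A', ?_, ?_⟩
  · rw [hD'R]
    have : (D : ℝ) ≤ L := by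
      have := hL _ hmax _ hmin
      rw [hD]; push_cast; exact (le_abs_self _).trans this
    rw [hDR] at this
    have h0 : (0 : ℝ) ≤ D' := by exact_mod_cast hD'pos.le
    nlinarith
  · rw [hD'R]
    have b1 : |(D : ℝ) * γ - A| ≤ 2 * ε := by
      have e : (D : ℝ) * γ - A = (h₂ * γ - a h₂) - (h₁ * γ - a h₁) := by
        rw [hD, hA]; push_cast; ring
      rw [e]
      refine (abs_sub _ _).trans ?_
      linarith [ha _ hmin, ha _ hmax]
    have e : (D : ℝ) * γ - A = (D' * γ - A') * g := by rw [hDR, hAR]; ring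
    rw [e, abs_mul, abs_of_nonneg (Nat.cast_nonneg (α := ℝ) g)] at b1
    exact (mul_le_mul_of_nonneg_left hcardR (abs_nonneg _)).trans b1

/-- A positive proportion of h < N with hγ within about N^{-d} of ℤ forces collinearity of the
points (h, a h) on short intervals. The common slope is a fraction with small denominator, and
spreading the error over about N points gains one more power of N. -/
lemma exists_approx_of_dense (E d : ℕ) (hd : 1 ≤ d) : ∃ C : ℕ, ∀ M : ℝ, 2 ≤ M → ∀ N : ℕ, 1 ≤ N →
    ∀ (γ : ℝ) (H : Finset ℕ) (a : ℕ → ℤ), H ⊆ Finset.range N → (N : ℝ) ≤ M ^ E * H.card →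
    (∀ h ∈ H, |h * γ - a h| ≤ M ^ E / N ^ d) →
    ∃ q : ℕ, 1 ≤ q ∧ (q : ℝ) ≤ M ^ C ∧ ∃ c : ℤ, |q * γ - c| ≤ M ^ C / N ^ (d + 1) := by
  refine ⟨(2 * E + 8) * (d + 1) + (3 * E + 8), fun M hM N hN γ H a hHN hcard ha => ?_⟩
  have hM1 : 1 ≤ M := by linarith
  have hNpos : (0 : ℝ) < N := by exact_mod_cast hN
  -- For N this small the power of M absorbs N^{d+1}, and q = 1 suffices.
  by_cases hsmall : (N : ℝ) ≤ M ^ (2 * E + 8)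
  · refine ⟨1, le_rfl, by simpa using one_le_pow₀ hM1, round γ, ?_⟩
    have h1 : |γ - round γ| ≤ 1 / 2 := abs_sub_round γ
    rw [le_div_iff₀ (by positivity)]
    have h2 : (N : ℝ) ^ (d + 1) ≤ M ^ ((2 * E + 8) * (d + 1)) := by
      rw [pow_mul]; gcongr
    have h3 : M ^ ((2 * E + 8) * (d + 1)) ≤ M ^ ((2 * E + 8) * (d + 1) + (3 * E + 8)) :=
      pow_le_pow_right₀ hM1 (by omega)
    have h4 : (0 : ℝ) ≤ (N : ℝ) ^ (d + 1) := by positivity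
    simp only [Nat.cast_one, one_mul]
    nlinarith [abs_nonneg (γ - round γ)]
  · push Not at hsmall
    -- Cells of length L = N/T: with ε = M^E/N^d ≤ M^E/N (as d ≥ 1), this T makes 4εL ≤ 4M^E/T < 1.
    -- Pigeonhole picks a rich cell.
    set T := ⌈M ^ (E + 5)⌉₊ with hT
    have hT1 : M ^ (E + 5) ≤ T := Nat.le_ceil _
    have hMp : (1 : ℝ) ≤ M ^ (E + 5) := one_le_pow₀ hM1
    have hTone : (1 : ℝ) ≤ T := hMp.trans hT1
    have hTpos : 0 < T := by exact_mod_cast (zero_lt_one.trans_le hTone)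
    have hT2 : (T : ℝ) ≤ M ^ (E + 6) := by
      have : (T : ℝ) < M ^ (E + 5) + 1 := Nat.ceil_lt_add_one (by positivity)
      have e : M ^ (E + 6) = M ^ (E + 5) * M := by ring
      nlinarith
    obtain ⟨i, -, hi⟩ := Finset.exists_le_card_fiber_of_nsmul_le_card_of_maps_to (s := H)
      (t := Finset.range T) (f := fun h => h * T / N) (b := (H.card : ℝ) / T)
      (by
        intro h hh
        have : h < N := Finset.mem_range.mp (hHN hh)
        rw [Finset.mem_range]
        apply Nat.div_lt_of_lt_mul
        exact Nat.mul_lt_mul_of_pos_right this hTpos)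
      ⟨0, Finset.mem_range.mpr hTpos⟩
      (by rw [Finset.card_range, nsmul_eq_mul]; field_simp; exact le_rfl)
    set H' := H.filter (fun h => h * T / N = i) with hH'
    set k : ℝ := (H'.card : ℝ) with hk
    have hTp : (0 : ℝ) < T := by linarith
    have hME : (0 : ℝ) < M ^ E := by positivity
    have hk1 : (N : ℝ) ≤ M ^ (2 * E + 6) * k := by
      have h1 : (H.card : ℝ) ≤ T * k := by
        rw [div_le_iff₀ hTp] at hi; linarith
      calc (N : ℝ) ≤ M ^ E * (T * k) := hcard.trans (by gcongr)
        _ ≤ M ^ E * (M ^ (E + 6) * k) := by gcongr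
        _ = M ^ (2 * E + 6) * k := by ring
    have hk4 : 4 ≤ k := by
      have h1 : M ^ (2 * E + 8) < M ^ (2 * E + 6) * k := hsmall.trans_le hk1
      have e : M ^ (2 * E + 8) = M ^ (2 * E + 6) * M ^ 2 := by ring
      rw [e] at h1
      have := lt_of_mul_lt_mul_left h1 (by positivity)
      nlinarith
    have hk2 : (N : ℝ) ≤ M ^ (2 * E + 7) * (k - 1) := by
      have e : M ^ (2 * E + 7) = M ^ (2 * E + 6) * M := by ring
      rw [e]
      have : k ≤ M * (k - 1) := by nlinarith
      calc (N : ℝ) ≤ M ^ (2 * E + 6) * k := hk1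
        _ ≤ M ^ (2 * E + 6) * (M * (k - 1)) := by gcongr
        _ = _ := by ring
    have hNd : (N : ℝ) ≤ N ^ d := le_self_pow₀ (by exact_mod_cast hN) (by omega)
    obtain ⟨q, hq1, c, hqL, hqε⟩ := exists_approx_of_many (γ := γ) (ε := M ^ E / N ^ d)
      (L := N / T) H' a (fun h hh => ha h (Finset.mem_filter.mp hh).1)
      (by
        intro h hh h' hh'
        have e1 := (Finset.mem_filter.mp hh).2
        have e2 := (Finset.mem_filter.mp hh').2
        rw [le_div_iff₀ hTp]
        have m1 := Nat.div_add_mod (h * T) N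
        have m2 := Nat.div_add_mod (h' * T) N
        have l1 := Nat.mod_lt (h * T) (by omega : N > 0)
        have l2 := Nat.mod_lt (h' * T) (by omega : N > 0)
        rw [e1] at m1; rw [e2] at m2
        generalize h * T % N = r₁ at m1 l1
        generalize h' * T % N = r₂ at m2 l2
        zify at m1 m2 l1 l2
        have : |((h : ℤ) - h') * T| ≤ N := by
          rw [abs_le, sub_mul]
          constructor <;> linarith [Int.natCast_nonneg r₁, Int.natCast_nonneg r₂]
        have hTz : |(T : ℤ)| = T := abs_of_nonneg (by positivity)
        rw [abs_mul, hTz] at this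
        exact_mod_cast this)
      (by
        have : M ^ E / N ^ d ≤ M ^ E / N := by gcongr
        calc 4 * (M ^ E / N ^ d) * (N / T) ≤ 4 * (M ^ E / N) * (N / T) := by gcongr
          _ = 4 * M ^ E / T := by field_simp
          _ < 1 := by
            rw [div_lt_one hTp]
            refine lt_of_lt_of_le ?_ hT1
            rw [pow_add, mul_comm]
            gcongr
            calc (4 : ℝ) < 2 ^ 5 := by norm_num
              _ ≤ M ^ 5 := by gcongr)
      (by
        have : (2 : ℝ) ≤ (H'.card : ℝ) := by linarith
        exact_mod_cast this)
    rw [← hk] at hqL hqε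
    have hk0 : 0 < k - 1 := by linarith
    refine ⟨q, hq1, ?_, c, ?_⟩
    · have h1 : (q : ℝ) * (k - 1) ≤ M ^ (2 * E + 7) * (k - 1) := by
        refine hqL.trans (le_trans ?_ hk2)
        exact div_le_self hNpos.le hTone
      refine (le_of_mul_le_mul_right h1 hk0).trans (pow_le_pow_right₀ hM1 ?_)
      nlinarith [Nat.zero_le ((2 * E + 8) * d)]
    · have h1 : M ^ (3 * E + 8) / N ^ (d + 1) ≤
          M ^ ((2 * E + 8) * (d + 1) + (3 * E + 8)) / N ^ (d + 1) := by
        gcongr ?_ / _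
        refine pow_le_pow_right₀ hM1 ?_
        omega
      refine le_trans ?_ h1
      rw [le_div_iff₀ (by positivity), pow_succ]
      have h2 : |q * γ - c| * N ≤ M ^ (2 * E + 7) * (2 * (M ^ E / N ^ d)) :=
        calc |q * γ - c| * N ≤ |q * γ - c| * (M ^ (2 * E + 7) * (k - 1)) := by gcongr
          _ = M ^ (2 * E + 7) * (|q * γ - c| * (k - 1)) := by ring
          _ ≤ _ := by gcongr
      calc |q * γ - c| * (N ^ d * N) = |q * γ - c| * N * N ^ d := by ring
        _ ≤ M ^ (2 * E + 7) * (2 * (M ^ E / N ^ d)) * N ^ d := by gcongr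
        _ = 2 * M ^ (3 * E + 7) := by field_simp; ring
        _ ≤ M * M ^ (3 * E + 7) := by gcongr
        _ = M ^ (3 * E + 8) := by ring

/-! ### Van der Corput differencing and the inverse Weyl inequality. -/

open Polynomial in
lemma taylor_coeff_top {R : Type*} [CommRing R] (f : R[X]) {d : ℕ} (hf : f.natDegree ≤ d + 1)
    (h : R) : (taylor h f).coeff (d + 1) = f.coeff (d + 1) := by
  rw [taylor_coeff, eval_eq_sum_range' (n := 1) (by
    refine lt_of_le_of_lt (natDegree_hasseDeriv_le f (d + 1)) ?_; omega)]
  simp [hasseDeriv_coeff]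

open Polynomial in
lemma taylor_coeff_subtop {R : Type*} [CommRing R] (f : R[X]) {d : ℕ} (hf : f.natDegree ≤ d + 1)
    (h : R) : (taylor h f).coeff d = f.coeff d + (d + 1) * h * f.coeff (d + 1) := by
  rw [taylor_coeff, eval_eq_sum_range' (n := 2) (by
    refine lt_of_le_of_lt (natDegree_hasseDeriv_le f d) ?_; omega)]
  simp [hasseDeriv_coeff, Finset.sum_range_succ, add_comm 1 d]
  ring

open Polynomial in
lemma natDegree_taylor_sub_le {R : Type*} [CommRing R] (f : R[X]) {d : ℕ}
    (hf : f.natDegree ≤ d + 1) (h : R) : (taylor h f - f).natDegree ≤ d := by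
  rw [natDegree_le_iff_coeff_eq_zero]
  intro m hm
  rw [coeff_sub]
  rcases eq_or_lt_of_le (Nat.succ_le_of_lt hm) with h1 | h1
  · rw [← h1]; simp only [Nat.succ_eq_add_one]; rw [taylor_coeff_top f hf, sub_self]
  · rw [coeff_eq_zero_of_natDegree_lt (by rw [natDegree_taylor]; omega),
      coeff_eq_zero_of_natDegree_lt (p := f) (by omega), sub_zero]

/-- Van der Corput differencing. -/
lemma norm_sum_sq_le (v : ℕ → ℂ) (N : ℕ) :
    ‖∑ j ∈ Finset.range N, v j‖ ^ 2 ≤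
      2 * ∑ h ∈ Finset.range N,
        ‖∑ j ∈ Finset.range (N - h), v (j + h) * (starRingEnd ℂ) (v j)‖ := by
  -- An exact identity: doubling the real part counts the diagonal h = 0 twice, which accounts for
  -- the extra ∑‖v j‖².
  have key : ∀ N : ℕ, ‖∑ j ∈ Finset.range N, v j‖ ^ 2 + ∑ j ∈ Finset.range N, ‖v j‖ ^ 2 =
      2 * (∑ h ∈ Finset.range N,
        ∑ j ∈ Finset.range (N - h), v (j + h) * (starRingEnd ℂ) (v j)).re := by
    intro N
    induction N with
    | zero => simp
    | succ N ih =>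
      have e : ∑ h ∈ Finset.range (N + 1),
          ∑ j ∈ Finset.range (N + 1 - h), v (j + h) * (starRingEnd ℂ) (v j) =
          (∑ h ∈ Finset.range N, ∑ j ∈ Finset.range (N - h), v (j + h) * (starRingEnd ℂ) (v j)) +
          v N * (starRingEnd ℂ) (∑ j ∈ Finset.range (N + 1), v j) := by
        have e1 : ∀ h ∈ Finset.range (N + 1),
            ∑ j ∈ Finset.range (N + 1 - h), v (j + h) * (starRingEnd ℂ) (v j) =
            ∑ j ∈ Finset.range (N - h), v (j + h) * (starRingEnd ℂ) (v j) +
              v N * (starRingEnd ℂ) (v (N - h)) := by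
          intro h hh
          have hle : h ≤ N := Nat.lt_succ_iff.mp (Finset.mem_range.mp hh)
          rw [Nat.succ_sub hle, Finset.sum_range_succ, Nat.sub_add_cancel hle]
        rw [Finset.sum_congr rfl e1, Finset.sum_add_distrib]
        congr 1
        · rw [Finset.sum_range_succ]; simp
        · rw [map_sum, Finset.mul_sum]
          exact Finset.sum_range_reflect (fun j => v N * (starRingEnd ℂ) (v j)) (N + 1)
      rw [e, Complex.add_re, mul_add, ← ih, Finset.sum_range_succ, Finset.sum_range_succ]
      simp only [← Complex.normSq_eq_norm_sq, Complex.normSq_apply, map_add, Complex.add_re,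
        Complex.add_im, Complex.mul_re, Complex.conj_re, Complex.conj_im]
      ring
  have h1 := key N
  have h2 : (0 : ℝ) ≤ ∑ j ∈ Finset.range N, ‖v j‖ ^ 2 := Finset.sum_nonneg fun _ _ => by positivity
  have h3 := (Complex.re_le_norm (∑ h ∈ Finset.range N,
        ∑ j ∈ Finset.range (N - h), v (j + h) * (starRingEnd ℂ) (v j))).trans (norm_sum_le _ _)
  linarith

/-- Geometric-type sums: a `Q`-periodic bounded sequence twisted by a non-resonant character. -/
lemma norm_sum_periodic_mul_unitExp_le {ρ : ℕ → ℂ} {Q : ℕ} (hρ : ∀ j, ρ (j + Q) = ρ j)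
    (hb : ∀ j, ‖ρ j‖ ≤ 1) (z : ℝ) (N : ℕ) :
    ‖∑ j ∈ Finset.range N, ρ j * unitExp (j * z)‖ * ‖1 - unitExp (Q * z)‖ ≤ 2 * Q := by
  set v : ℕ → ℂ := fun j => ρ j * unitExp (j * z) with hv
  have hvb : ∀ j, ‖v j‖ ≤ 1 := fun j => by
    rw [hv]; simp only [norm_mul, norm_unitExp, mul_one]; exact hb j
  have hshift : ∀ j, v j * unitExp (Q * z) = v (j + Q) := fun j => by
    simp only [hv]
    rw [hρ, mul_assoc, ← unitExp_add]
    congr 2; push_cast; ring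
  -- Multiplication by e(Qz) shifts the index by Q, so only two stretches of length Q survive.
  have e : (∑ j ∈ Finset.range N, v j) * (1 - unitExp (Q * z)) =
      ∑ j ∈ Finset.range Q, v j - ∑ j ∈ Finset.range Q, v (N + j) := by
    rw [mul_sub, mul_one, Finset.sum_mul, Finset.sum_congr rfl fun j _ => hshift j]
    have h1 := Finset.sum_range_add v N Q
    have h2 := Finset.sum_range_add v Q N
    rw [add_comm Q N] at h2
    simp only [add_comm Q] at h2
    rw [h1] at h2
    linear_combination h2
  rw [← norm_mul, e]
  refine (norm_sub_le _ _).trans ?_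
  have h1 : ∀ w : ℕ → ℕ, ‖∑ j ∈ Finset.range Q, v (w j)‖ ≤ Q := fun w => by
    refine (norm_sum_le _ _).trans ?_
    refine (Finset.sum_le_sum fun j _ => hvb (w j)).trans ?_
    simp
  have h2 := h1 id
  have h3 := h1 (fun j => N + j)
  simp only [id] at h2
  linarith

lemma norm_sum_unitExp_le (f : ℕ → ℝ) (N : ℕ) :
    ‖∑ j ∈ Finset.range N, unitExp (f j)‖ ≤ N := by
  refine (norm_sum_le _ _).trans ?_
  simp [norm_unitExp]

open Polynomial in
/-- Weyl's inequality in inverse form: a large exponential sum forces the top coefficient of the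
phase to be close to a rational number with small denominator. -/
lemma exists_approx_of_large_sum (d : ℕ) : ∃ C : ℕ, ∀ M : ℝ, 2 ≤ M → ∀ f : ℝ[X],
    f.natDegree ≤ d + 1 → ∀ N : ℕ, 1 ≤ N →
    (N : ℝ) ≤ M * ‖∑ j ∈ Finset.range N, unitExp (f.eval (j : ℝ))‖ →
    ∃ b : ℕ, 1 ≤ b ∧ (b : ℝ) ≤ M ^ C ∧
      ∃ a : ℤ, |b * f.coeff (d + 1) - a| ≤ M ^ C / N ^ (d + 1) := by
  induction d with
  | zero =>
    refine ⟨1, fun M hM f hf N hN hS => ⟨1, le_rfl, by simp; linarith, round (f.coeff 1), ?_⟩⟩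
    simp only [Nat.cast_one, one_mul, zero_add, pow_one]
    set α := f.coeff 1
    set τ := α - round α with hτ
    have hNpos : (0 : ℝ) < N := by exact_mod_cast hN
    have e : ∀ j : ℕ, unitExp (f.eval (j : ℝ)) = unitExp (f.coeff 0) * (1 * unitExp (j * τ)) := by
      intro j
      have : f.eval (j : ℝ) = f.coeff 0 + (j * τ + ((j * round α : ℤ) : ℝ)) := by
        rw [eval_eq_sum_range' (n := 2) (by omega), Finset.sum_range_succ, Finset.sum_range_one,
          hτ]
        push_cast; ring
      rw [this, unitExp_add, unitExp_add_intCast, one_mul]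
    have h1 := norm_sum_periodic_mul_unitExp_le (ρ := fun _ => 1) (Q := 1) (fun _ => rfl)
      (by simp) τ N
    rw [Finset.sum_congr rfl fun j _ => e j, ← Finset.mul_sum, norm_mul, norm_unitExp,
      one_mul] at hS
    have h2 := le_norm_unitExp_sub_one (abs_sub_round α)
    rw [← hτ] at h2
    simp only [Nat.cast_one, one_mul, mul_one] at h1 hS
    rw [le_div_iff₀ hNpos]
    set S := ‖∑ j ∈ Finset.range N, unitExp (j * τ)‖
    have h3 : S * (4 * |τ|) ≤ 2 := le_trans (by gcongr) h1
    have h4 : |τ| * N ≤ |τ| * (M * S) := by gcongr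
    nlinarith
  | succ d ih =>
    obtain ⟨C, ih⟩ := ih
    -- One exponent serves both hypotheses below: the density needs 4C + 4, the error 4C + 4d + 4.
    obtain ⟨C', hC'⟩ := exists_approx_of_dense (8 * C + 4 * d + 8) (d + 1) (by omega)
    refine ⟨C' + 4 * C + d + 2, fun M hM f hf N hN hS => ?_⟩
    have hM1 : 1 ≤ M := by linarith
    have hNpos : (0 : ℝ) < N := by exact_mod_cast hN
    set S := ‖∑ j ∈ Finset.range N, unitExp (f.eval (j : ℝ))‖ with hSdef
    set D : ℕ → ℝ := fun h => ‖∑ j ∈ Finset.range (N - h),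
      unitExp ((taylor (h : ℝ) f - f).eval (j : ℝ))‖ with hD
    have hvdc : S ^ 2 ≤ 2 * ∑ h ∈ Finset.range N, D h := by
      refine (norm_sum_sq_le (fun j => unitExp (f.eval (j : ℝ))) N).trans_eq ?_
      congr 1
      refine Finset.sum_congr rfl fun h _ => ?_
      rw [hD]; simp only
      congr 1
      refine Finset.sum_congr rfl fun j _ => ?_
      rw [← unitExp_sub, eval_sub, taylor_eval]
      push_cast; rfl
    have hDle : ∀ h, D h ≤ N := fun h => by
      refine (norm_sum_unitExp_le _ _).trans ?_
      exact_mod_cast Nat.sub_le N h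
    have hDle' : ∀ h, D h ≤ (N - h : ℕ) := fun h => norm_sum_unitExp_le _ _
    -- The shifts whose differenced sum is still large. Since each D h ≤ N, the bound on S² leaves
    -- at least N/(4M²) of them.
    set H := (Finset.range N).filter (fun h => (N : ℝ) ≤ 4 * M ^ 2 * D h) with hH
    have hHcard : (N : ℝ) ≤ 4 * M ^ 2 * H.card := by
      have h1 : ∑ h ∈ Finset.range N, D h ≤ H.card * N + N * (N / (4 * M ^ 2)) := by
        rw [← Finset.sum_filter_add_sum_filter_not _ (fun h => (N : ℝ) ≤ 4 * M ^ 2 * D h)]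
        refine add_le_add ?_ ?_
        · refine (Finset.sum_le_sum fun h _ => hDle h).trans ?_
          simp [hH]
        · refine (Finset.sum_le_sum (g := fun _ => (N : ℝ) / (4 * M ^ 2)) fun h hh => ?_).trans ?_
          · have := (Finset.mem_filter.mp hh).2
            rw [le_div_iff₀ (by positivity)]; linarith
          · rw [Finset.sum_const, nsmul_eq_mul]
            gcongr
            refine (Finset.card_filter_le _ _).trans ?_
            simp
      have h2 : (N : ℝ) ^ 2 ≤ M ^ 2 * S ^ 2 := by
        rw [← mul_pow]; gcongr
      have h3 : (N : ℝ) ^ 2 ≤ M ^ 2 * (2 * (H.card * N + N * (N / (4 * M ^ 2)))) := by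
        refine h2.trans ?_
        gcongr
        linarith
      have h4 : M ^ 2 * (2 * (H.card * N + N * (N / (4 * M ^ 2)))) =
          2 * M ^ 2 * H.card * N + N ^ 2 / 2 := by field_simp; ring
      rw [h4] at h3
      have h5 : (N : ℝ) * N ≤ 4 * M ^ 2 * H.card * N := by nlinarith
      exact le_of_mul_le_mul_right h5 hNpos
    have hM4 : 4 * M ^ 2 ≤ M ^ 4 := by
      have : 0 ≤ M ^ 2 * (M ^ 2 - 4) := mul_nonneg (sq_nonneg M) (by nlinarith)
      nlinarith
    -- Differencing by h lowers the degree by one and has top coefficient (d+2)·h·α, with α the top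
    -- coefficient of f. The induction hypothesis therefore controls multiples of hα.
    have hstep : ∀ h ∈ H, ∃ b : ℕ, 1 ≤ b ∧ (b : ℝ) ≤ M ^ (4 * C) ∧ ∃ a : ℤ,
        |b * ((d + 2) * h * f.coeff (d + 2)) - a| ≤ M ^ (4 * C + 4 * d + 4) / N ^ (d + 1) := by
      intro h hh
      obtain ⟨hh1, hh2⟩ := Finset.mem_filter.mp hh
      have hlt := Finset.mem_range.mp hh1
      have hpos : (0 : ℝ) < (N - h : ℕ) := by exact_mod_cast Nat.sub_pos_of_lt hlt
      -- A large D h forces N - h to be comparable to N, so powers of N - h may be traded for powers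
      -- of N.
      have hNh : (N : ℝ) ≤ M ^ 4 * (N - h : ℕ) := by
        refine hh2.trans ?_
        have := hDle' h
        have h0 : 0 ≤ D h := norm_nonneg _
        gcongr
      have hNN : ((N - h : ℕ) : ℝ) ≤ N := by exact_mod_cast Nat.sub_le N h
      obtain ⟨b, hb1, hb2, a, ha⟩ := ih (M ^ 4) (by nlinarith [pow_le_pow_left₀ (by norm_num) hM 4])
        (taylor (h : ℝ) f - f) (natDegree_taylor_sub_le f hf _) (N - h) (Nat.sub_pos_of_lt hlt)
        (by
          refine hNN.trans (hh2.trans ?_)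
          have h0 : 0 ≤ D h := norm_nonneg _
          gcongr)
      refine ⟨b, hb1, by rw [pow_mul]; exact hb2, a, ?_⟩
      rw [coeff_sub, taylor_coeff_subtop f hf] at ha
      have e : (b : ℝ) * ((d + 2) * h * f.coeff (d + 2)) =
          b * (f.coeff (d + 1) + ((d + 1 : ℕ) + 1) * h * f.coeff (d + 1 + 1) - f.coeff (d + 1)) := by
        push_cast; ring
      rw [e]
      refine ha.trans ?_
      rw [div_le_div_iff₀ (by positivity) (by positivity)]
      calc (M ^ 4) ^ C * N ^ (d + 1) ≤ (M ^ 4) ^ C * (M ^ 4 * (N - h : ℕ)) ^ (d + 1) := by gcongr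
        _ = _ := by rw [mul_pow]; ring
    choose! bf hb1 hb2 af haf using hstep
    set T := ⌊M ^ (4 * C)⌋₊ with hT
    have hT2 : (T : ℝ) ≤ M ^ (4 * C) := Nat.floor_le (by positivity)
    have hTpos : 0 < T := Nat.floor_pos.mpr (one_le_pow₀ hM1)
    have hTp : (0 : ℝ) < T := by exact_mod_cast hTpos
    -- Pigeonhole on the denominator: a single b serves a dense set of h, so the multiples of the
    -- fixed number b(d+2)α are near integers.
    obtain ⟨b, hbT, hbcard⟩ := Finset.exists_le_card_fiber_of_nsmul_le_card_of_maps_to (s := H)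
      (t := Finset.Icc 1 T) (f := bf) (b := (H.card : ℝ) / T)
      (fun h hh => Finset.mem_Icc.mpr ⟨hb1 h hh, Nat.le_floor (hb2 h hh)⟩)
      ⟨1, Finset.mem_Icc.mpr ⟨le_rfl, hTpos⟩⟩
      (by rw [Nat.card_Icc, nsmul_eq_mul, Nat.add_sub_cancel]; field_simp; exact le_rfl)
    set H' := H.filter (fun h => bf h = b) with hH'
    obtain ⟨q, hq1, hq2, c, hc⟩ := hC' M hM N hN (b * ((d + 2) * f.coeff (d + 2))) H' af
      ((Finset.filter_subset _ _).trans (Finset.filter_subset _ _))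
      (by
        rw [div_le_iff₀ hTp] at hbcard
        calc (N : ℝ) ≤ 4 * M ^ 2 * H.card := hHcard
          _ ≤ M ^ 4 * (H'.card * M ^ (4 * C)) := by
            gcongr
            exact hbcard.trans (by gcongr)
          _ = M ^ (4 * C + 4) * H'.card := by ring
          _ ≤ _ := mul_le_mul_of_nonneg_right (pow_le_pow_right₀ hM1 (by omega))
              (Nat.cast_nonneg _))
      (by
        intro h hh
        obtain ⟨hh1, hh2⟩ := Finset.mem_filter.mp hh
        have := haf h hh1
        rw [hh2] at this
        have e : (h : ℝ) * (b * ((d + 2) * f.coeff (d + 2))) =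
          b * ((d + 2) * h * f.coeff (d + 2)) := by ring
        rw [e]
        refine this.trans ?_
        gcongr ?_ / _
        exact pow_le_pow_right₀ hM1 (by omega))
    have hbT' := Finset.mem_Icc.mp hbT
    have hd2 : ((d + 2 : ℕ) : ℝ) ≤ M ^ (d + 2) := by
      calc ((d + 2 : ℕ) : ℝ) ≤ 2 ^ (d + 2) := by exact_mod_cast (Nat.lt_two_pow_self).le
        _ ≤ M ^ (d + 2) := by gcongr
    refine ⟨q * b * (d + 2), Nat.mul_pos (Nat.mul_pos hq1 hbT'.1) (by omega), ?_, c, ?_⟩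
    · have hbR : (b : ℝ) ≤ M ^ (4 * C) := le_trans (by exact_mod_cast hbT'.2) hT2
      calc ((q * b * (d + 2) : ℕ) : ℝ) = q * b * (d + 2 : ℕ) := by push_cast; ring
        _ ≤ M ^ C' * M ^ (4 * C) * M ^ (d + 2) := by gcongr
        _ = M ^ (C' + 4 * C + d + 2) := by ring
    · have e : ((q * b * (d + 2) : ℕ) : ℝ) * f.coeff (d + 1 + 1) - c =
          q * (b * ((d + 2) * f.coeff (d + 2))) - c := by push_cast; ring
      rw [e]
      refine hc.trans ?_
      gcongr ?_ / _
      exact pow_le_pow_right₀ hM1 (by omega)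

/-! ### Rational top coefficient and the exponential sums of the problem. -/

lemma sum_range_eq_sum_residues (v : ℕ → ℂ) (N : ℕ) {q : ℕ} (hq : 0 < q) :
    ∑ j ∈ Finset.range N, v j =
      ∑ r ∈ Finset.range q, ∑ l ∈ Finset.range ((N + q - 1 - r) / q), v (q * l + r) := by
  rw [Finset.sum_sigma']
  -- (N + q - 1 - r)/q is the ceiling of (N - r)/q; the subtraction does not truncate because r < q.
  have key : ∀ r l, r < q → (l < (N + q - 1 - r) / q ↔ q * l + r < N) := fun r l hr => by
    rw [← Nat.succ_le_iff, Nat.le_div_iff_mul_le hq, Nat.succ_mul, mul_comm l q]; omega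
  refine Finset.sum_nbij' (fun j => ⟨j % q, j / q⟩) (fun s => q * s.2 + s.1) ?_ ?_ ?_ ?_ ?_
  · intro j hj
    have hr := Nat.mod_lt j hq
    simp only [Finset.mem_sigma, Finset.mem_range]
    exact ⟨hr, (key _ _ hr).mpr (by rw [Nat.div_add_mod]; exact Finset.mem_range.mp hj)⟩
  · rintro ⟨r, l⟩ hs
    simp only [Finset.mem_sigma, Finset.mem_range] at hs ⊢
    exact (key _ _ hs.1).mp hs.2
  · intro j _
    exact Nat.div_add_mod j q
  · rintro ⟨r, l⟩ hs
    simp only [Finset.mem_sigma, Finset.mem_range] at hs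
    simp only [Nat.mul_add_mod, Nat.mod_eq_of_lt hs.1, Nat.mul_add_div hq,
      Nat.div_eq_of_lt hs.1, add_zero]
  · intro j _
    simp only [Nat.div_add_mod]

open Polynomial in
/-- If the top coefficient of the phase is rational, a large exponential sum forces the next
coefficient to be close to a rational number with small denominator. -/
lemma exists_approx_of_large_sum_of_rational_top (d q : ℕ) (hq : 0 < q) : ∃ C : ℕ,
    ∀ M : ℝ, 2 ≤ M → ∀ F : ℝ[X], F.natDegree ≤ d + 2 → ∀ m : ℤ, q * F.coeff (d + 2) = m →
    ∀ N : ℕ, 1 ≤ N → (N : ℝ) ≤ M * ‖∑ j ∈ Finset.range N, unitExp (F.eval (j : ℝ))‖ →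
    ∃ b : ℕ, 1 ≤ b ∧ (b : ℝ) ≤ M ^ C ∧
      ∃ a : ℤ, |b * F.coeff (d + 1) - a| ≤ M ^ C / N ^ (d + 1) := by
  obtain ⟨C₁, hC⟩ := exists_approx_of_large_sum d
  refine ⟨(q + 1) * C₁ + (q + 1) * (d + 1), fun M hM F hF m hm N hN hS => ?_⟩
  have hM1 : 1 ≤ M := by linarith
  have hqp : (0 : ℝ) < q := by exact_mod_cast hq
  have hq1 : (1 : ℝ) ≤ q := by exact_mod_cast hq
  have hNpos : (0 : ℝ) < N := by exact_mod_cast hN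
  have hqM : (q : ℝ) ≤ M ^ q := by
    calc (q : ℝ) ≤ 2 ^ q := by exact_mod_cast (Nat.lt_two_pow_self).le
      _ ≤ M ^ q := by gcongr
  have hMq : M * q ≤ M ^ (q + 1) := by
    rw [pow_succ, mul_comm]; gcongr
  set S := ‖∑ j ∈ Finset.range N, unitExp (F.eval (j : ℝ))‖ with hSdef
  -- On a residue class j = ql + r the top term becomes an integer multiple of l^{d+2} and drops out
  -- of the character. The phase then has degree d + 1, and its leading coefficient is q^{d+1} times
  -- the old one plus an integer.
  obtain ⟨r, -, hr⟩ : ∃ r ∈ Finset.range q, S / q ≤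
      ‖∑ l ∈ Finset.range ((N + q - 1 - r) / q), unitExp (F.eval ((q * l + r : ℕ) : ℝ))‖ := by
    apply Finset.exists_le_of_sum_le ⟨0, Finset.mem_range.mpr hq⟩
    rw [Finset.sum_const, Finset.card_range, nsmul_eq_mul, mul_div_cancel₀ _ hqp.ne', hSdef,
      sum_range_eq_sum_residues _ N hq]
    exact norm_sum_le _ _
  set N' := (N + q - 1 - r) / q with hN'
  set G := (taylor (r : ℝ) F).comp (C (q : ℝ) * X) with hG
  set c : ℝ := q ^ (d + 2) * F.coeff (d + 2) with hc
  have hcint : c = ((q ^ (d + 1) * m : ℤ) : ℝ) := by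
    push_cast; rw [hc, ← hm]; ring
  have hGcoeff : ∀ i, G.coeff i = q ^ i * (taylor (r : ℝ) F).coeff i := fun i => by
    rw [hG, comp_C_mul_X_coeff, mul_comm]
  set G' := G - C c * X ^ (d + 2) with hG'
  have hdeg : G'.natDegree ≤ d + 1 := by
    rw [natDegree_le_iff_coeff_eq_zero]
    intro i hi
    rw [hG', coeff_sub, hGcoeff, coeff_C_mul, coeff_X_pow]
    rcases eq_or_lt_of_le (Nat.succ_le_of_lt hi) with h1 | h1
    · have h2 : i = d + 1 + 1 := by omega
      subst h2
      rw [taylor_coeff_top F hF]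
      simp [hc]
    · rw [coeff_eq_zero_of_natDegree_lt (by rw [natDegree_taylor]; omega), if_neg (by omega)]
      simp
  have heval : ∀ l : ℕ, unitExp (F.eval ((q * l + r : ℕ) : ℝ)) = unitExp (G'.eval (l : ℝ)) := by
    intro l
    have e : F.eval ((q * l + r : ℕ) : ℝ) = G'.eval (l : ℝ) +
        ((q ^ (d + 1) * m * l ^ (d + 2) : ℤ) : ℝ) := by
      rw [hG', eval_sub, hG, eval_comp, taylor_eval, hcint]
      simp only [eval_mul, eval_C, eval_X, eval_pow]
      push_cast; ring
    rw [e, unitExp_add_intCast]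
  simp only [heval] at hr
  set S' := ‖∑ l ∈ Finset.range N', unitExp (G'.eval (l : ℝ))‖ with hS'
  have hS'N : S' ≤ N' := norm_sum_unitExp_le _ _
  have hNS' : (N : ℝ) ≤ M ^ (q + 1) * S' := by
    rw [div_le_iff₀ hqp] at hr
    calc (N : ℝ) ≤ M * S := hS
      _ ≤ M * (S' * q) := by gcongr
      _ = (M * q) * S' := by ring
      _ ≤ _ := by
        have : 0 ≤ S' := norm_nonneg _
        gcongr
  have hN'pos : 0 < N' := by
    by_contra h0
    have h1 : N' = 0 := Nat.eq_zero_of_not_pos h0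
    rw [h1] at hS'N
    have h2 : (0 : ℝ) < M ^ (q + 1) := by positivity
    push_cast at hS'N
    nlinarith
  have hN'N : (N' : ℝ) ≤ N := by
    have : N' ≤ N := by
      rw [hN']
      apply Nat.div_le_of_le_mul
      have : 1 * (q - 1) ≤ N * (q - 1) := Nat.mul_le_mul_right _ hN
      obtain ⟨q', rfl⟩ : ∃ q', q = q' + 1 := ⟨q - 1, by omega⟩
      simp only [Nat.add_sub_cancel] at this
      have e : (q' + 1) * N = N * q' + N := by ring
      omega
    exact_mod_cast this
  obtain ⟨b, hb1, hb2, a, ha⟩ := hC (M ^ (q + 1))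
    (hM.trans (le_self_pow₀ hM1 (by omega))) G' hdeg N' hN'pos (hN'N.trans hNS')
  have hcoeff : G'.coeff (d + 1) = q ^ (d + 1) * F.coeff (d + 1) + q ^ d * (d + 2) * r * m := by
    rw [hG', coeff_sub, hGcoeff, coeff_C_mul, coeff_X_pow, if_neg (by omega),
      taylor_coeff_subtop F hF, ← hm]
    push_cast; ring
  refine ⟨b * q ^ (d + 1), Nat.mul_pos hb1 (pow_pos hq _), ?_, a - b * (q ^ d * (d + 2) * r * m), ?_⟩
  · push_cast
    calc (b : ℝ) * q ^ (d + 1) ≤ (M ^ (q + 1)) ^ C₁ * (M ^ q) ^ (d + 1) := by gcongr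
      _ = M ^ ((q + 1) * C₁ + q * (d + 1)) := by ring
      _ ≤ _ := pow_le_pow_right₀ hM1 (by gcongr; omega)
  · have e : ((b * q ^ (d + 1) : ℕ) : ℝ) * F.coeff (d + 1) -
        ((a - b * (q ^ d * (d + 2) * r * m) : ℤ) : ℝ) = b * G'.coeff (d + 1) - a := by
      rw [hcoeff]; push_cast; ring
    rw [e]
    refine ha.trans ?_
    have hN'p : (0 : ℝ) < N' := by exact_mod_cast hN'pos
    rw [div_le_div_iff₀ (by positivity) (by positivity)]
    have h1 : (N : ℝ) ≤ M ^ (q + 1) * N' := hNS'.trans (by gcongr)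
    calc (M ^ (q + 1)) ^ C₁ * N ^ (d + 1) ≤ (M ^ (q + 1)) ^ C₁ * (M ^ (q + 1) * N') ^ (d + 1) := by
          gcongr
      _ = _ := by rw [mul_pow]; ring

open Polynomial in
/-- The exponential sums attached to the problem at a rational time are small unless `θ` is close to a
rational number with small denominator. -/
lemma exists_approx_of_large_dispersive_sum {d : ℕ} (hd : 1 ≤ d) {P : ℤ[X]}
    (hP : P.natDegree = d + 2) {p q : ℕ} (hp : 0 < p) (hq : 0 < q) (θ : ℝ) : ∃ C : ℕ,
    ∀ M : ℝ, 2 ≤ M → ∀ ε : ℤ, ε * ε = 1 → ∀ (z : ℝ) (N : ℕ), 1 ≤ N →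
    (N : ℝ) ≤ M * ‖∑ j ∈ Finset.range N,
      unitExp (-(p / q : ℝ) * (P.map (Int.castRingHom ℝ)).eval (ε * j + θ) + ε * j * z)‖ →
    ∃ b : ℕ, 1 ≤ b ∧ (b : ℝ) ≤ M ^ C ∧ ∃ a : ℤ, |b * θ - a| ≤ M ^ C / N ^ (d + 1) := by
  obtain ⟨C₀, hC⟩ := exists_approx_of_large_sum_of_rational_top d q hq
  set A := P.coeff (d + 2) with hA
  have hA0 : A ≠ 0 := by
    rw [hA, ← hP]
    intro h0
    rw [coeff_natDegree, leadingCoeff_eq_zero] at h0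
    rw [h0] at hP; simp at hP
  -- Chosen so that M^κ dominates both the integer multiplier of θ and the cleared denominator q.
  set κ := p * (d + 2) * A.natAbs + q with hκ
  refine ⟨C₀ + κ, fun M hM ε hε z N hN hS => ?_⟩
  have hM1 : 1 ≤ M := by linarith
  have hqp : (0 : ℝ) < q := by exact_mod_cast hq
  have hNpos : (0 : ℝ) < N := by exact_mod_cast hN
  set Pr := P.map (Int.castRingHom ℝ) with hPr
  have hPrdeg : Pr.natDegree ≤ d + 2 := hP ▸ natDegree_map_le
  have hPrc : ∀ i, Pr.coeff i = P.coeff i := fun i => by rw [hPr, coeff_map]; rfl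
  set F := C (-(p / q : ℝ)) * (taylor θ Pr).comp (C (ε : ℝ) * X) + C (ε * z) * X with hF
  -- From degree 2 on the linear term in z is invisible. The index d + 1 used below qualifies
  -- because d ≥ 1, that is, n ≥ 3; this makes the estimate uniform in z.
  have hFc : ∀ i, 2 ≤ i → F.coeff i = -(p / q : ℝ) * ((taylor θ Pr).coeff i * ε ^ i) := by
    intro i hi
    rw [hF, coeff_add, coeff_C_mul, comp_C_mul_X_coeff, coeff_C_mul, coeff_X, if_neg (by omega)]
    ring
  have hFdeg : F.natDegree ≤ d + 2 := by
    rw [natDegree_le_iff_coeff_eq_zero]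
    intro i hi
    rw [hFc i (by omega), coeff_eq_zero_of_natDegree_lt (by rw [natDegree_taylor]; omega)]
    simp
  have htop : q * F.coeff (d + 2) = ((-(p * (A * ε ^ (d + 2))) : ℤ) : ℝ) := by
    rw [hFc _ (by omega), taylor_coeff_top Pr hPrdeg, hPrc]
    rw [← hA]; push_cast; field_simp
  obtain ⟨b, hb1, hb2, a, ha⟩ := hC M hM F hFdeg _ htop N hN (by
    refine hS.trans_eq ?_
    congr 2
    refine Finset.sum_congr rfl fun j _ => ?_
    congr 1
    rw [hF]
    simp only [eval_add, eval_mul, eval_C, eval_comp, eval_X, taylor_eval]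
    ring)
  have hκM : (κ : ℝ) ≤ M ^ κ := by
    calc (κ : ℝ) ≤ 2 ^ κ := by exact_mod_cast (Nat.lt_two_pow_self).le
      _ ≤ M ^ κ := by gcongr
  have hκsplit : (κ : ℝ) = p * (d + 2) * A.natAbs + q := by rw [hκ]; push_cast; ring
  have hnn : (0 : ℝ) ≤ p * (d + 2) * A.natAbs := by positivity
  -- The sign that turns the integer multiplying θ in the coefficient into a positive one, up to a
  -- global factor ±1.
  set s : ℤ := ε ^ (d + 1) * A.sign with hs
  have hε1 : ε ^ (d + 1) * ε ^ (d + 1) = 1 := by rw [← mul_pow, hε, one_pow]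
  have hsA : s * (ε ^ (d + 1) * A) = A.natAbs := by
    rw [hs]
    calc ε ^ (d + 1) * A.sign * (ε ^ (d + 1) * A) =
        (ε ^ (d + 1) * ε ^ (d + 1)) * (A.sign * A) := by ring
      _ = A.natAbs := by rw [hε1, one_mul, Int.sign_mul_self_eq_abs, Int.abs_eq_natAbs]
  have hsabs : |(s : ℝ)| = 1 := by
    have : |s| = 1 := by
      rw [hs, abs_mul, Int.abs_sign_of_ne_zero hA0, mul_one]
      have h2 : |ε ^ (d + 1)| * |ε ^ (d + 1)| = 1 := by rw [← abs_mul, hε1, abs_one]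
      nlinarith [abs_nonneg (ε ^ (d + 1))]
    exact_mod_cast this
  have hsAr : (s : ℝ) * (ε ^ (d + 1) * A) = A.natAbs := by
    have h2 : ((s * (ε ^ (d + 1) * A) : ℤ) : ℝ) = ((A.natAbs : ℤ) : ℝ) := by rw [hsA]
    simpa only [Int.cast_mul, Int.cast_pow, Int.cast_natCast] using h2
  refine ⟨b * (p * (d + 2) * A.natAbs),
    Nat.mul_pos hb1 (Nat.mul_pos (Nat.mul_pos hp (by omega)) (Int.natAbs_pos.mpr hA0)), ?_,
    -(s * (q * a + b * p * ε ^ (d + 1) * P.coeff (d + 1))), ?_⟩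
  · push_cast
    rw [pow_add]
    gcongr
    linarith
  · have e : ((b * (p * (d + 2) * A.natAbs) : ℕ) : ℝ) * θ -
        ((-(s * (q * a + b * p * ε ^ (d + 1) * P.coeff (d + 1))) : ℤ) : ℝ) =
        s * (-(q * (b * F.coeff (d + 1) - a))) := by
      rw [hFc _ (by omega), taylor_coeff_subtop Pr hPrdeg, hPrc, hPrc]
      push_cast
      rw [← hsAr, hA]
      field_simp
      ring
    rw [e, abs_mul, hsabs, one_mul, abs_neg, abs_mul, abs_of_pos hqp]
    have hqM : (q : ℝ) ≤ M ^ κ := by linarith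
    calc (q : ℝ) * |b * F.coeff (d + 1) - a| ≤ M ^ κ * (M ^ C₀ / N ^ (d + 1)) := by gcongr
      _ = M ^ (C₀ + κ) / N ^ (d + 1) := by ring

/-! ### Dyadic blocks with kernel 1/j. -/

/-- Summation by parts on a dyadic block. -/
lemma norm_sum_div_le {v : ℕ → ℂ} {δ : ℝ} {R : ℕ} (hR : 0 < R)
    (h : ∀ N, R ≤ N → N ≤ 2 * R → ‖∑ j ∈ Finset.range N, v j‖ ≤ δ * N) :
    ‖∑ j ∈ Finset.Ico R (2 * R), v j / j‖ ≤ 3 * δ := by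
  set V : ℕ → ℂ := fun N => ∑ j ∈ Finset.range N, v j with hV
  have hRp : (0 : ℝ) < R := by exact_mod_cast hR
  have hδ : 0 ≤ δ := by
    have := (norm_nonneg _).trans (h R le_rfl (by omega))
    by_contra hneg
    push Not at hneg
    nlinarith
  have key : ∀ m, R ≤ m → ∑ j ∈ Finset.Ico R m, v j / j =
      V m / m - V R / R + ∑ j ∈ Finset.Ico R m, V (j + 1) * (1 / j - 1 / (j + 1 : ℕ)) := by
    intro m hm
    induction m, hm using Nat.le_induction with
    | base => simp
    | succ m hm ih =>
      rw [Finset.sum_Ico_succ_top hm, Finset.sum_Ico_succ_top hm, ih]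
      have e : V (m + 1) = V m + v m := Finset.sum_range_succ _ _
      have h1 : (m : ℂ) ≠ 0 := by exact_mod_cast (by omega : m ≠ 0)
      have h2 : ((m + 1 : ℕ) : ℂ) ≠ 0 := by exact_mod_cast (by omega : m + 1 ≠ 0)
      rw [e]; field_simp; ring
  rw [key (2 * R) (by omega)]
  have hdiv : ∀ N : ℕ, R ≤ N → N ≤ 2 * R → ‖V N / N‖ ≤ δ := fun N h1 h2 => by
    have hNp : (0 : ℝ) < N := by exact_mod_cast (by omega : 0 < N)
    rw [norm_div, Complex.norm_natCast, div_le_iff₀ hNp]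
    exact h N h1 h2
  have h3 : ‖∑ j ∈ Finset.Ico R (2 * R), V (j + 1) * (1 / j - 1 / (j + 1 : ℕ))‖ ≤ δ := by
    calc _ ≤ ∑ j ∈ Finset.Ico R (2 * R), δ / R := by
          refine norm_sum_le_of_le _ fun j hj => ?_
          obtain ⟨hj1, hj2⟩ := Finset.mem_Ico.mp hj
          have hjp : (0 : ℝ) < j := by exact_mod_cast (by omega : 0 < j)
          have e : (1 / j - 1 / (j + 1 : ℕ) : ℂ) = ((1 / j - 1 / (j + 1 : ℕ) : ℝ) : ℂ) := by
            push_cast; rfl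
          have e2 : (1 / j - 1 / (j + 1 : ℕ) : ℝ) = 1 / (j * (j + 1 : ℕ)) := by
            push_cast; field_simp; ring
          rw [norm_mul, e, e2, Complex.norm_real, Real.norm_of_nonneg (by positivity)]
          calc _ ≤ δ * (j + 1 : ℕ) * (1 / (j * (j + 1 : ℕ))) := by
                gcongr; exact h _ (by omega) (by omega)
            _ = δ / j := by push_cast; field_simp
            _ ≤ δ / R := by gcongr
      _ = δ := by
          rw [Finset.sum_const, Nat.card_Ico, nsmul_eq_mul, two_mul, Nat.add_sub_cancel]
          field_simp
  have h1 := hdiv R le_rfl (by omega)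
  have h2 := hdiv (2 * R) (by omega) le_rfl
  calc _ ≤ ‖V (2 * R) / (2 * R : ℕ)‖ + ‖V R / R‖ + δ := by
        refine (norm_add_le _ _).trans (add_le_add (norm_sub_le _ _) h3)
    _ ≤ 3 * δ := by linarith

/-- The symmetric dyadic block `∑_{2^k ≤ |j| < 2^{k+1}} w_j e(jz) / j`. -/
def blockSum (w : ℤ → ℂ) (z : ℝ) (k : ℕ) : ℂ :=
  ∑ j ∈ Finset.Ico (2 ^ k : ℕ) (2 * 2 ^ k),
    (w j * unitExp (j * z) - w (-j) * unitExp (-(j * z))) / j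

lemma norm_sum_periodic_le {g : ℕ → ℂ} {Q : ℕ} (hQ : 0 < Q) (hg : ∀ j, g (j + Q) = g j)
    {c : ℝ} (hb : ∀ j, ‖g j‖ ≤ c) (h0 : ∑ j ∈ Finset.range Q, g j = 0) (N : ℕ) :
    ‖∑ j ∈ Finset.range N, g j‖ ≤ c * Q := by
  have hc : 0 ≤ c := (norm_nonneg _).trans (hb 0)
  induction N using Nat.strong_induction_on with
  | _ N ih =>
    by_cases h : N < Q
    · refine (norm_sum_le _ _).trans ((Finset.sum_le_sum fun j _ => hb j).trans ?_)
      rw [Finset.sum_const, Finset.card_range, nsmul_eq_mul, mul_comm]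
      gcongr
    · obtain ⟨m, rfl⟩ := Nat.exists_eq_add_of_le (not_lt.mp h)
      rw [Finset.sum_range_add, h0, zero_add,
        Finset.sum_congr rfl fun j _ => by rw [add_comm Q j, hg]]
      exact ih m (by omega)

lemma sum_Ico_dyadic_inv_le (k : ℕ) (c : ℝ) (hc : 0 ≤ c) :
    ∑ j ∈ Finset.Ico (2 ^ k : ℕ) (2 * 2 ^ k), c / (j : ℝ) ≤ c := by
  calc ∑ j ∈ Finset.Ico (2 ^ k : ℕ) (2 * 2 ^ k), c / (j : ℝ)
      ≤ ∑ j ∈ Finset.Ico (2 ^ k : ℕ) (2 * 2 ^ k), c / 2 ^ k := by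
        refine Finset.sum_le_sum fun j hj => ?_
        have h1 : ((2 ^ k : ℕ) : ℝ) ≤ j := by exact_mod_cast (Finset.mem_Ico.mp hj).1
        push_cast at h1
        gcongr
    _ = c := by
        rw [Finset.sum_const, Nat.card_Ico, nsmul_eq_mul, two_mul, Nat.add_sub_cancel]
        push_cast; field_simp

lemma norm_blockSum_sub_le {w w' : ℤ → ℂ} {z η : ℝ} {k : ℕ} (hη : 0 ≤ η)
    (h : ∀ j : ℤ, |(j : ℝ)| ≤ 2 * 2 ^ k → ‖w j - w' j‖ ≤ η) :
    ‖blockSum w z k - blockSum w' z k‖ ≤ 2 * η := by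
  rw [blockSum, blockSum, ← Finset.sum_sub_distrib]
  refine (norm_sum_le_of_le _ fun j hj => ?_).trans (sum_Ico_dyadic_inv_le k (2 * η) (by linarith))
  have hj2 : (j : ℝ) ≤ 2 * 2 ^ k := by exact_mod_cast (Finset.mem_Ico.mp hj).2.le
  have e : (w j * unitExp (j * z) - w (-j) * unitExp (-(j * z))) / j -
      (w' j * unitExp (j * z) - w' (-j) * unitExp (-(j * z))) / j =
      ((w j - w' j) * unitExp (j * z) - (w (-j) - w' (-j)) * unitExp (-(j * z))) / (j : ℂ) := by
    ring
  rw [e, norm_div, Complex.norm_natCast]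
  gcongr
  refine (norm_sub_le _ _).trans ?_
  rw [norm_mul, norm_mul, norm_unitExp, norm_unitExp, mul_one, mul_one]
  have h1 := h j (by simpa using hj2)
  have h2 := h (-j) (by simpa using hj2)
  linarith

/-- The upper end of the window: summing in steps of Q gives a geometric series of ratio e(τ), so
one-sided sums are O(Q/|τ|) and the weight 1/j gains 2^{-k}. -/
lemma norm_blockSum_periodic_mul_le {w : ℤ → ℂ} {Q : ℕ} (hw : ∀ j, w (j + Q) = w j)
    (hb : ∀ j, ‖w j‖ ≤ 1) {z τ : ℝ} {m : ℤ} (hz : Q * z = m + τ) (hτ : |τ| ≤ 1 / 2) (k : ℕ) :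
    ‖blockSum w z k‖ * (2 ^ k * |τ|) ≤ 3 * Q := by
  rcases eq_or_ne τ 0 with rfl | hτ0
  · simp
  have hτp : 0 < |τ| := abs_pos.mpr hτ0
  have h1 := le_norm_unitExp_sub_one hτ
  have hsum : ∀ (ρ : ℕ → ℂ) (y : ℝ) (N : ℕ), (∀ j, ρ (j + Q) = ρ j) → (∀ j, ‖ρ j‖ ≤ 1) →
      (‖1 - unitExp (Q * y)‖ = ‖1 - unitExp τ‖) →
      ‖∑ j ∈ Finset.range N, ρ j * unitExp (j * y)‖ ≤ Q / (2 * |τ|) := by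
    intro ρ y N hρ hρb hy
    have h2 := norm_sum_periodic_mul_unitExp_le hρ hρb y N
    rw [hy] at h2
    rw [le_div_iff₀ (by positivity)]
    have h3 : ‖∑ j ∈ Finset.range N, ρ j * unitExp (j * y)‖ * (4 * |τ|) ≤ 2 * Q :=
      le_trans (by gcongr) h2
    linarith
  have hplus := fun N => hsum (fun j => w j) z N (fun j => by push_cast; exact hw j)
    (fun j => hb j) (by rw [hz, add_comm, unitExp_add_intCast])
  have hminus := fun N => hsum (fun j => w (-j)) (-z) N
    (fun j => by
      have := hw (-(j + Q : ℕ))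
      rw [← this]; congr 1; push_cast; ring)
    (fun j => hb _) (by
      rw [mul_neg, hz, neg_add, add_comm, ← Int.cast_neg, unitExp_add_intCast, unitExp_neg,
        ← Complex.norm_conj (1 - unitExp τ)]
      simp)
  have hkey : ‖blockSum w z k‖ ≤ 3 * (Q / (2 ^ k * |τ|)) := by
    refine norm_sum_div_le (R := 2 ^ k) (by positivity) (v := fun j =>
      w j * unitExp (j * z) - w (-j) * unitExp (-(j * z))) fun N hN _ => ?_
    rw [Finset.sum_sub_distrib]
    refine (norm_sub_le _ _).trans ?_
    have h2 := hplus N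
    have h3 := hminus N
    simp only [mul_neg] at h3
    have hNR : ((2 : ℝ) ^ k) ≤ N := by exact_mod_cast hN
    calc _ ≤ Q / (2 * |τ|) + Q / (2 * |τ|) := add_le_add h2 h3
      _ = Q / (2 ^ k * |τ|) * 2 ^ k := by field_simp; ring
      _ ≤ _ := by gcongr
  calc _ ≤ 3 * (Q / (2 ^ k * |τ|)) * (2 ^ k * |τ|) := by gcongr
    _ = 3 * Q := by field_simp

lemma sum_range_periodic_neg {w : ℤ → ℂ} {Q : ℕ} (hw : ∀ j, w (j + Q) = w j) :
    ∑ j ∈ Finset.range Q, w (-(j : ℕ)) = ∑ j ∈ Finset.range Q, w (j : ℕ) := by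
  have e : ∀ j ∈ Finset.range Q, w (-j) = (fun i : ℕ => w (i + 1 : ℕ)) (Q - 1 - j) := by
    intro j hj
    have := Finset.mem_range.mp hj
    simp only
    rw [← hw (-j)]
    congr 1
    omega
  rw [Finset.sum_congr rfl e, Finset.sum_range_reflect (fun i : ℕ => w (i + 1 : ℕ)) Q]
  have h1 := Finset.sum_range_succ (fun i : ℕ => w (i : ℕ)) Q
  have h2 := Finset.sum_range_succ' (fun i : ℕ => w (i : ℕ)) Q
  have h3 : w (Q : ℕ) = w (0 : ℕ) := by simpa using hw 0
  rw [h1] at h2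
  rw [h3] at h2
  exact (add_right_cancel h2).symm

/-- The lower end of the window: at z = m/Q the character can be absorbed into the periodic weight,
and then the terms j and -j cancel over a full period. The actual z differs from m/Q by τ/Q, which
costs O(2^k|τ|). Without the symmetric pairing, a nonzero mean of the weight would keep the block
from decaying. -/
lemma norm_blockSum_periodic_le {w : ℤ → ℂ} {Q : ℕ} (hQ : 0 < Q) (hw : ∀ j, w (j + Q) = w j)
    (hb : ∀ j, ‖w j‖ ≤ 1) {z τ : ℝ} {m : ℤ} (hz : Q * z = m + τ) (k : ℕ) :
    ‖blockSum w z k‖ ≤ 6 * Q / 2 ^ k + 14 * (2 ^ k * |τ|) := by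
  have hQp : (0 : ℝ) < Q := by exact_mod_cast hQ
  have hQ1 : (1 : ℝ) ≤ Q := by exact_mod_cast hQ
  set w' : ℤ → ℂ := fun j => w j * unitExp (j * m / Q) with hw'def
  have hw' : ∀ j, w' (j + Q) = w' j := fun j => by
    simp only [hw'def]
    have e : ((j + Q : ℤ) : ℝ) * m / Q = j * m / Q + m := by push_cast; field_simp
    rw [hw, e, unitExp_add_intCast]
  have hb' : ∀ j, ‖w' j‖ ≤ 1 := fun j => by
    simp only [hw'def, norm_mul, norm_unitExp, mul_one]; exact hb j
  have hsplit : ∀ j : ℤ, w j * unitExp (j * z) = w' j * unitExp (j * τ / Q) := fun j => by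
    simp only [hw'def]
    rw [mul_assoc, ← unitExp_add]
    congr 2
    field_simp
    linear_combination (j : ℝ) * hz
  have hmain : ‖blockSum w' 0 k‖ ≤ 6 * Q / 2 ^ k := by
    -- Both j and -j run through all residues modulo Q.
    have h0 : ∑ j ∈ Finset.range Q, (w' (j : ℕ) - w' (-(j : ℕ))) = 0 := by
      rw [Finset.sum_sub_distrib, sum_range_periodic_neg hw', sub_self]
    have hsum := fun N => norm_sum_periodic_le (g := fun j : ℕ => w' j - w' (-j)) (c := 2) hQ
      (fun j => by
        congr 1
        · push_cast; exact hw' j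
        · rw [← hw' (-(j + Q : ℕ))]; congr 1; push_cast; ring)
      (fun j => by
        refine (norm_sub_le _ _).trans ?_
        linarith [hb' j, hb' (-j)]) h0 N
    have hkey : ‖blockSum w' 0 k‖ ≤ 3 * (2 * Q / 2 ^ k) := by
      refine norm_sum_div_le (R := 2 ^ k) (by positivity) (v := fun j =>
        w' j * unitExp (j * 0) - w' (-j) * unitExp (-(j * 0))) fun N hN _ => ?_
      simp only [mul_zero, neg_zero, unitExp_zero, mul_one]
      refine (hsum N).trans ?_
      have hNR : ((2 : ℝ) ^ k) ≤ N := by exact_mod_cast hN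
      calc (2 : ℝ) * Q = 2 * Q / 2 ^ k * 2 ^ k := by field_simp
        _ ≤ _ := by gcongr
    refine hkey.trans_eq ?_
    ring
  have hdiff : ‖blockSum w z k - blockSum w' 0 k‖ ≤ 14 * (2 ^ k * |τ|) := by
    set w'' : ℤ → ℂ := fun j => w j * unitExp (j * z) with hw''
    have e : blockSum w z k = blockSum w'' 0 k := by
      simp only [blockSum, hw'', mul_zero, neg_zero, unitExp_zero, mul_one]
      refine Finset.sum_congr rfl fun j _ => ?_
      push_cast
      rw [neg_mul]
    rw [e, blockSum, blockSum, ← Finset.sum_sub_distrib]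
    have hterm : ∀ j : ℤ, ‖w'' j - w' j‖ ≤ 7 * (|(j : ℝ)| * |τ|) := fun j => by
      simp only [hw'']
      rw [hsplit j]
      have e2 : w' j * unitExp (j * τ / Q) - w' j = w' j * (unitExp (j * τ / Q) - 1) := by ring
      rw [e2, norm_mul]
      have h3 := norm_unitExp_sub_one_le (j * τ / Q)
      calc _ ≤ 1 * (7 * |j * τ / Q|) := by gcongr; exact hb' j
        _ ≤ _ := by
          rw [one_mul, abs_div, abs_mul, abs_of_pos hQp]
          gcongr
          exact div_le_self (by positivity) hQ1
    calc _ ≤ ∑ j ∈ Finset.Ico (2 ^ k : ℕ) (2 * 2 ^ k), 14 * |τ| := by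
          refine norm_sum_le_of_le _ fun j hj => ?_
          have hjp : (0 : ℝ) < j := by
            exact_mod_cast lt_of_lt_of_le (by positivity) (Finset.mem_Ico.mp hj).1
          simp only [mul_zero, neg_zero, unitExp_zero, mul_one]
          rw [← sub_div, norm_div, Complex.norm_natCast, div_le_iff₀ hjp]
          have e3 : w'' j - w'' (-j) - (w' j - w' (-j)) =
            (w'' j - w' j) - (w'' (-j) - w' (-j)) := by ring
          rw [e3]
          refine (norm_sub_le _ _).trans ?_
          have h4 := hterm j
          have h5 := hterm (-j)
          push_cast at h4 h5
          rw [abs_neg, Nat.abs_cast] at h5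
          rw [Nat.abs_cast] at h4
          linarith
      _ = 14 * (2 ^ k * |τ|) := by
          rw [Finset.sum_const, Nat.card_Ico, nsmul_eq_mul, two_mul, Nat.add_sub_cancel]
          push_cast; ring
  have := norm_add_le (blockSum w z k - blockSum w' 0 k) (blockSum w' 0 k)
  rw [sub_add_cancel] at this
  linarith

/-- A large dyadic block forces a large one-sided exponential sum. -/
lemma exists_large_sum_of_large_block {w : ℤ → ℂ} {z M : ℝ} {k : ℕ} (hM : 0 < M)
    (h : 1 ≤ M * ‖blockSum w z k‖) : ∃ ε : ℤ, ε * ε = 1 ∧ ∃ N : ℕ, 2 ^ k ≤ N ∧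
      (N : ℝ) ≤ 8 * M * ‖∑ j ∈ Finset.range N, w (ε * j) * unitExp (ε * j * z)‖ := by
  by_contra hcon
  push Not at hcon
  have hkey : ‖blockSum w z k‖ ≤ 3 * (1 / (4 * M)) := by
    refine norm_sum_div_le (R := 2 ^ k) (by positivity) (v := fun j =>
        w j * unitExp (j * z) - w (-j) * unitExp (-(j * z))) fun N hN _ => ?_
    rw [Finset.sum_sub_distrib]
    refine (norm_sub_le _ _).trans ?_
    have h1 := hcon 1 (by norm_num) N hN
    have h2 := hcon (-1) (by norm_num) N hN
    simp only [Int.cast_one, one_mul, Int.cast_neg, neg_mul] at h1 h2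
    have e : 1 / (4 * M) * N = N / (8 * M) + N / (8 * M) := by field_simp; ring
    rw [e]
    refine add_le_add ?_ ?_
    · rw [le_div_iff₀ (by positivity)]; linarith
    · rw [le_div_iff₀ (by positivity)]; linarith
  have : M * ‖blockSum w z k‖ ≤ 3 / 4 := by
    calc M * ‖blockSum w z k‖ ≤ M * (3 * (1 / (4 * M))) := by gcongr
      _ = 3 / 4 := by field_simp
  linarith

/-- A geometric progression of ratio 2^d ≥ 2 stays between 2^{-u} and 2^v for at most u + v + 1
indices. -/
lemma card_le_of_dyadic_window {S : Finset ℕ} {D : ℝ} {d u v : ℕ} (hd : 1 ≤ d)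
    (h : ∀ k ∈ S, 1 ≤ 2 ^ u * (D * 2 ^ (k * d)) ∧ D * 2 ^ (k * d) ≤ 2 ^ v) :
    S.card ≤ u + v + 1 := by
  rcases S.eq_empty_or_nonempty with rfl | hne
  · simp
  set k₁ := S.min' hne with hk₁
  have hmin := (h _ (S.min'_mem hne)).1
  rw [← hk₁] at hmin
  have hsub : S ⊆ Finset.Icc k₁ (k₁ + (u + v)) := by
    intro k hk
    have h1 : k₁ ≤ k := S.min'_le k hk
    have h2 := (h k hk).2
    obtain ⟨t, rfl⟩ := Nat.exists_eq_add_of_le h1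
    have h3 : (2 : ℝ) ^ (t * d) ≤ 2 ^ (u + v) := by
      calc (2 : ℝ) ^ (t * d) = 1 * 2 ^ (t * d) := (one_mul _).symm
        _ ≤ 2 ^ u * (D * 2 ^ (k₁ * d)) * 2 ^ (t * d) := by gcongr
        _ = 2 ^ u * (D * 2 ^ ((k₁ + t) * d)) := by ring
        _ ≤ 2 ^ u * 2 ^ v := by gcongr
        _ = _ := by ring
    have h4 : t * d ≤ u + v := (pow_le_pow_iff_right₀ (by norm_num : (1 : ℝ) < 2)).mp h3
    have h5 : t * 1 ≤ t * d := Nat.mul_le_mul_left t hd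
    rw [Finset.mem_Icc]; omega
  refine (Finset.card_le_card hsub).trans ?_
  rw [Nat.card_Icc]; omega

/-! ### The weights of the problem and the number of large blocks. -/

open Polynomial in
/-- At a rational shift the multiplier `e(c P(j + a/b))`, `c = -p/q`, is periodic in `j`. -/
lemma unitExp_eval_periodic (P : ℤ[X]) (p : ℕ) {q b : ℕ} (hq : 0 < q) (hb : 0 < b) (a j : ℤ) :
    unitExp (-(p / q : ℝ) * (P.map (Int.castRingHom ℝ)).eval
        (((j + (q * b ^ P.natDegree : ℕ) : ℤ) : ℝ) + a / b)) =
      unitExp (-(p / q : ℝ) * (P.map (Int.castRingHom ℝ)).eval ((j : ℝ) + a / b)) := by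
  set Q := q * b ^ P.natDegree with hQ
  have hbp : (b : ℝ) ≠ 0 := by exact_mod_cast hb.ne'
  have hqp : (q : ℝ) ≠ 0 := by exact_mod_cast hq.ne'
  -- Clearing denominators: b^n P(i + a/b) is an integer polynomial evaluated at bi + a. Shifting i
  -- by Q changes it by a multiple of Q = q·b^n, hence changes P by a multiple of q.
  have hval : ∀ i : ℤ, (b : ℝ) ^ P.natDegree *
      (P.map (Int.castRingHom ℝ)).eval ((i : ℝ) + a / b) =
      (((P.scaleRoots (b : ℤ)).eval (b * i + a) : ℤ) : ℝ) := by
    intro i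
    have h1 := scaleRoots_eval₂_mul (p := P) (Int.castRingHom ℝ) ((i : ℝ) + a / b) (b : ℤ)
    have h2 : (Int.castRingHom ℝ) (b : ℤ) * ((i : ℝ) + a / b) = Int.castRingHom ℝ (b * i + a) := by
      simp; field_simp
    rw [h2, eval₂_hom] at h1
    rw [eval_map]
    simpa using h1.symm
  obtain ⟨t, ht⟩ : (Q : ℤ) ∣ (P.scaleRoots (b : ℤ)).eval (b * (j + Q) + a) -
      (P.scaleRoots (b : ℤ)).eval (b * j + a) := by
    refine Dvd.dvd.trans ?_ (sub_dvd_eval_sub _ _ _)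
    exact ⟨b, by ring⟩
  have h1 := hval (j + Q)
  have h2 := hval j
  have h3 : (b : ℝ) ^ P.natDegree * ((P.map (Int.castRingHom ℝ)).eval (((j + Q : ℤ) : ℝ) + a / b) -
      (P.map (Int.castRingHom ℝ)).eval ((j : ℝ) + a / b)) = (q * b ^ P.natDegree : ℝ) * t := by
    rw [mul_sub, h1, h2, ← Int.cast_sub, ht, hQ]; push_cast; ring
  have h4 : (P.map (Int.castRingHom ℝ)).eval (((j + Q : ℤ) : ℝ) + a / b) =
      (P.map (Int.castRingHom ℝ)).eval ((j : ℝ) + a / b) + q * t := by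
    have : (b : ℝ) ^ P.natDegree ≠ 0 := pow_ne_zero _ hbp
    apply mul_left_cancel₀ this
    linear_combination h3
  have h5 : -(p / q : ℝ) * (P.map (Int.castRingHom ℝ)).eval (((j + Q : ℤ) : ℝ) + a / b) =
      -(p / q : ℝ) * (P.map (Int.castRingHom ℝ)).eval ((j : ℝ) + a / b) + ((-(p * t) : ℤ) : ℝ) := by
    rw [h4]; push_cast; field_simp; ring
  rw [h5, unitExp_add_intCast]

open Polynomial in
lemma exists_abs_eval_sub_eval_le (P : ℝ[X]) {m : ℕ} (hP : P.natDegree ≤ m + 1) : ∃ Λ : ℝ, 0 ≤ Λ ∧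
    ∀ X x y : ℝ, 1 ≤ X → |x| ≤ X → |y| ≤ X → |P.eval x - P.eval y| ≤ Λ * (|x - y| * X ^ m) := by
  refine ⟨∑ i ∈ Finset.range (m + 2), |P.coeff i| * i, by positivity, fun X x y hX hx hy => ?_⟩
  have hX0 : 0 ≤ X := by linarith
  have hpow : ∀ i : ℕ, |x ^ i - y ^ i| ≤ i * (|x - y| * X ^ (i - 1)) := by
    intro i
    rw [← (Commute.all x y).geom_sum₂_mul, abs_mul, mul_comm, mul_left_comm]
    gcongr
    refine (Finset.abs_sum_le_sum_abs _ _).trans ?_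
    calc _ ≤ ∑ l ∈ Finset.range i, X ^ (i - 1) := by
          refine Finset.sum_le_sum fun l hl => ?_
          have := Finset.mem_range.mp hl
          rw [abs_mul, abs_pow, abs_pow]
          calc |x| ^ l * |y| ^ (i - 1 - l) ≤ X ^ l * X ^ (i - 1 - l) := by gcongr
            _ = X ^ (i - 1) := by rw [← pow_add]; congr 1; omega
      _ = _ := by simp
  rw [eval_eq_sum_range' (n := m + 2) (by omega), eval_eq_sum_range' (n := m + 2) (by omega),
    ← Finset.sum_sub_distrib, Finset.sum_mul]
  refine (Finset.abs_sum_le_sum_abs _ _).trans (Finset.sum_le_sum fun i hi => ?_)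
  rw [← mul_sub, abs_mul, mul_assoc]
  gcongr
  refine (hpow i).trans ?_
  have := Finset.mem_range.mp hi
  gcongr ?_ * (?_ * ?_)
  exact pow_le_pow_right₀ hX (by omega)

/-- The Fourier multiplier `exp(-2πi (p/q) P(j + θ))` of the problem at time `2πp/q`. -/
def dispersiveWeight (P : Polynomial ℤ) (p q : ℕ) (θ : ℝ) (j : ℤ) : ℂ :=
  unitExp (-(p / q : ℝ) * (P.map (Int.castRingHom ℝ)).eval ((j : ℝ) + θ))

lemma norm_dispersiveWeight (P : Polynomial ℤ) (p q : ℕ) (θ : ℝ) (j : ℤ) :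
    ‖dispersiveWeight P p q θ j‖ = 1 := norm_unitExp _

lemma exists_approx_of_large_block {d : ℕ} (hd : 1 ≤ d) {P : Polynomial ℤ}
    (hP : P.natDegree = d + 2) {p q : ℕ} (hp : 0 < p) (hq : 0 < q) (θ : ℝ) : ∃ C : ℕ,
    ∀ M : ℝ, 2 ≤ M → ∀ (z : ℝ) (k : ℕ), 1 ≤ M * ‖blockSum (dispersiveWeight P p q θ) z k‖ →
    ∃ b : ℕ, 1 ≤ b ∧ (b : ℝ) ≤ M ^ C ∧
      ∃ a : ℤ, |b * θ - a| * 2 ^ (k * (d + 1)) ≤ M ^ C := by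
  obtain ⟨C, hC⟩ := exists_approx_of_large_dispersive_sum hd hP hp hq θ
  refine ⟨4 * C, fun M hM z k h => ?_⟩
  have hM0 : 0 < M := by linarith
  obtain ⟨ε, hε, N, hkN, hN⟩ := exists_large_sum_of_large_block hM0 h
  have hNpos : 0 < N := lt_of_lt_of_le (by positivity) hkN
  have h8 : 8 * M ≤ M ^ 4 := by
    have : (2 : ℝ) ^ 3 ≤ M ^ 3 := by gcongr
    have e : M ^ 4 = M ^ 3 * M := by ring
    rw [e]; nlinarith
  obtain ⟨b, hb1, hb2, a, ha⟩ := hC (M ^ 4)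
    (hM.trans (le_self_pow₀ (by linarith) (by norm_num))) ε hε z N hNpos (by
      have e : ∀ j ∈ Finset.range N, dispersiveWeight P p q θ (ε * j) * unitExp (ε * j * z) =
          unitExp (-(p / q : ℝ) * (P.map (Int.castRingHom ℝ)).eval (ε * j + θ) + ε * j * z) := by
        intro j _
        rw [unitExp_add, dispersiveWeight]
        push_cast; rfl
      rw [Finset.sum_congr rfl e] at hN
      exact hN.trans (by gcongr))
  rw [← pow_mul] at hb2 ha
  refine ⟨b, hb1, hb2, a, ?_⟩
  have hNR : (0 : ℝ) < N := by exact_mod_cast hNpos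
  rw [le_div_iff₀ (by positivity)] at ha
  refine le_trans ?_ ha
  have : (2 : ℝ) ^ k ≤ N := by exact_mod_cast hkN
  rw [pow_mul]
  gcongr

set_option maxHeartbeats 800000 in
/-- The number of dyadic blocks of size at least `2^{-s}` is `O(s)`, uniformly in `z`. -/
theorem exists_card_large_blocks_le {d : ℕ} (hd : 1 ≤ d) {P : Polynomial ℤ}
    (hP : P.natDegree = d + 2) {p q : ℕ} (hp : 0 < p) (hq : 0 < q) {θ : ℝ}
    (hθ : θ ∈ Ioo (0 : ℝ) 1) : ∃ C : ℕ, ∀ s : ℕ, 1 ≤ s → ∀ (z : ℝ) (L : ℕ),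
    ((Finset.range L).filter
      (fun k => 1 ≤ (2 : ℝ) ^ s * ‖blockSum (dispersiveWeight P p q θ) z k‖)).card ≤ C * s := by
  obtain ⟨c, hc⟩ := exists_approx_of_large_block hd hP hp hq θ
  obtain ⟨Λ, hΛ, hLip⟩ := exists_abs_eval_sub_eval_le (P.map (Int.castRingHom ℝ)) (m := d + 1)
    (Polynomial.natDegree_map_le.trans hP.le)
  -- 2^g absorbs the Lipschitz constants met when θ is replaced by a nearby fraction.
  obtain ⟨g, hg⟩ := pow_unbounded_of_one_lt (7 * ((p / q : ℝ) * (Λ * 4 ^ (d + 1))))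
    (by norm_num : (1 : ℝ) < 2)
  refine ⟨(2 * c + 2) + (q + c * (d + 2) + 6) + (g + 4 + c) + (12 + 2 * (q + c * (d + 2))),
    fun s hs z L => ?_⟩
  set w := dispersiveWeight P p q θ with hw
  set G := (Finset.range L).filter (fun k => 1 ≤ (2 : ℝ) ^ s * ‖blockSum w z k‖) with hG
  have hM : (2 : ℝ) ≤ 2 ^ s := le_self_pow₀ (by norm_num) (by omega)
  have happ : ∀ k ∈ G, ∃ b : ℕ, 1 ≤ b ∧ (b : ℝ) ≤ 2 ^ (s * c) ∧
      ∃ a : ℤ, |b * θ - a| * 2 ^ (k * (d + 1)) ≤ 2 ^ (s * c) := fun k hk => by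
    rw [pow_mul]
    exact hc _ hM z k (Finset.mem_filter.mp hk).2
  -- Beyond this threshold all approximating fractions coincide: cross-multiplying two of them gives
  -- an integer of size at most 2·2^{2sc}/2^A < 1.
  set A := s * (2 * c + 2) with hA
  -- Exponent with Q = q·b^{d+2} ≤ 2^h, from q ≤ 2^q and b ≤ 2^{sc}.
  set h := q + s * (c * (d + 2)) with hh
  by_cases hex : ∃ k₀ ∈ G, A ≤ k₀
  swap
  · push Not at hex
    have hsub : G ⊆ Finset.range A := fun k hk => Finset.mem_range.mpr (hex k hk)
    refine (Finset.card_le_card hsub).trans ?_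
    rw [Finset.card_range, hA, mul_comm]
    exact Nat.mul_le_mul_right s (by omega)
  obtain ⟨k₀, hk₀G, hk₀A⟩ := hex
  obtain ⟨b, hb1, hb2, a, ha⟩ := happ k₀ hk₀G
  have hbp : (0 : ℝ) < b := by exact_mod_cast hb1
  have hbone : (1 : ℝ) ≤ b := by exact_mod_cast hb1
  set D := |θ - a / b| with hD
  -- One fraction a/b, taken from k₀, serves every large block beyond A, so D obeys the bound at
  -- each such k.
  have hbA : ∀ k ∈ G, A ≤ k → D * 2 ^ (k * (d + 1)) ≤ 2 ^ (s * c) := by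
    intro k hk hkA
    obtain ⟨b', hb1', hb2', a', ha'⟩ := happ k hk
    have hbp' : (0 : ℝ) < b' := by exact_mod_cast hb1'
    have hbone' : (1 : ℝ) ≤ b' := by exact_mod_cast hb1'
    have hbound : ∀ (k' : ℕ) (x : ℝ), A ≤ k' → 0 ≤ x → x * 2 ^ (k' * (d + 1)) ≤ 2 ^ (s * c) →
        x * 2 ^ A ≤ 2 ^ (s * c) := fun k' x hk' hx h1 => by
      refine le_trans ?_ h1
      gcongr
      · norm_num
      · exact hk'.trans (Nat.le_mul_of_pos_right _ (by omega))
    have e1 := hbound k₀ _ hk₀A (abs_nonneg _) ha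
    have e2 := hbound k _ hkA (abs_nonneg _) ha'
    have heq : a * b' = a' * b := by
      have hlt : |(a * b' - a' * b : ℤ)| < 1 := by
        have : (|(a * b' - a' * b : ℤ)| : ℝ) < 1 := by
          push_cast
          have e : (a : ℝ) * b' - a' * b = b * (b' * θ - a') - b' * (b * θ - a) := by ring
          rw [e]
          have e3 : |b * (b' * θ - a') - b' * (b * θ - a)| ≤
              b * |b' * θ - a'| + b' * |b * θ - a| := by
            refine (abs_sub _ _).trans ?_
            rw [abs_mul, abs_mul, abs_of_pos hbp, abs_of_pos hbp']
          have hpow : (2 : ℝ) ^ (s * c) * 2 ^ (s * c) * 2 < 2 ^ A := by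
            rw [← pow_add, ← pow_succ]
            apply pow_lt_pow_right₀ (by norm_num)
            rw [hA, mul_add]
            have : s * (2 * c) = s * c + s * c := by ring
            omega
          have e4 : (b * |b' * θ - a'| + b' * |b * θ - a|) * 2 ^ A ≤
              2 ^ (s * c) * 2 ^ (s * c) * 2 := by
            calc _ = b * (|b' * θ - a'| * 2 ^ A) + b' * (|b * θ - a| * 2 ^ A) := by ring
              _ ≤ 2 ^ (s * c) * 2 ^ (s * c) + 2 ^ (s * c) * 2 ^ (s * c) := by gcongr
              _ = _ := by ring
          have e5 : (b * |b' * θ - a'| + b' * |b * θ - a|) * 2 ^ A < 1 * 2 ^ A := by linarith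
          exact e3.trans_lt (lt_of_mul_lt_mul_right e5 (by positivity))
        exact_mod_cast this
      have := Int.abs_lt_one_iff.mp hlt
      linarith
    have heqR : (a : ℝ) * b' = a' * b := by exact_mod_cast heq
    have hDle : D ≤ |b' * θ - a'| := by
      have e : θ - a / b = (b' * θ - a') / b' := by
        rw [eq_div_iff hbp'.ne', sub_mul, div_mul_eq_mul_div, heqR]
        field_simp
      rw [hD, e, abs_div, abs_of_pos hbp']
      exact div_le_self (abs_nonneg _) hbone'
    exact le_trans (by gcongr) ha'
  -- Keeps j + a/b within 4·2^k on the k-th block, as the Lipschitz estimate requires.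
  have hDone : D ≤ 1 := by
    have h1 := hbA k₀ hk₀G hk₀A
    have h2 : (2 : ℝ) ^ (s * c) ≤ 2 ^ (k₀ * (d + 1)) := by
      apply pow_le_pow_right₀ (by norm_num)
      calc s * c ≤ A := by rw [hA]; gcongr; omega
        _ ≤ k₀ := hk₀A
        _ ≤ _ := Nat.le_mul_of_pos_right _ (by omega)
    have h3 : D * 2 ^ (k₀ * (d + 1)) ≤ 1 * 2 ^ (k₀ * (d + 1)) := by linarith
    exact le_of_mul_le_mul_right h3 (by positivity)
  set w' := dispersiveWeight P p q (a / b) with hw'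
  set Q := q * b ^ P.natDegree with hQ
  have hQpos : 0 < Q := Nat.mul_pos hq (pow_pos hb1 _)
  have hperiod : ∀ j, w' (j + Q) = w' j := fun j => unitExp_eval_periodic P p hq hb1 a j
  have hw'b : ∀ j, ‖w' j‖ ≤ 1 := fun j => (norm_dispersiveWeight _ _ _ _ _).le
  have hQle : (Q : ℝ) ≤ 2 ^ h := by
    rw [hQ, hP, hh]
    push_cast
    have hq2 : (q : ℝ) ≤ 2 ^ q := by exact_mod_cast (Nat.lt_two_pow_self).le
    have e : (2 : ℝ) ^ (q + s * (c * (d + 2))) = 2 ^ q * (2 ^ (s * c)) ^ (d + 2) := by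
      rw [pow_add, ← pow_mul, mul_assoc]
    rw [e]
    gcongr
  have hclose : ∀ k : ℕ, ‖blockSum w z k - blockSum w' z k‖ ≤
      2 * (2 ^ g * (D * 2 ^ (k * (d + 1)))) := by
    intro k
    refine norm_blockSum_sub_le (by positivity) fun j hj => ?_
    have h2k : (1 : ℝ) ≤ 2 ^ k := one_le_pow₀ (by norm_num)
    have hx : |(j : ℝ) + θ| ≤ 4 * 2 ^ k := by
      refine (abs_add_le _ _).trans ?_
      rw [abs_of_pos hθ.1]; linarith [hθ.2]
    have hy : |(j : ℝ) + a / b| ≤ 4 * 2 ^ k := by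
      have e : (j : ℝ) + a / b = j + (θ - (θ - a / b)) := by ring
      rw [e]
      refine (abs_add_le _ _).trans ?_
      have := abs_sub θ (θ - a / b)
      rw [abs_of_pos hθ.1] at this
      linarith [hθ.2]
    have h1 := hLip (4 * 2 ^ k) _ _ (by linarith) hx hy
    rw [hw, hw', dispersiveWeight, dispersiveWeight]
    refine (norm_unitExp_sub_unitExp_le _ _).trans ?_
    rw [← mul_sub, abs_mul, abs_neg, abs_of_nonneg (by positivity : (0 : ℝ) ≤ p / q)]
    have e : (j : ℝ) + θ - (j + a / b) = θ - a / b := by ring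
    rw [e, ← hD] at h1
    calc _ ≤ 7 * ((p / q : ℝ) * (Λ * (D * (4 * 2 ^ k) ^ (d + 1)))) := by gcongr
      _ = 7 * ((p / q : ℝ) * (Λ * 4 ^ (d + 1))) * (D * 2 ^ (k * (d + 1))) := by
        rw [mul_pow, pow_mul]; ring
      _ ≤ _ := by gcongr
  set m := round (Q * z) with hm
  set τ := Q * z - m with hτ
  have hz : Q * z = m + τ := by rw [hτ]; ring
  have hτ2 : |τ| ≤ 1 / 2 := abs_sub_round _
  -- If 2^u·D·2^{k(d+1)} < 1, replacing θ by a/b alters the block by less than half of 2^{-s}.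
  set u := g + 2 + s with hu
  -- From k = A₂ on, the term 6Q/2^k is at most half of 2^{-(s+1)}, so 14·2^k|τ| must supply the
  -- rest of a large periodic block.
  set A₂ := h + s + 5 with hA₂
  set W₁ := G.filter (fun k => 1 ≤ 2 ^ u * (D * 2 ^ (k * (d + 1))) ∧
    D * 2 ^ (k * (d + 1)) ≤ (2 : ℝ) ^ (s * c)) with hW₁
  set W₂ := G.filter (fun k => 1 ≤ 2 ^ (s + 6) * (|τ| * 2 ^ (k * 1)) ∧
    |τ| * 2 ^ (k * 1) ≤ (2 : ℝ) ^ (h + s + 3)) with hW₂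
  -- Four sources of large blocks: two initial ranges, the window where θ and a/b separate, and the
  -- window where z and the multiples of 1/Q separate. Each has O(s) elements.
  have hsub : G ⊆ Finset.range A ∪ Finset.range A₂ ∪ W₁ ∪ W₂ := by
    intro k hk
    simp only [Finset.mem_union, Finset.mem_range]
    by_cases hkA : k < A
    · tauto
    by_cases hkA₂ : k < A₂
    · tauto
    push Not at hkA hkA₂
    have hup := hbA k hk hkA
    by_cases hD1 : 1 ≤ 2 ^ u * (D * 2 ^ (k * (d + 1)))
    · exact Or.inl (Or.inr (Finset.mem_filter.mpr ⟨hk, hD1, hup⟩))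
    refine Or.inr (Finset.mem_filter.mpr ⟨hk, ?_⟩)
    rw [mul_one]
    push Not at hD1
    have hblock : 1 ≤ 2 ^ (s + 1) * ‖blockSum w' z k‖ := by
      have h1 := (Finset.mem_filter.mp hk).2
      have h2 := hclose k
      have h3 : ‖blockSum w z k‖ ≤ ‖blockSum w z k - blockSum w' z k‖ + ‖blockSum w' z k‖ := by
        have := norm_add_le (blockSum w z k - blockSum w' z k) (blockSum w' z k)
        rwa [sub_add_cancel] at this
      have e : (2 : ℝ) ^ u * (D * 2 ^ (k * (d + 1))) =
        2 ^ s * (2 * (2 * (2 ^ g * (D * 2 ^ (k * (d + 1)))))) := by rw [hu]; ring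
      rw [e] at hD1
      have h4 : (2 : ℝ) ^ s * ‖blockSum w z k‖ ≤
          2 ^ s * (2 * (2 ^ g * (D * 2 ^ (k * (d + 1)))) + ‖blockSum w' z k‖) := by
        gcongr; linarith
      rw [pow_succ]
      linarith
    have hB1 := norm_blockSum_periodic_mul_le hperiod hw'b hz hτ2 k
    have hB2 := norm_blockSum_periodic_le hQpos hperiod hw'b hz k
    constructor
    · have h1 : (2 : ℝ) ^ (s + 1) * (6 * Q / 2 ^ k) ≤ 1 / 2 := by
        have hk2 : (2 : ℝ) ^ (h + s + 5) ≤ 2 ^ k := pow_le_pow_right₀ (by norm_num) hkA₂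
        rw [mul_div_assoc', div_le_iff₀ (by positivity)]
        have e : (2 : ℝ) ^ (h + s + 5) = 32 * (2 ^ h * 2 ^ s) := by ring
        rw [e] at hk2
        have h5 : (2 : ℝ) ^ s * Q ≤ 2 ^ s * 2 ^ h := by gcongr
        rw [pow_succ]
        nlinarith
      have h2 : 1 ≤ (2 : ℝ) ^ (s + 1) * (6 * Q / 2 ^ k + 14 * (2 ^ k * |τ|)) :=
        hblock.trans (by gcongr)
      have e : (2 : ℝ) ^ (s + 6) * (|τ| * 2 ^ k) = 32 * (2 ^ (s + 1) * (2 ^ k * |τ|)) := by ring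
      rw [e]
      nlinarith
    · calc |τ| * 2 ^ k ≤ (2 ^ (s + 1) * ‖blockSum w' z k‖) * (|τ| * 2 ^ k) :=
            le_mul_of_one_le_left (by positivity) hblock
        _ = 2 ^ (s + 1) * (‖blockSum w' z k‖ * (2 ^ k * |τ|)) := by ring
        _ ≤ 2 ^ (s + 1) * (3 * Q) := by gcongr
        _ ≤ 2 ^ (s + 1) * (4 * 2 ^ h) := by gcongr; norm_num
        _ = 2 ^ (h + s + 3) := by ring
  have hc1 : W₁.card ≤ u + s * c + 1 := card_le_of_dyadic_window (d := d + 1) (by omega)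
    fun k hk => (Finset.mem_filter.mp hk).2
  have hc2 : W₂.card ≤ (s + 6) + (h + s + 3) + 1 := card_le_of_dyadic_window (d := 1) le_rfl
    fun k hk => (Finset.mem_filter.mp hk).2
  have h1 := Finset.card_le_card hsub
  have h2 := Finset.card_union_le (Finset.range A ∪ Finset.range A₂ ∪ W₁) W₂
  have h3 := Finset.card_union_le (Finset.range A ∪ Finset.range A₂) W₁
  have h4 := Finset.card_union_le (Finset.range A) (Finset.range A₂)
  rw [Finset.card_range, Finset.card_range] at h4
  have hfin : G.card ≤ A + A₂ + (u + s * c + 1) + ((s + 6) + (h + s + 3) + 1) := by omega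
  refine hfin.trans ?_
  rw [hA, hA₂, hu, hh]
  have hqs : q ≤ q * s := Nat.le_mul_of_pos_right _ hs
  have hgs : g ≤ g * s := Nat.le_mul_of_pos_right _ hs
  have e₁ : s * (2 * c + 2) = 2 * (s * c) + 2 * s := by ring
  have e₂ : ((2 * c + 2) + (q + c * (d + 2) + 6) + (g + 4 + c) + (12 + 2 * (q + c * (d + 2)))) * s =
      3 * (s * c) + 3 * (s * (c * (d + 2))) + 3 * (q * s) + g * s + 24 * s := by ring
  rw [e₁, e₂]
  omega

/-! ### Uniform summability of the blocks and of the kernel series. -/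

/-- The dyadic blocks tend to zero uniformly in `z` when `θ` is irrational. -/
theorem exists_forall_block_le {d : ℕ} (hd : 1 ≤ d) {P : Polynomial ℤ}
    (hP : P.natDegree = d + 2) {p q : ℕ} (hp : 0 < p) (hq : 0 < q) {θ : ℝ}
    (hθ : Irrational θ) (s : ℕ) : ∃ K : ℕ, ∀ k ≥ K, ∀ z : ℝ,
      (2 : ℝ) ^ s * ‖blockSum (dispersiveWeight P p q θ) z k‖ ≤ 1 := by
  obtain ⟨C, hC⟩ := exists_approx_of_large_block hd hP hp hq θ
  set M : ℝ := 2 ^ (s + 1) with hM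
  have hM2 : 2 ≤ M := le_self_pow₀ (by norm_num) (by omega)
  -- Only finitely many denominators occur, and irrationality keeps each bθ at positive distance
  -- from ℤ; so no approximation of the forced quality survives for large k.
  have hev : ∀ b ∈ Finset.Icc 1 ⌊M ^ C⌋₊, ∀ᶠ k : ℕ in Filter.atTop,
      M ^ C < |b * θ - round (b * θ)| * 2 ^ k := by
    intro b hb
    have hb1 := (Finset.mem_Icc.mp hb).1
    have hpos : 0 < |b * θ - round (b * θ)| := by
      rw [abs_pos, sub_ne_zero]
      intro heq
      have : Irrational (b * θ) := hθ.natCast_mul (by omega)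
      exact this ⟨(round (b * θ) : ℤ), by rw [Rat.cast_intCast]; exact heq.symm⟩
    exact ((tendsto_pow_atTop_atTop_of_one_lt (by norm_num : (1 : ℝ) < 2)).const_mul_atTop
      hpos).eventually_gt_atTop _
  obtain ⟨K, hK⟩ := Filter.eventually_atTop.mp ((Filter.eventually_all_finset _).mpr hev)
  refine ⟨K, fun k hk z => ?_⟩
  by_contra hcon
  push Not at hcon
  obtain ⟨b, hb1, hb2, a, ha⟩ := hC M hM2 z k (by
    rw [hM, pow_succ]
    nlinarith [norm_nonneg (blockSum (dispersiveWeight P p q θ) z k),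
      pow_pos (by norm_num : (0 : ℝ) < 2) s])
  have h1 := hK k hk b (Finset.mem_Icc.mpr ⟨hb1, Nat.le_floor hb2⟩)
  have h2 : |b * θ - round (b * θ)| ≤ |b * θ - a| := round_le _ _
  have h3 : (2 : ℝ) ^ k ≤ 2 ^ (k * (d + 1)) :=
    pow_le_pow_right₀ (by norm_num) (Nat.le_mul_of_pos_right _ (by omega))
  have h4 : |b * θ - round (b * θ)| * 2 ^ k ≤ |b * θ - a| * 2 ^ (k * (d + 1)) := by gcongr
  linarith

/-- A dyadic layer-cake bound: the first level that x fails to reach bounds it by the previous one,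
and the leading term covers the case where all t levels are reached or t = 0. -/
lemma le_sum_levels {x : ℝ} {s₀ : ℕ} (hx : 2 ^ s₀ * x ≤ 1) (t : ℕ) :
    x ≤ 1 / 2 ^ (s₀ + t) + ∑ s ∈ Finset.range t,
      if 1 ≤ 2 ^ (s + s₀ + 1) * x then (1 : ℝ) / 2 ^ (s + s₀) else 0 := by
  induction t with
  | zero =>
    simp only [Finset.range_zero, Finset.sum_empty, add_zero]
    rw [le_div_iff₀ (by positivity)]; linarith
  | succ t ih =>
    rw [Finset.sum_range_succ]
    split_ifs with h
    · have e : (1 : ℝ) / 2 ^ (t + s₀) = 1 / 2 ^ (s₀ + t) := by rw [add_comm]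
      have : (0 : ℝ) ≤ 1 / 2 ^ (s₀ + (t + 1)) := by positivity
      linarith
    · push Not at h
      have h1 : x ≤ 1 / 2 ^ (s₀ + (t + 1)) := by
        rw [le_div_iff₀ (by positivity)]
        have e : s₀ + (t + 1) = t + s₀ + 1 := by ring
        rw [e]; linarith
      have h2 : 0 ≤ ∑ s ∈ Finset.range t,
          if 1 ≤ 2 ^ (s + s₀ + 1) * x then (1 : ℝ) / 2 ^ (s + s₀) else 0 :=
        Finset.sum_nonneg fun _ _ => by split_ifs <;> positivity
      linarith

/-- Exchanging the sum over k with the sum over levels turns the counts C·s into a tail of ∑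
C(s+1)2^{-s}. The leading layer-cake terms vanish as t → ∞, so the bound does not depend on L. -/
lemma sum_le_tsum_of_card_levels {Δ : ℕ → ℝ} {C s₀ K : ℕ}
    (hcard : ∀ s : ℕ, 1 ≤ s → ∀ L : ℕ,
      ((Finset.range L).filter (fun k => 1 ≤ (2 : ℝ) ^ s * Δ k)).card ≤ C * s)
    (hK : ∀ k ≥ K, (2 : ℝ) ^ s₀ * Δ k ≤ 1)
    (hsum : Summable fun s : ℕ => (C * (s + 1) : ℝ) / 2 ^ s) (L : ℕ) :
    ∑ k ∈ Finset.Ico K L, Δ k ≤ ∑' s : ℕ, (C * ((s + s₀ : ℕ) + 1) : ℝ) / 2 ^ (s + s₀) := by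
  have hsum' := (summable_nat_add_iff s₀).mpr hsum
  have hbound : ∀ t : ℕ, ∑ k ∈ Finset.Ico K L, Δ k ≤
      (Finset.Ico K L).card * (1 / 2 ^ (s₀ + t)) +
        ∑' s : ℕ, (C * ((s + s₀ : ℕ) + 1) : ℝ) / 2 ^ (s + s₀) := by
    intro t
    calc ∑ k ∈ Finset.Ico K L, Δ k ≤ ∑ k ∈ Finset.Ico K L, (1 / 2 ^ (s₀ + t) +
          ∑ s ∈ Finset.range t,
            if 1 ≤ 2 ^ (s + s₀ + 1) * Δ k then (1 : ℝ) / 2 ^ (s + s₀) else 0) :=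
          Finset.sum_le_sum fun k hk => le_sum_levels (hK k (Finset.mem_Ico.mp hk).1) t
      _ = (Finset.Ico K L).card * (1 / 2 ^ (s₀ + t)) + ∑ s ∈ Finset.range t,
          (((Finset.Ico K L).filter (fun k => 1 ≤ 2 ^ (s + s₀ + 1) * Δ k)).card : ℝ) *
            (1 / 2 ^ (s + s₀)) := by
          rw [Finset.sum_add_distrib, Finset.sum_const, nsmul_eq_mul, Finset.sum_comm]
          congr 1
          refine Finset.sum_congr rfl fun s _ => ?_
          rw [← Finset.sum_filter, Finset.sum_const, nsmul_eq_mul]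
      _ ≤ (Finset.Ico K L).card * (1 / 2 ^ (s₀ + t)) + ∑ s ∈ Finset.range t,
          (C * ((s + s₀ : ℕ) + 1) : ℝ) / 2 ^ (s + s₀) := by
          gcongr with s hs
          rw [mul_one_div]
          gcongr ?_ / _
          have h1 : ((Finset.Ico K L).filter (fun k => 1 ≤ 2 ^ (s + s₀ + 1) * Δ k)).card ≤
              C * (s + s₀ + 1) := by
            refine le_trans (Finset.card_le_card ?_) (hcard (s + s₀ + 1) (by omega) L)
            refine Finset.filter_subset_filter _ fun k hk => ?_
            exact Finset.mem_range.mpr (Finset.mem_Ico.mp hk).2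
          exact_mod_cast h1
      _ ≤ _ := by
          gcongr
          exact hsum'.sum_le_tsum _ fun s _ => by positivity
  have hlim : Filter.Tendsto (fun t : ℕ => ((Finset.Ico K L).card : ℝ) * (1 / 2 ^ (s₀ + t)) +
      ∑' s : ℕ, (C * ((s + s₀ : ℕ) + 1) : ℝ) / 2 ^ (s + s₀)) Filter.atTop
      (nhds (((Finset.Ico K L).card : ℝ) * 0 +
        ∑' s : ℕ, (C * ((s + s₀ : ℕ) + 1) : ℝ) / 2 ^ (s + s₀))) := by
    refine Filter.Tendsto.add_const _ (Filter.Tendsto.const_mul _ ?_)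
    have h1 : Filter.Tendsto (fun t : ℕ => ((1 / 2 : ℝ)) ^ t) Filter.atTop (nhds 0) :=
      tendsto_pow_atTop_nhds_zero_of_lt_one (by norm_num) (by norm_num)
    have h2 := (Filter.tendsto_add_atTop_iff_nat s₀).mpr h1
    refine h2.congr fun t => ?_
    rw [one_div_pow, add_comm]
  rw [mul_zero, zero_add] at hlim
  exact ge_of_tendsto' hlim hbound

/-- Uniform absolute convergence of the dyadic blocks for irrational `θ`. -/
theorem exists_forall_sum_block_le {d : ℕ} (hd : 1 ≤ d) {P : Polynomial ℤ}
    (hP : P.natDegree = d + 2) {p q : ℕ} (hp : 0 < p) (hq : 0 < q) {θ : ℝ}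
    (hθ : θ ∈ Ioo (0 : ℝ) 1) (hirr : Irrational θ) {η : ℝ} (hη : 0 < η) : ∃ K : ℕ, ∀ (K' L : ℕ),
      K ≤ K' → ∀ z : ℝ,
      ∑ k ∈ Finset.Ico K' L, ‖blockSum (dispersiveWeight P p q θ) z k‖ ≤ η := by
  obtain ⟨C, hC⟩ := exists_card_large_blocks_le hd hP hp hq hθ
  have hsum : Summable fun s : ℕ => (C * (s + 1) : ℝ) / 2 ^ s := by
    have h1 := summable_pow_mul_geometric_of_norm_lt_one (R := ℝ) 1 (r := 1 / 2) (by norm_num)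
    have h2 := summable_geometric_of_lt_one (r := (1 / 2 : ℝ)) (by norm_num) (by norm_num)
    refine ((h1.add h2).mul_left (C : ℝ)).congr fun s => ?_
    rw [one_div_pow]; ring
  have htail := tendsto_sum_nat_add fun s : ℕ => (C * (s + 1) : ℝ) / 2 ^ s
  obtain ⟨s₀, hs₀⟩ := (htail.eventually_lt_const hη).exists
  obtain ⟨K, hK⟩ := exists_forall_block_le hd hP hp hq hirr s₀
  refine ⟨K, fun K' L hK' z => ?_⟩
  exact (sum_le_tsum_of_card_levels (fun s hs L => hC s hs z L)
    (fun k hk => hK k (hK'.trans hk) z) hsum L).trans hs₀.le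

lemma sum_Ico_two_pow_eq {E : Type*} [AddCommMonoid E] (g : ℕ → E) {K L : ℕ} (h : K ≤ L) :
    ∑ j ∈ Finset.Ico (2 ^ K : ℕ) (2 ^ L), g j =
      ∑ k ∈ Finset.Ico K L, ∑ j ∈ Finset.Ico (2 ^ k : ℕ) (2 * 2 ^ k), g j := by
  induction L, h using Nat.le_induction with
  | base => simp
  | succ L h ih =>
    rw [Finset.sum_Ico_succ_top h, ← ih, pow_succ', Finset.sum_Ico_consecutive]
    · exact Nat.pow_le_pow_right (by norm_num) h
    · omega

/-- Uniform convergence of the dyadic partial sums of `∑ w_j e(jz) / (j + θ)`. -/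
theorem exists_forall_tail_le {d : ℕ} (hd : 1 ≤ d) {P : Polynomial ℤ}
    (hP : P.natDegree = d + 2) {p q : ℕ} (hp : 0 < p) (hq : 0 < q) {θ : ℝ}
    (hθ : θ ∈ Ioo (0 : ℝ) 1) (hirr : Irrational θ) {η : ℝ} (hη : 0 < η) : ∃ K : ℕ,
    ∀ K' L : ℕ, K ≤ K' → K' ≤ L → ∀ z : ℝ,
      ‖∑ j ∈ Finset.Ico (2 ^ K' : ℕ) (2 ^ L),
        (dispersiveWeight P p q θ j * unitExp (j * z) / (j + θ) +
          dispersiveWeight P p q θ (-j) * unitExp (-(j * z)) / (-j + θ))‖ ≤ η := by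
  obtain ⟨K₁, hK₁⟩ := exists_forall_sum_block_le hd hP hp hq hθ hirr (half_pos hη)
  obtain ⟨K₂, hK₂⟩ := pow_unbounded_of_one_lt (12 / η) (by norm_num : (1 : ℝ) < 2)
  refine ⟨max K₁ K₂ + 1, fun K L hK hKL z => ?_⟩
  set w := dispersiveWeight P p q θ with hw
  set g : ℕ → ℂ := fun j => (w j * unitExp (j * z) - w (-j) * unitExp (-(j * z))) / j with hg
  have hmain : ‖∑ j ∈ Finset.Ico (2 ^ K : ℕ) (2 ^ L), g j‖ ≤ η / 2 := by
    rw [sum_Ico_two_pow_eq _ hKL]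
    exact (norm_sum_le _ _).trans (hK₁ K L (by omega) z)
  have hdiff : ‖∑ j ∈ Finset.Ico (2 ^ K : ℕ) (2 ^ L),
      (w j * unitExp (j * z) / (j + θ) + w (-j) * unitExp (-(j * z)) / (-j + θ) - g j)‖ ≤
      η / 2 := by
    have hterm : ∀ j ∈ Finset.Ico (2 ^ K : ℕ) (2 ^ L),
        ‖w j * unitExp (j * z) / (j + θ) + w (-j) * unitExp (-(j * z)) / (-j + θ) - g j‖ ≤
          3 * ((j : ℝ) ^ 2)⁻¹ := by
      intro j hj
      have hj2 : (2 : ℝ) ≤ j := by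
        have h1 := (Finset.mem_Ico.mp hj).1
        have h2 : 2 ^ 1 ≤ 2 ^ K := Nat.pow_le_pow_right (by norm_num) (by omega)
        exact_mod_cast h2.trans h1
      have hjC : (j : ℂ) ≠ 0 := by
        have : (j : ℝ) ≠ 0 := by linarith
        exact_mod_cast this
      have h1C : (j : ℂ) + θ ≠ 0 := by
        have : (j : ℝ) + θ ≠ 0 := by linarith [hθ.1]
        exact_mod_cast this
      have h2C : -(j : ℂ) + θ ≠ 0 := by
        have : -(j : ℝ) + θ ≠ 0 := by linarith [hθ.2]
        exact_mod_cast this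
      -- Passing from 1/(±j + θ) to ±1/j costs O(1/j²) per term, absolutely summable and uniform in
      -- z.
      have e : w j * unitExp (j * z) / (j + θ) + w (-j) * unitExp (-(j * z)) / (-j + θ) - g j =
          w j * unitExp (j * z) * ((-(θ / (j * (j + θ))) : ℝ) : ℂ) +
            w (-j) * unitExp (-(j * z)) * ((-(θ / (j * (j - θ))) : ℝ) : ℂ) := by
        have h3C : (j : ℂ) - θ ≠ 0 := by
          rw [← neg_ne_zero, neg_sub, sub_eq_neg_add]; exact h2C
        have h4 : -(j : ℂ) + θ = -(j - θ) := by ring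
        simp only [hg]
        rw [h4]
        push_cast
        field_simp
        ring
      have b1 : θ / (j * (j + θ)) ≤ ((j : ℝ) ^ 2)⁻¹ := by
        rw [← one_div, div_le_div_iff₀ (by nlinarith [hθ.1]) (by positivity)]
        nlinarith [hθ.1, hθ.2]
      have b2 : θ / (j * (j - θ)) ≤ 2 * ((j : ℝ) ^ 2)⁻¹ := by
        rw [← div_eq_mul_inv, div_le_div_iff₀ (by nlinarith [hθ.2]) (by positivity)]
        nlinarith [hθ.1, hθ.2]
      have p1 : 0 ≤ θ / (j * (j + θ)) := by
        have := hθ.1; positivity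
      have p2 : 0 ≤ θ / (j * (j - θ)) :=
        div_nonneg hθ.1.le (mul_nonneg (by linarith) (by linarith [hθ.2]))
      rw [e]
      refine (norm_add_le _ _).trans ?_
      rw [norm_mul, norm_mul, norm_mul, norm_mul, norm_unitExp, norm_unitExp,
        hw, norm_dispersiveWeight, norm_dispersiveWeight, Complex.norm_real, Complex.norm_real,
        norm_neg, norm_neg, Real.norm_of_nonneg p1, Real.norm_of_nonneg p2]
      linarith
    have hpos : 1 ≤ 2 ^ K := Nat.one_le_two_pow
    have hset : Finset.Ico (2 ^ K : ℕ) (2 ^ L) = Finset.Ioo (2 ^ K - 1) (2 ^ L) := by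
      ext j; simp only [Finset.mem_Ico, Finset.mem_Ioo]; omega
    calc _ ≤ ∑ j ∈ Finset.Ico (2 ^ K : ℕ) (2 ^ L), 3 * ((j : ℝ) ^ 2)⁻¹ :=
          norm_sum_le_of_le _ hterm
      _ ≤ 3 * (2 / 2 ^ K) := by
          rw [← Finset.mul_sum, hset]
          have := sum_Ioo_inv_sq_le (α := ℝ) (2 ^ K - 1) (2 ^ L)
          rw [Nat.cast_sub hpos] at this
          push_cast at this
          rw [sub_add_cancel] at this
          gcongr
      _ ≤ η / 2 := by
          have h2 : (2 : ℝ) ^ K₂ ≤ 2 ^ K := pow_le_pow_right₀ (by norm_num) (by omega)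
          rw [mul_div_assoc', div_le_iff₀ (by positivity)]
          rw [div_lt_iff₀ hη] at hK₂
          nlinarith
  rw [Finset.sum_sub_distrib] at hdiff
  have := norm_add_le (∑ j ∈ Finset.Ico (2 ^ K : ℕ) (2 ^ L),
      (w j * unitExp (j * z) / (j + θ) + w (-j) * unitExp (-(j * z)) / (-j + θ)) -
      ∑ j ∈ Finset.Ico (2 ^ K : ℕ) (2 ^ L), g j) (∑ j ∈ Finset.Ico (2 ^ K : ℕ) (2 ^ L), g j)
  rw [sub_add_cancel] at this
  linarith

/-! ### Functions of bounded variation against oscillating kernels. -/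

lemma sum_mul_sub_eq {R : Type*} [CommRing R] (f φ : ℕ → R) (M : ℕ) :
    ∑ i ∈ Finset.range M, f i * (φ (i + 1) - φ i) =
      f M * φ M - f 0 * φ 0 - ∑ i ∈ Finset.range M, φ (i + 1) * (f (i + 1) - f i) := by
  induction M with
  | zero => simp
  | succ M ih => rw [Finset.sum_range_succ, Finset.sum_range_succ, ih]; ring

/-- A function of bounded variation pairs with the derivative of a small function to something
small. -/
lemma norm_integral_deriv_mul_le {f Φ Φ' : ℝ → ℂ} {v : ℝ → ℝ} {T ε : ℝ} (hT : 0 < T)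
    (hf : IntervalIntegrable f volume 0 T)
    (hv : ∀ x ∈ Icc 0 T, ∀ y ∈ Icc 0 T, x ≤ y → ‖f y - f x‖ ≤ v y - v x)
    (hΦ : ∀ x, HasDerivAt Φ (Φ' x) x) (hΦ' : Continuous Φ') (hε : ∀ x, ‖Φ x‖ ≤ ε) :
    ‖∫ x in 0..T, Φ' x * f x‖ ≤ ε * (‖f 0‖ + ‖f T‖ + (v T - v 0)) := by
  obtain ⟨B, hB⟩ := (isCompact_Icc (a := (0 : ℝ)) (b := T)).exists_bound_of_continuousOn
    hΦ'.continuousOn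
  have hε0 : 0 ≤ ε := (norm_nonneg _).trans (hε 0)
  have hB0 : 0 ≤ B := (norm_nonneg _).trans (hB 0 ⟨le_rfl, hT.le⟩)
  have hvm : ∀ x ∈ Icc 0 T, ∀ y ∈ Icc 0 T, x ≤ y → v x ≤ v y := fun x hx y hy hxy => by
    linarith [(norm_nonneg _).trans (hv x hx y hy hxy)]
  -- Freeze f on a uniform partition and sum by parts. The size B of Φ' enters only through the
  -- freezing error, which vanishes as the partition is refined; the limiting bound depends on Φ
  -- alone.
  have key : ∀ n : ℕ, ‖∫ x in 0..T, Φ' x * f x‖ ≤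
      ε * (‖f 0‖ + ‖f T‖ + (v T - v 0)) + B * T * (v T - v 0) * (1 / ((n : ℝ) + 1)) := by
    intro n
    set N : ℕ := n + 1 with hN
    have hNp : (0 : ℝ) < N := by positivity
    set a : ℕ → ℝ := fun i => i * (T / N) with ha
    have ha0 : a 0 = 0 := by simp [ha]
    have haN : a N = T := by simp only [ha]; field_simp
    have hstep : ∀ i, a (i + 1) - a i = T / N := fun i => by simp only [ha]; push_cast; ring
    have hmono : ∀ i, a i ≤ a (i + 1) := fun i => by
      have : 0 ≤ T / N := by positivity
      linarith [hstep i]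
    have hmem : ∀ i ≤ N, a i ∈ Icc 0 T := fun i hi => by
      refine ⟨by simp only [ha]; positivity, ?_⟩
      rw [← haN]; simp only [ha]; gcongr
    have hsubset : ∀ i < N, uIcc (a i) (a (i + 1)) ⊆ uIcc 0 T := fun i hi => by
      rw [uIcc_of_le (hmono i), uIcc_of_le hT.le]
      exact Icc_subset_Icc (hmem i hi.le).1 (hmem (i + 1) hi).2
    have hfi : ∀ i < N, IntervalIntegrable f volume (a i) (a (i + 1)) := fun i hi =>
      hf.mono_set (hsubset i hi)
    have hint : ∀ i < N, IntervalIntegrable (fun x => Φ' x * f x) volume (a i) (a (i + 1)) :=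
      fun i hi => (hfi i hi).continuousOn_mul hΦ'.continuousOn
    have hsum := intervalIntegral.sum_integral_adjacent_intervals hint
    rw [ha0, haN] at hsum
    have hpiece : ∀ i ∈ Finset.range N, ∫ x in a i..a (i + 1), Φ' x * f x =
        f (a i) * (Φ (a (i + 1)) - Φ (a i)) +
          ∫ x in a i..a (i + 1), Φ' x * (f x - f (a i)) := by
      intro i hi
      have hi' := Finset.mem_range.mp hi
      have e1 : ∫ x in a i..a (i + 1), Φ' x = Φ (a (i + 1)) - Φ (a i) :=
        intervalIntegral.integral_eq_sub_of_hasDerivAt (fun x _ => hΦ x)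
          (hΦ'.intervalIntegrable _ _)
      have e2 : ∀ x, Φ' x * (f x - f (a i)) = Φ' x * f x - f (a i) * Φ' x := fun x => by ring
      simp only [e2]
      rw [intervalIntegral.integral_sub (hint i hi') ((hΦ'.intervalIntegrable _ _).const_mul _),
        intervalIntegral.integral_const_mul, e1]
      ring
    have herr : ∀ i ∈ Finset.range N, ‖∫ x in a i..a (i + 1), Φ' x * (f x - f (a i))‖ ≤
        B * (T / N) * (v (a (i + 1)) - v (a i)) := by
      intro i hi
      have hi' := Finset.mem_range.mp hi
      have h1 : ∀ x ∈ uIoc (a i) (a (i + 1)), ‖Φ' x * (f x - f (a i))‖ ≤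
          B * (v (a (i + 1)) - v (a i)) := by
        intro x hx
        rw [uIoc_of_le (hmono i)] at hx
        have hxm : x ∈ Icc 0 T := ⟨(hmem i hi'.le).1.trans hx.1.le, hx.2.trans (hmem _ hi').2⟩
        rw [norm_mul]
        have h2 := hv _ (hmem i hi'.le) x hxm hx.1.le
        have h3 := hvm x hxm _ (hmem (i + 1) hi') hx.2
        exact mul_le_mul (hB x hxm) (by linarith) (norm_nonneg _) hB0
      refine (intervalIntegral.norm_integral_le_of_norm_le_const h1).trans_eq ?_
      rw [hstep, abs_of_pos (by positivity)]; ring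
    rw [← hsum, Finset.sum_congr rfl hpiece, Finset.sum_add_distrib,
      sum_mul_sub_eq (fun i => f (a i)) (fun i => Φ (a i)), ha0, haN]
    have hvsum : ∑ i ∈ Finset.range N, (v (a (i + 1)) - v (a i)) = v T - v 0 := by
      rw [Finset.sum_range_sub (fun i => v (a i)), haN, ha0]
    have b1 : ‖∑ i ∈ Finset.range N, Φ (a (i + 1)) * (f (a (i + 1)) - f (a i))‖ ≤
        ε * (v T - v 0) := by
      rw [← hvsum, Finset.mul_sum]
      refine norm_sum_le_of_le _ fun i hi => ?_
      have hi' := Finset.mem_range.mp hi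
      rw [norm_mul]
      exact mul_le_mul (hε _) (hv _ (hmem i hi'.le) _ (hmem _ hi') (hmono i)) (norm_nonneg _) hε0
    have b2 : ‖∑ i ∈ Finset.range N, ∫ x in a i..a (i + 1), Φ' x * (f x - f (a i))‖ ≤
        B * T * (v T - v 0) * (1 / ((n : ℝ) + 1)) := by
      refine (norm_sum_le_of_le _ herr).trans_eq ?_
      rw [← Finset.mul_sum, hvsum, hN]; push_cast; ring
    have b3 : ‖f T * Φ T‖ ≤ ε * ‖f T‖ := by
      rw [norm_mul, mul_comm]; gcongr; exact hε _
    have b4 : ‖f 0 * Φ 0‖ ≤ ε * ‖f 0‖ := by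
      rw [norm_mul, mul_comm]; gcongr; exact hε _
    calc _ ≤ ‖f T * Φ T‖ + ‖f 0 * Φ 0‖ +
          ‖∑ i ∈ Finset.range N, Φ (a (i + 1)) * (f (a (i + 1)) - f (a i))‖ +
          ‖∑ i ∈ Finset.range N, ∫ x in a i..a (i + 1), Φ' x * (f x - f (a i))‖ := by
          refine (norm_add_le _ _).trans ?_
          gcongr
          refine (norm_sub_le _ _).trans ?_
          gcongr
          exact norm_sub_le _ _
      _ ≤ _ := by linarith
  have hlim : Filter.Tendsto (fun n : ℕ => ε * (‖f 0‖ + ‖f T‖ + (v T - v 0)) +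
      B * T * (v T - v 0) * (1 / ((n : ℝ) + 1))) Filter.atTop
      (nhds (ε * (‖f 0‖ + ‖f T‖ + (v T - v 0)) + B * T * (v T - v 0) * 0)) :=
    (tendsto_one_div_add_atTop_nhds_zero_nat.const_mul _).const_add _
  rw [mul_zero, add_zero] at hlim
  exact ge_of_tendsto' hlim key

lemma BoundedVariationOn.exists_variation_bound {f : ℝ → ℂ} {T : ℝ} (hT : 0 ≤ T)
    (hf : BoundedVariationOn f (Icc 0 T)) : ∃ v : ℝ → ℝ,
    ∀ x ∈ Icc 0 T, ∀ y ∈ Icc 0 T, x ≤ y → ‖f y - f x‖ ≤ v y - v x := by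
  refine ⟨variationOnFromTo f (Icc 0 T) 0, fun x hx y hy hxy => ?_⟩
  have h0 : (0 : ℝ) ∈ Icc 0 T := ⟨le_rfl, hT⟩
  have h1 := variationOnFromTo.add hf.locallyBoundedVariationOn h0 hx hy
  rw [← h1, add_sub_cancel_left, variationOnFromTo.eq_of_le _ _ hxy, ← dist_eq_norm, dist_edist]
  apply ENNReal.toReal_mono (hf.locallyBoundedVariationOn x y hx hy)
  exact eVariationOn.edist_le f ⟨hy, hxy, le_rfl⟩ ⟨hx, le_rfl, hxy⟩

/-! ### The basis of quasi-periodic exponentials in L²(0, 2π). -/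

instance : IsFiniteMeasure intervalMeasure := by
  unfold intervalMeasure; infer_instance

lemma integral_intervalMeasure (f : ℝ → ℂ) :
    ∫ x, f x ∂intervalMeasure = ∫ x in (0 : ℝ)..(2 * Real.pi), f x := by
  rw [intervalIntegral.integral_of_le Real.two_pi_pos.le, intervalMeasure]

lemma ae_mem_Ioc_intervalMeasure : ∀ᵐ x ∂intervalMeasure, x ∈ Ioc 0 (2 * Real.pi) :=
  ae_restrict_mem measurableSet_Ioc

lemma memLp_of_continuous {f : ℝ → ℂ} (hf : Continuous f) : MemLp f 2 intervalMeasure := by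
  obtain ⟨B, hB⟩ := (isCompact_Icc (a := (0 : ℝ)) (b := 2 * Real.pi)).exists_bound_of_continuousOn
    hf.continuousOn
  refine MemLp.of_bound hf.aestronglyMeasurable B ?_
  filter_upwards [ae_mem_Ioc_intervalMeasure] with x hx
  exact hB x (Ioc_subset_Icc_self hx)

lemma integrable_of_L2 (f : L2) : Integrable f intervalMeasure :=
  (Lp.memLp f).integrable (by norm_num)

/-- The eigenfunction `e^{i(j+θ)x}`. -/
def eigenfn (θ : ℝ) (j : ℤ) (x : ℝ) : ℂ := Complex.exp (((j + θ : ℝ) * x : ℝ) * Complex.I)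

lemma continuous_eigenfn (θ : ℝ) (j : ℤ) : Continuous (eigenfn θ j) := by
  unfold eigenfn; fun_prop

lemma norm_eigenfn (θ : ℝ) (j : ℤ) (x : ℝ) : ‖eigenfn θ j x‖ = 1 :=
  Complex.norm_exp_ofReal_mul_I _

lemma conj_eigenfn (θ : ℝ) (j : ℤ) (x : ℝ) :
    (starRingEnd ℂ) (eigenfn θ j x) = Complex.exp (-(((j + θ : ℝ) * x : ℝ) * Complex.I)) := by
  rw [eigenfn, ← Complex.exp_conj]; simp

lemma eigenfn_add (θ : ℝ) (j : ℤ) (x y : ℝ) :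
    eigenfn θ j (x + y) = eigenfn θ j x * eigenfn θ j y := by
  rw [eigenfn, eigenfn, eigenfn, ← Complex.exp_add]; congr 1; push_cast; ring

lemma eigenfn_two_pi (θ : ℝ) (j : ℤ) :
    eigenfn θ j (2 * Real.pi) = Complex.exp (Complex.I * (2 * Real.pi * θ)) := by
  have e : (((j + θ : ℝ) * (2 * Real.pi) : ℝ) * Complex.I : ℂ) =
      Complex.I * (2 * Real.pi * θ) + j * (2 * Real.pi * Complex.I) := by push_cast; ring
  rw [eigenfn, e, Complex.exp_add, Complex.exp_int_mul_two_pi_mul_I, mul_one]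

lemma eigenfn_mul_conj (θ : ℝ) (j : ℤ) (x : ℝ) :
    eigenfn θ j x * (starRingEnd ℂ) (eigenfn θ j x) = 1 := by
  rw [Complex.mul_conj, Complex.normSq_eq_norm_sq, norm_eigenfn]; simp

/-- The (unnormalised) Fourier coefficient `∫ e^{-i(j+θ)x} f(x) dx` over `(0, 2π)`. -/
def eigenCoeff (θ : ℝ) (f : ℝ → ℂ) (j : ℤ) : ℂ :=
  ∫ x, (starRingEnd ℂ) (eigenfn θ j x) * f x ∂intervalMeasure

/-- The normalised eigenfunctions as elements of `L²(0, 2π)`. -/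
def eigenLp (θ : ℝ) (j : ℤ) : L2 :=
  (((Real.sqrt (2 * Real.pi))⁻¹ : ℝ) : ℂ) • (memLp_of_continuous (continuous_eigenfn θ j)).toLp

lemma eigenCoeff_congr_ae {θ : ℝ} {f g : ℝ → ℂ} (h : f =ᵐ[intervalMeasure] g) (j : ℤ) :
    eigenCoeff θ f j = eigenCoeff θ g j := by
  refine integral_congr_ae ?_
  filter_upwards [h] with x hx
  rw [hx]

lemma inner_toLp {f : ℝ → ℂ} (hf : MemLp f 2 intervalMeasure) (g : L2) :
    inner ℂ hf.toLp g = ∫ x, (starRingEnd ℂ) (f x) * g x ∂intervalMeasure := by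
  rw [L2.inner_def]
  refine integral_congr_ae ?_
  filter_upwards [hf.coeFn_toLp] with x hx
  rw [hx, RCLike.inner_apply']

lemma inner_eigenLp (θ : ℝ) (j : ℤ) (f : L2) :
    inner ℂ (eigenLp θ j) f = (((Real.sqrt (2 * Real.pi))⁻¹ : ℝ) : ℂ) * eigenCoeff θ f j := by
  rw [eigenLp, inner_smul_left, inner_toLp, Complex.conj_ofReal, eigenCoeff]

lemma integral_conj_eigenfn_mul_eigenfn (θ : ℝ) (i j : ℤ) :
    eigenCoeff θ (eigenfn θ j) i = if i = j then (2 * Real.pi : ℂ) else 0 := by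
  rw [eigenCoeff, integral_intervalMeasure]
  have e : ∀ x : ℝ, (starRingEnd ℂ) (eigenfn θ i x) * eigenfn θ j x =
      Complex.exp (((j - i : ℤ) * Complex.I) * x) := fun x => by
    rw [conj_eigenfn, eigenfn, ← Complex.exp_add]; congr 1; push_cast; ring
  simp only [e]
  split_ifs with h
  · subst h; simp
  · have hc : ((j - i : ℤ) * Complex.I : ℂ) ≠ 0 :=
      mul_ne_zero (by exact_mod_cast sub_ne_zero.mpr (Ne.symm h)) Complex.I_ne_zero
    rw [integral_exp_mul_complex hc]
    have e2 : ((j - i : ℤ) * Complex.I * ((2 * Real.pi : ℝ) : ℂ) : ℂ) =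
        (j - i : ℤ) * (2 * Real.pi * Complex.I) := by push_cast; ring
    rw [e2, Complex.exp_int_mul_two_pi_mul_I]; simp

lemma eigenCoeff_const_mul (θ : ℝ) (c : ℂ) (f : ℝ → ℂ) (j : ℤ) :
    eigenCoeff θ (fun x => c * f x) j = c * eigenCoeff θ f j := by
  rw [eigenCoeff, eigenCoeff, ← integral_const_mul]
  congr 1; ext x; ring

lemma inv_sqrt_two_pi_mul_self :
    (((Real.sqrt (2 * Real.pi))⁻¹ : ℝ) : ℂ) * (((Real.sqrt (2 * Real.pi))⁻¹ : ℝ) : ℂ) *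
      (2 * Real.pi : ℂ) = 1 := by
  have h := Real.mul_self_sqrt Real.two_pi_pos.le
  have h2 : Real.sqrt (2 * Real.pi) ≠ 0 := (Real.sqrt_pos.mpr Real.two_pi_pos).ne'
  have : (Real.sqrt (2 * Real.pi))⁻¹ * (Real.sqrt (2 * Real.pi))⁻¹ * (2 * Real.pi) = 1 := by
    nth_rewrite 3 [← h]; field_simp
  exact_mod_cast this

lemma coeFn_eigenLp (θ : ℝ) (j : ℤ) : eigenLp θ j =ᵐ[intervalMeasure]
    fun x => (((Real.sqrt (2 * Real.pi))⁻¹ : ℝ) : ℂ) * eigenfn θ j x := by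
  filter_upwards [Lp.coeFn_smul (((Real.sqrt (2 * Real.pi))⁻¹ : ℝ) : ℂ)
    ((memLp_of_continuous (continuous_eigenfn θ j)).toLp),
    (memLp_of_continuous (continuous_eigenfn θ j)).coeFn_toLp] with x h1 h2
  rw [eigenLp, h1, Pi.smul_apply, h2, smul_eq_mul]

lemma orthonormal_eigenLp (θ : ℝ) : Orthonormal ℂ (eigenLp θ) := by
  rw [orthonormal_iff_ite]
  intro i j
  rw [inner_eigenLp, eigenCoeff_congr_ae (coeFn_eigenLp θ j), eigenCoeff_const_mul,
    integral_conj_eigenfn_mul_eigenfn]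
  split_ifs
  · rw [← mul_assoc, inv_sqrt_two_pi_mul_self]
  · simp

/-- Multiplication by the unimodular e^{-iθx} carries these coefficients to ordinary Fourier
coefficients, and Parseval's identity applies. -/
lemma eq_zero_of_eigenCoeff_eq_zero {θ : ℝ} (f : L2) (h : ∀ j, eigenCoeff θ f j = 0) : f = 0 := by
  set g : ℝ → ℂ := fun x => Complex.exp (-((θ * x : ℝ) * Complex.I)) * f x with hg
  have hgn : ∀ x, ‖g x‖ = ‖f x‖ := fun x => by
    have e : (-((θ * x : ℝ) * Complex.I) : ℂ) = ((-(θ * x) : ℝ) : ℂ) * Complex.I := by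
      push_cast; ring
    simp only [hg, norm_mul]
    rw [e, Complex.norm_exp_ofReal_mul_I, one_mul]
  have hgm : MemLp g 2 (volume.restrict (Ioc 0 (2 * Real.pi))) := by
    refine (Lp.memLp f).of_le ?_ (Filter.Eventually.of_forall fun x => (hgn x).le)
    refine AEStronglyMeasurable.mul ?_ (Lp.aestronglyMeasurable f)
    exact (by fun_prop : Continuous fun x : ℝ =>
      Complex.exp (-((θ * x : ℝ) * Complex.I))).aestronglyMeasurable
  have hzero : ∀ j, fourierCoeffOn Real.two_pi_pos g j = 0 := fun j => by
    rw [fourierCoeffOn_eq_integral]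
    have := h j
    rw [eigenCoeff, integral_intervalMeasure] at this
    refine smul_eq_zero_of_right _ (Eq.trans ?_ this)
    refine intervalIntegral.integral_congr fun x _ => ?_
    simp only [hg]
    rw [fourier_coe_apply, smul_eq_mul, ← mul_assoc, conj_eigenfn, ← Complex.exp_add]
    congr 2
    have : (Real.pi : ℂ) ≠ 0 := by exact_mod_cast Real.pi_ne_zero
    push_cast
    rw [sub_zero]
    field_simp
    ring
  have hpars := hasSum_sq_fourierCoeffOn Real.two_pi_pos hgm
  simp only [hzero, norm_zero, ne_eq, OfNat.ofNat_ne_zero, not_false_eq_true, zero_pow] at hpars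
  have h0 := hpars.unique hasSum_zero
  have h1 : ∫ x, ‖f x‖ ^ 2 ∂intervalMeasure = 0 := by
    rw [smul_eq_zero] at h0
    rcases h0 with h0 | h0
    · rw [sub_zero, inv_eq_zero] at h0
      exact absurd h0 Real.two_pi_pos.ne'
    · simp only [hgn] at h0
      rw [intervalIntegral.integral_of_le Real.two_pi_pos.le] at h0
      exact h0
  rw [integral_eq_zero_iff_of_nonneg (fun x => by positivity)
    ((memLp_two_iff_integrable_sq_norm (Lp.aestronglyMeasurable f)).mp (Lp.memLp f))] at h1
  rw [Lp.eq_zero_iff_ae_eq_zero]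
  filter_upwards [h1] with x hx
  simpa using hx

/-- The Hilbert basis of normalised eigenfunctions. -/
def eigenBasis (θ : ℝ) : HilbertBasis ℤ ℂ L2 :=
  HilbertBasis.mkOfOrthogonalEqBot (orthonormal_eigenLp θ) (by
    rw [Submodule.eq_bot_iff]
    intro f hf
    apply eq_zero_of_eigenCoeff_eq_zero (θ := θ)
    intro j
    have h := (Submodule.mem_orthogonal _ _).mp hf (eigenLp θ j) (Submodule.subset_span ⟨j, rfl⟩)
    rw [inner_eigenLp, mul_eq_zero] at h
    refine h.resolve_left ?_
    have : Real.sqrt (2 * Real.pi) ≠ 0 := (Real.sqrt_pos.mpr Real.two_pi_pos).ne'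
    exact_mod_cast inv_ne_zero this)

lemma eigenBasis_apply (θ : ℝ) (j : ℤ) : eigenBasis θ j = eigenLp θ j := by
  rw [eigenBasis, HilbertBasis.coe_mkOfOrthogonalEqBot]

lemma eigenBasis_repr (θ : ℝ) (f : L2) (j : ℤ) : (eigenBasis θ).repr f j =
    (((Real.sqrt (2 * Real.pi))⁻¹ : ℝ) : ℂ) * eigenCoeff θ f j := by
  rw [HilbertBasis.repr_apply_apply, eigenBasis_apply, inner_eigenLp]

lemma ext_of_eigenCoeff {θ : ℝ} {f g : L2} (h : ∀ j, eigenCoeff θ f j = eigenCoeff θ g j) :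
    f = g := by
  apply (eigenBasis θ).repr.injective
  ext j
  rw [eigenBasis_repr, eigenBasis_repr, h]

/-! ### Weak solutions: uniqueness and existence. -/

/-- The eigenvalue `P(j + θ)`. -/
def eigenvalue (P : Polynomial ℤ) (θ : ℝ) (j : ℤ) : ℝ :=
  (P.map (Int.castRingHom ℝ)).eval ((j : ℝ) + θ)

lemma hasDerivAt_eigenfn (θ : ℝ) (j : ℤ) (x : ℝ) :
    HasDerivAt (eigenfn θ j) (((j + θ : ℝ) * Complex.I) * eigenfn θ j x) x := by
  have h1 : HasDerivAt (fun x : ℝ => (((j + θ : ℝ) * x : ℝ) : ℂ) * Complex.I)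
      (((j + θ : ℝ) : ℂ) * Complex.I) x := by
    have := (((hasDerivAt_id x).const_mul (j + θ : ℝ)).ofReal_comp).mul_const Complex.I
    simpa using this
  have := h1.cexp
  rw [mul_comm] at this
  exact this

lemma contDiff_eigenfn (θ : ℝ) (j : ℤ) (n : WithTop ℕ∞) : ContDiff ℝ n (eigenfn θ j) := by
  unfold eigenfn
  exact ((Complex.ofRealCLM.contDiff.comp (contDiff_const.mul contDiff_id)).mul
    contDiff_const).cexp

lemma iteratedDeriv_eigenfn (θ : ℝ) (j : ℤ) (m : ℕ) (x : ℝ) :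
    iteratedDeriv m (eigenfn θ j) x = ((j + θ : ℝ) * Complex.I) ^ m * eigenfn θ j x := by
  induction m generalizing x with
  | zero => simp
  | succ m ih =>
    rw [iteratedDeriv_succ, funext ih, ((hasDerivAt_eigenfn θ j x).const_mul _).deriv]
    ring

lemma isQuasiPeriodicTest_eigenfn (θ : ℝ) (n : ℕ) (j : ℤ) :
    IsQuasiPeriodicTest θ n (eigenfn θ j) := by
  refine ⟨contDiff_eigenfn θ j n, fun m _ => ?_⟩
  rw [iteratedDeriv_eigenfn, iteratedDeriv_eigenfn, eigenfn_two_pi]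
  simp [eigenfn]; ring

lemma sum_coeff_mul_eq_eigenvalue (P : Polynomial ℤ) (θ : ℝ) (j : ℤ) :
    ∑ m ∈ Finset.range (P.natDegree + 1),
      (P.coeff m : ℂ) * (-Complex.I) ^ m * ((j + θ : ℝ) * Complex.I) ^ m = eigenvalue P θ j := by
  rw [eigenvalue, Polynomial.eval_map, Polynomial.eval₂_eq_sum_range]
  push_cast
  refine Finset.sum_congr rfl fun m _ => ?_
  rw [mul_assoc, ← mul_pow]
  congr 2
  linear_combination (-(j + θ) : ℂ) * Complex.I_mul_I

lemma diffOp_eigenfn (P : Polynomial ℤ) (θ : ℝ) (j : ℤ) (x : ℝ) :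
    diffOp P (eigenfn θ j) x = eigenvalue P θ j * eigenfn θ j x := by
  rw [← sum_coeff_mul_eq_eigenvalue, diffOp, Finset.sum_mul]
  refine Finset.sum_congr rfl fun m _ => ?_
  rw [iteratedDeriv_eigenfn]; ring

/-- Integration by parts: at 2π the phase of the test function cancels that of the conjugated
eigenfunction, so the boundary terms agree. -/
lemma eigenCoeff_iteratedDeriv_succ {θ : ℝ} {n : ℕ} {φ : ℝ → ℂ} (hφ : IsQuasiPeriodicTest θ n φ)
    (j : ℤ) {m : ℕ} (hm : m < n) : eigenCoeff θ (iteratedDeriv (m + 1) φ) j =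
      ((j + θ : ℝ) * Complex.I) * eigenCoeff θ (iteratedDeriv m φ) j := by
  rw [eigenCoeff, eigenCoeff, integral_intervalMeasure, integral_intervalMeasure]
  have hu : ∀ x, HasDerivAt (fun x => (starRingEnd ℂ) (eigenfn θ j x))
      ((starRingEnd ℂ) (((j + θ : ℝ) * Complex.I) * eigenfn θ j x)) x := fun x =>
    (hasDerivAt_eigenfn θ j x).star
  have hv : ∀ x, HasDerivAt (iteratedDeriv m φ) (iteratedDeriv (m + 1) φ x) x := fun x => by
    rw [iteratedDeriv_succ]
    exact (hφ.contDiff.differentiable_iteratedDeriv m (by exact_mod_cast hm) x).hasDerivAt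
  have hcont : Continuous (iteratedDeriv (m + 1) φ) :=
    hφ.contDiff.continuous_iteratedDeriv (m + 1) (by exact_mod_cast hm)
  have hcont2 : Continuous fun x =>
      (starRingEnd ℂ) (((j + θ : ℝ) * Complex.I) * eigenfn θ j x) :=
    Complex.continuous_conj.comp (continuous_const.mul (continuous_eigenfn θ j))
  rw [intervalIntegral.integral_mul_deriv_eq_deriv_mul (fun x _ => hu x) (fun x _ => hv x)
    (hcont2.intervalIntegrable _ _) (hcont.intervalIntegrable _ _),
    ← hφ.boundary m hm, ← eigenfn_two_pi θ j, ← mul_assoc, mul_comm ((starRingEnd ℂ) _),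
    eigenfn_mul_conj]
  have h0 : eigenfn θ j 0 = 1 := by simp [eigenfn]
  rw [h0, map_one, sub_self, zero_sub, ← intervalIntegral.integral_neg,
    ← intervalIntegral.integral_const_mul]
  congr 1; ext x
  rw [map_mul, map_mul, Complex.conj_ofReal, Complex.conj_I]
  ring

lemma eigenCoeff_iteratedDeriv {θ : ℝ} {n : ℕ} {φ : ℝ → ℂ} (hφ : IsQuasiPeriodicTest θ n φ)
    (j : ℤ) {m : ℕ} (hm : m ≤ n) : eigenCoeff θ (iteratedDeriv m φ) j =
      ((j + θ : ℝ) * Complex.I) ^ m * eigenCoeff θ φ j := by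
  induction m with
  | zero => simp
  | succ m ih => rw [eigenCoeff_iteratedDeriv_succ hφ j hm, ih (by omega)]; ring

lemma continuous_diffOp {θ : ℝ} {P : Polynomial ℤ} {φ : ℝ → ℂ}
    (hφ : IsQuasiPeriodicTest θ P.natDegree φ) : Continuous (diffOp P φ) := by
  unfold diffOp
  refine continuous_finsetSum _ fun m hm => continuous_const.mul ?_
  have : m ≤ P.natDegree := Nat.lt_succ_iff.mp (Finset.mem_range.mp hm)
  exact hφ.contDiff.continuous_iteratedDeriv m (by exact_mod_cast this)

lemma eigenCoeff_diffOp {θ : ℝ} {P : Polynomial ℤ} {φ : ℝ → ℂ}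
    (hφ : IsQuasiPeriodicTest θ P.natDegree φ) (j : ℤ) :
    eigenCoeff θ (diffOp P φ) j = eigenvalue P θ j * eigenCoeff θ φ j := by
  have hterm : ∀ m ∈ Finset.range (P.natDegree + 1), eigenCoeff θ
      (fun x => (P.coeff m : ℂ) * (-Complex.I) ^ m * iteratedDeriv m φ x) j =
      (P.coeff m : ℂ) * (-Complex.I) ^ m * ((j + θ : ℝ) * Complex.I) ^ m *
        eigenCoeff θ φ j := fun m hm => by
    rw [eigenCoeff_const_mul, eigenCoeff_iteratedDeriv hφ j
      (Nat.lt_succ_iff.mp (Finset.mem_range.mp hm))]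
    ring
  rw [← sum_coeff_mul_eq_eigenvalue, Finset.sum_mul, ← Finset.sum_congr rfl hterm]
  simp only [eigenCoeff, diffOp, Finset.mul_sum]
  refine integral_finsetSum _ fun m hm => ?_
  have : m ≤ P.natDegree := Nat.lt_succ_iff.mp (Finset.mem_range.mp hm)
  have hc : Continuous fun x => (starRingEnd ℂ) (eigenfn θ j x) *
      ((P.coeff m : ℂ) * (-Complex.I) ^ m * iteratedDeriv m φ x) :=
    (Complex.continuous_conj.comp (continuous_eigenfn θ j)).mul (continuous_const.mul
      (hφ.contDiff.continuous_iteratedDeriv m (by exact_mod_cast this)))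
  exact (memLp_of_continuous hc).integrable (by norm_num)

lemma integral_mul_conj_eigenfn (θ : ℝ) (f : ℝ → ℂ) (j : ℤ) :
    ∫ x, f x * (starRingEnd ℂ) (eigenfn θ j x) ∂intervalMeasure = eigenCoeff θ f j := by
  rw [eigenCoeff]; congr 1; ext x; ring

/-- The Fourier coefficients of a weak solution. -/
theorem IsWeakSolution.eigenCoeff_eq {θ : ℝ} {P : Polynomial ℤ} {u₀ : L2} {u : ℝ → L2}
    (hu : IsWeakSolution θ P u₀ u) {t : ℝ} (ht : 0 ≤ t) (j : ℤ) :
    eigenCoeff θ (u t) j =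
      Complex.exp (-(Complex.I * (eigenvalue P θ j * t))) * eigenCoeff θ u₀ j := by
  set c : ℝ → ℂ := fun τ => eigenCoeff θ (u τ) j with hc
  have hderiv : ∀ τ, 0 ≤ τ → HasDerivWithinAt c (-Complex.I * (eigenvalue P θ j * c τ)) (Ici 0) τ := by
    intro τ hτ
    have h := hu.weak _ (isQuasiPeriodicTest_eigenfn θ P.natDegree j) τ hτ
    simp only [integral_mul_conj_eigenfn] at h
    have e : ∫ x, u τ x * (starRingEnd ℂ) (diffOp P (eigenfn θ j) x) ∂intervalMeasure =
        eigenvalue P θ j * c τ := by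
      rw [hc]; simp only
      rw [← integral_mul_conj_eigenfn, ← integral_const_mul]
      congr 1; ext x
      rw [diffOp_eigenfn, map_mul, Complex.conj_ofReal]; ring
    rw [e] at h
    exact h
  set E : ℝ → ℂ := fun τ => Complex.exp (Complex.I * (eigenvalue P θ j * τ)) with hE
  have hEd : ∀ τ, HasDerivAt E (E τ * (Complex.I * eigenvalue P θ j)) τ := fun τ => by
    have h1 : HasDerivAt (fun τ : ℝ => Complex.I * (eigenvalue P θ j * (τ : ℂ)))
        (Complex.I * eigenvalue P θ j) τ := by
      have := ((Complex.ofRealCLM.hasDerivAt (x := τ)).const_mul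
        (eigenvalue P θ j : ℂ)).const_mul Complex.I
      simpa using this
    exact h1.cexp
  -- Integrating factor for the scalar equation c' = -iP(j+θ)c, with one-sided derivatives at 0.
  have hprod : ∀ τ, 0 ≤ τ → HasDerivWithinAt (fun τ => E τ * c τ) 0 (Ici 0) τ := fun τ hτ => by
    have h := (hEd τ).hasDerivWithinAt.mul (hderiv τ hτ)
    refine h.congr_deriv ?_
    ring
  have hconst := constant_of_has_deriv_right_zero (f := fun τ => E τ * c τ) (a := 0) (b := t)
    (fun τ hτ => ((hprod τ hτ.1).continuousWithinAt).mono Icc_subset_Ici_self)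
    (fun τ hτ => (hprod τ hτ.1).mono (Ici_subset_Ici.mpr hτ.1)) t ⟨ht, le_rfl⟩
  have hE0 : E 0 = 1 := by simp [hE]
  rw [hE0, one_mul] at hconst
  have hc0 : c 0 = eigenCoeff θ u₀ j := by rw [hc]; simp only; rw [hu.initial]
  rw [← hc0, ← hconst, ← mul_assoc, hE]
  simp only
  rw [← Complex.exp_add, neg_add_cancel, Complex.exp_zero, one_mul]

theorem IsWeakSolution.eqOn {θ : ℝ} {P : Polynomial ℤ} {u₀ : L2} {u v : ℝ → L2}
    (hu : IsWeakSolution θ P u₀ u) (hv : IsWeakSolution θ P u₀ v) : EqOn v u (Ici 0) :=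
  fun t ht => ext_of_eigenCoeff (θ := θ) fun j => by
    rw [hu.eigenCoeff_eq ht, hv.eigenCoeff_eq ht]

lemma norm_exp_neg_I_mul (a b : ℝ) : ‖Complex.exp (-(Complex.I * (a * b)))‖ = 1 := by
  have e : (-(Complex.I * (a * b)) : ℂ) = ((-(a * b) : ℝ) : ℂ) * Complex.I := by push_cast; ring
  rw [e, Complex.norm_exp_ofReal_mul_I]

/-- The coefficient sequence of the evolution. -/
def evolutionSeq (P : Polynomial ℤ) (θ : ℝ) (u₀ : L2) (t : ℝ) : lp (fun _ : ℤ => ℂ) 2 :=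
  ⟨fun j => Complex.exp (-(Complex.I * (eigenvalue P θ j * t))) * (eigenBasis θ).repr u₀ j, by
    have h := lp.memℓp ((eigenBasis θ).repr u₀)
    change Memℓp _ 2
    rw [memℓp_gen_iff (by norm_num)] at h ⊢
    refine h.congr fun j => ?_
    rw [norm_mul, norm_exp_neg_I_mul, one_mul]⟩

/-- The solution operator, a Fourier multiplier in the basis of eigenfunctions. -/
def evolution (P : Polynomial ℤ) (θ : ℝ) (u₀ : L2) (t : ℝ) : L2 :=
  (eigenBasis θ).repr.symm (evolutionSeq P θ u₀ t)

lemma repr_evolution (P : Polynomial ℤ) (θ : ℝ) (u₀ : L2) (t : ℝ) (j : ℤ) :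
    (eigenBasis θ).repr (evolution P θ u₀ t) j =
      Complex.exp (-(Complex.I * (eigenvalue P θ j * t))) * (eigenBasis θ).repr u₀ j := by
  rw [evolution, LinearIsometryEquiv.apply_symm_apply]; rfl

/-- Each mode is continuous in time, and the squared increments are dominated by the summable
4‖c_j‖². -/
lemma continuous_evolution (P : Polynomial ℤ) (θ : ℝ) (u₀ : L2) :
    Continuous (evolution P θ u₀) := by
  refine (eigenBasis θ).repr.symm.continuous.comp ?_
  rw [continuous_iff_continuousAt]
  intro s
  rw [ContinuousAt, tendsto_iff_norm_sub_tendsto_zero]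
  set c : ℤ → ℂ := fun j => (eigenBasis θ).repr u₀ j with hc
  set F : ℝ → ℝ := fun t => ∑' j : ℤ, ‖(Complex.exp (-(Complex.I * (eigenvalue P θ j * t))) -
    Complex.exp (-(Complex.I * (eigenvalue P θ j * s)))) * c j‖ ^ 2 with hF
  have hnorm : ∀ t, ‖evolutionSeq P θ u₀ t - evolutionSeq P θ u₀ s‖ = Real.sqrt (F t) := by
    intro t
    have h := lp.norm_rpow_eq_tsum (p := 2) (by norm_num)
      (evolutionSeq P θ u₀ t - evolutionSeq P θ u₀ s)
    simp only [ENNReal.toReal_ofNat, Real.rpow_ofNat] at h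
    rw [← Real.sqrt_sq (norm_nonneg (evolutionSeq P θ u₀ t - evolutionSeq P θ u₀ s)), h]
    congr 2; ext j
    rw [hc, sub_mul]; rfl
  have hsum : Summable fun j => 4 * ‖c j‖ ^ 2 := by
    have h := lp.memℓp ((eigenBasis θ).repr u₀)
    rw [memℓp_gen_iff (by norm_num)] at h
    refine (h.mul_left 4).congr fun j => ?_
    simp [hc]
  have hFc : Continuous F := by
    refine continuous_tsum (fun j => by fun_prop) hsum fun j t => ?_
    rw [norm_pow, norm_norm, norm_mul, mul_pow]
    gcongr
    have h1 := norm_sub_le (Complex.exp (-(Complex.I * (eigenvalue P θ j * t))))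
      (Complex.exp (-(Complex.I * (eigenvalue P θ j * s))))
    rw [norm_exp_neg_I_mul, norm_exp_neg_I_mul] at h1
    nlinarith [norm_nonneg (Complex.exp (-(Complex.I * (eigenvalue P θ j * t))) -
      Complex.exp (-(Complex.I * (eigenvalue P θ j * s))))]
  have hFs : F s = 0 := by simp [hF]
  simp only [hnorm]
  have := (Real.continuous_sqrt.comp hFc).tendsto s
  rw [Function.comp_apply, hFs, Real.sqrt_zero] at this
  exact this

/-- The pairing is differentiated termwise. The unbounded eigenvalue is moved onto the test
function, where it produces the coefficients of P(-i∂ₓ)φ ∈ L²; so u₀ needs no smoothness. -/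
theorem isWeakSolution_evolution (P : Polynomial ℤ) (θ : ℝ) (u₀ : L2) :
    IsWeakSolution θ P u₀ (evolution P θ u₀) := by
  refine ⟨(continuous_evolution P θ u₀).continuousOn, ?_, fun φ hφ t _ => ?_⟩
  · apply (eigenBasis θ).repr.injective
    ext j
    rw [repr_evolution]; simp
  set b := eigenBasis θ with hb
  have hφm := memLp_of_continuous hφ.contDiff.continuous
  have hψm := memLp_of_continuous (continuous_diffOp hφ)
  have hin : ∀ {f : ℝ → ℂ} (hf : MemLp f 2 intervalMeasure) (g : L2),
      ∫ x, g x * (starRingEnd ℂ) (f x) ∂intervalMeasure = inner ℂ hf.toLp g := fun hf g => by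
    rw [inner_toLp]; congr 1; ext x; ring
  simp only [hin hφm, hin hψm]
  have hψφ : ∀ j, inner ℂ hψm.toLp (b j) = eigenvalue P θ j * inner ℂ hφm.toLp (b j) := by
    intro j
    have h : inner ℂ (b j) hψm.toLp = eigenvalue P θ j * inner ℂ (b j) hφm.toLp := by
      rw [hb, eigenBasis_apply, inner_eigenLp, inner_eigenLp, eigenCoeff_congr_ae hψm.coeFn_toLp,
        eigenCoeff_congr_ae hφm.coeFn_toLp, eigenCoeff_diffOp hφ]
      ring
    rw [← inner_conj_symm, h, map_mul, Complex.conj_ofReal, inner_conj_symm]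
  have hexp : ∀ (f : L2) (τ : ℝ), inner ℂ f (evolution P θ u₀ τ) = ∑' j, inner ℂ f (b j) *
      (Complex.exp (-(Complex.I * (eigenvalue P θ j * τ))) * inner ℂ (b j) u₀) := by
    intro f τ
    rw [← b.tsum_inner_mul_inner]
    congr 1; ext j
    rw [← b.repr_apply_apply, repr_evolution, ← b.repr_apply_apply]
  simp only [hexp]
  -- A majorant of the differentiated series uniform in time, since the exponentials are unimodular.
  have hsum : Summable fun j => ‖inner ℂ hψm.toLp (b j) * inner ℂ (b j) u₀‖ :=
    (b.summable_inner_mul_inner _ _).norm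
  have hd : ∀ (j : ℤ) (τ : ℝ), HasDerivAt (fun τ : ℝ => inner ℂ hφm.toLp (b j) *
      (Complex.exp (-(Complex.I * (eigenvalue P θ j * τ))) * inner ℂ (b j) u₀))
      (-Complex.I * (inner ℂ hψm.toLp (b j) *
      (Complex.exp (-(Complex.I * (eigenvalue P θ j * τ))) * inner ℂ (b j) u₀))) τ := by
    intro j τ
    have h1 : HasDerivAt (fun τ : ℝ => -(Complex.I * (eigenvalue P θ j * (τ : ℂ))))
        (-(Complex.I * eigenvalue P θ j)) τ := by
      have := (((Complex.ofRealCLM.hasDerivAt (x := τ)).const_mul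
        (eigenvalue P θ j : ℂ)).const_mul Complex.I).fun_neg
      simpa using this
    have h2 := ((h1.cexp.mul_const (inner ℂ (b j) u₀)).const_mul (inner ℂ hφm.toLp (b j)))
    refine h2.congr_deriv ?_
    rw [hψφ]; ring
  have h := hasDerivAt_tsum hsum hd (fun j τ => by
    rw [norm_mul, norm_neg, Complex.norm_I, one_mul, norm_mul, norm_mul, norm_exp_neg_I_mul,
      one_mul, ← norm_mul]) (y₀ := 0) (by
        simpa using b.summable_inner_mul_inner hφm.toLp u₀) t
  rw [tsum_mul_left] at h
  exact h.hasDerivWithinAt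

/-! ### Rational θ: revival by translations. -/

lemma exp_eigenvalue_rational_time (P : Polynomial ℤ) (θ : ℝ) (p q : ℕ) (j : ℤ) :
    Complex.exp (-(Complex.I * (eigenvalue P θ j * (2 * Real.pi * (p / q) : ℝ)))) =
      dispersiveWeight P p q θ j := by
  rw [dispersiveWeight, unitExp, eigenvalue]
  congr 1
  push_cast
  ring

lemma quasiPeriodicExt_add_two_pi (θ : ℝ) (f : ℝ → ℂ) (x : ℝ) :
    quasiPeriodicExt θ f (x + 2 * Real.pi) =
      Complex.exp (Complex.I * (2 * Real.pi * θ)) * quasiPeriodicExt θ f x := by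
  have h : (x + 2 * Real.pi) / (2 * Real.pi) = x / (2 * Real.pi) + 1 := by
    rw [add_div, div_self Real.two_pi_pos.ne']
  rw [quasiPeriodicExt, quasiPeriodicExt, h, Int.floor_add_one,
    ← mul_assoc (Complex.exp _) (Complex.exp _), ← Complex.exp_add]
  congr 2
  · push_cast; ring
  · push_cast; ring

lemma quasiPeriodicExt_of_mem_Ico (θ : ℝ) (f : ℝ → ℂ) {x : ℝ} (hx : x ∈ Ico 0 (2 * Real.pi)) :
    quasiPeriodicExt θ f x = f x := by
  have h : ⌊x / (2 * Real.pi)⌋ = 0 := by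
    rw [Int.floor_eq_zero_iff]
    exact ⟨div_nonneg hx.1 Real.two_pi_pos.le, (div_lt_one Real.two_pi_pos).mpr hx.2⟩
  simp [quasiPeriodicExt, h]

lemma measurable_quasiPeriodicExt (θ : ℝ) {f : ℝ → ℂ} (hf : Measurable f) :
    Measurable (quasiPeriodicExt θ f) := by
  unfold quasiPeriodicExt
  have h : Measurable fun x : ℝ => (⌊x / (2 * Real.pi)⌋ : ℝ) :=
    (measurable_from_top.comp (Int.measurable_floor.comp (measurable_id.div_const _)) :
      Measurable ((fun m : ℤ => (m : ℝ)) ∘ fun x : ℝ => ⌊x / (2 * Real.pi)⌋))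
  refine Measurable.mul ?_ (hf.comp (measurable_id.sub (measurable_const.mul h)))
  refine Complex.measurable_exp.comp (measurable_const.mul (measurable_const.mul ?_))
  simpa [Function.comp_def] using Complex.measurable_ofReal.comp h

lemma norm_exp_quasi (θ : ℝ) : ‖Complex.exp (Complex.I * (2 * Real.pi * θ))‖ = 1 := by
  have e : (Complex.I * (2 * Real.pi * θ) : ℂ) = ((2 * Real.pi * θ : ℝ) : ℂ) * Complex.I := by
    push_cast; ring
  rw [e, Complex.norm_exp_ofReal_mul_I]

lemma intervalIntegrable_iff_integrable_intervalMeasure {E : Type*} [NormedAddCommGroup E]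
    {f : ℝ → E} :
    IntervalIntegrable f volume 0 (2 * Real.pi) ↔ Integrable f intervalMeasure := by
  rw [intervalIntegrable_iff_integrableOn_Ioc_of_le Real.two_pi_pos.le]; rfl

lemma memLp_quasiPeriodicExt_translate (θ s : ℝ) (u : L2) :
    MemLp (fun x => quasiPeriodicExt θ u (x - s)) 2 intervalMeasure := by
  have hm : Measurable (quasiPeriodicExt θ u) :=
    measurable_quasiPeriodicExt θ (Lp.stronglyMeasurable u).measurable
  have hm' : Measurable fun x => quasiPeriodicExt θ u (x - s) :=
    hm.comp (measurable_id.sub_const s)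
  rw [memLp_two_iff_integrable_sq_norm hm'.aestronglyMeasurable,
    ← intervalIntegrable_iff_integrable_intervalMeasure]
  set F : ℝ → ℝ := fun x => ‖quasiPeriodicExt θ u x‖ ^ 2 with hF
  have hper : Function.Periodic F (2 * Real.pi) := fun x => by
    simp only [hF]
    rw [quasiPeriodicExt_add_two_pi, norm_mul, norm_exp_quasi, one_mul]
  have h0 : IntervalIntegrable F volume 0 (2 * Real.pi) := by
    have h1 : Integrable (fun x => ‖u x‖ ^ 2) intervalMeasure :=
      (memLp_two_iff_integrable_sq_norm (Lp.aestronglyMeasurable u)).mp (Lp.memLp u)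
    rw [← intervalIntegrable_iff_integrable_intervalMeasure] at h1
    refine h1.congr_uIoo fun x hx => ?_
    rw [uIoo_of_le Real.two_pi_pos.le] at hx
    simp only [hF]
    rw [quasiPeriodicExt_of_mem_Ico θ u (Ioo_subset_Ico_self hx)]
  have h2 := hper.intervalIntegrable₀ Real.two_pi_pos.ne' h0 (0 - s) (2 * Real.pi - s)
  have h3 := h2.comp_sub_right s
  rw [sub_add_cancel, sub_add_cancel] at h3
  exact h3

/-- The conjugated eigenfunction times the quasi-periodic extension is 2π-periodic, so its integral
over a period is translation invariant. -/
lemma eigenCoeff_quasiPeriodicExt_translate (θ s : ℝ) (f : ℝ → ℂ) (j : ℤ) :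
    eigenCoeff θ (fun x => quasiPeriodicExt θ f (x - s)) j =
      (starRingEnd ℂ) (eigenfn θ j s) * eigenCoeff θ f j := by
  rw [eigenCoeff, eigenCoeff, integral_intervalMeasure, integral_intervalMeasure]
  set h : ℝ → ℂ := fun x => (starRingEnd ℂ) (eigenfn θ j x) * quasiPeriodicExt θ f x with hh
  have hper : Function.Periodic h (2 * Real.pi) := fun x => by
    simp only [hh]
    rw [quasiPeriodicExt_add_two_pi, eigenfn_add, map_mul, ← eigenfn_two_pi θ j]
    linear_combination ((starRingEnd ℂ) (eigenfn θ j x) * quasiPeriodicExt θ f x) *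
      eigenfn_mul_conj θ j (2 * Real.pi)
  have e : ∀ x, (starRingEnd ℂ) (eigenfn θ j x) * quasiPeriodicExt θ f (x - s) =
      (starRingEnd ℂ) (eigenfn θ j s) * h (x - s) := fun x => by
    simp only [hh]
    rw [← mul_assoc, ← map_mul, ← eigenfn_add, add_sub_cancel]
  simp only [e]
  rw [intervalIntegral.integral_const_mul, intervalIntegral.integral_comp_sub_right]
  congr 1
  have h1 := hper.intervalIntegral_add_eq (0 - s) 0
  rw [zero_add] at h1
  have e2 : 2 * Real.pi - s = 0 - s + 2 * Real.pi := by ring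
  rw [e2, h1]
  refine intervalIntegral.integral_congr_Ioo_of_le Real.two_pi_pos.le fun x hx => ?_
  simp only [hh]
  rw [quasiPeriodicExt_of_mem_Ico θ f (Ioo_subset_Ico_self hx)]

lemma sum_unitExp_div {Q : ℕ} (hQ : 0 < Q) (m : ℤ) :
    ∑ r ∈ Finset.range Q, unitExp (r * (m / Q)) = if (Q : ℤ) ∣ m then (Q : ℂ) else 0 := by
  have hQp : (Q : ℝ) ≠ 0 := by exact_mod_cast hQ.ne'
  split_ifs with h
  · obtain ⟨t, rfl⟩ := h
    have e : ∀ r ∈ Finset.range Q, unitExp (r * (((Q * t : ℤ) : ℝ) / Q)) = 1 := fun r _ => by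
      rw [← unitExp_intCast (r * t)]; congr 1; push_cast; field_simp
    rw [Finset.sum_congr rfl e]; simp
  · have h1 : unitExp (m / Q) ≠ 1 := by
      rw [unitExp, Ne, Complex.exp_eq_one_iff]
      rintro ⟨t, ht⟩
      apply h
      refine ⟨t, ?_⟩
      have h2 : (2 * Real.pi * Complex.I : ℂ) ≠ 0 := Complex.two_pi_I_ne_zero
      have h3 : ((m / Q : ℝ) : ℂ) = t := by
        apply mul_right_cancel₀ h2; rw [← ht]; ring
      have h4 : (m / Q : ℝ) = t := by exact_mod_cast h3
      rw [div_eq_iff hQp] at h4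
      have : m = t * Q := by exact_mod_cast h4
      rw [this, mul_comm]
    have h5 : ∀ r : ℕ, unitExp (r * (m / Q)) = unitExp (m / Q) ^ r := fun r => by
      rw [unitExp, unitExp, ← Complex.exp_nat_mul]; congr 1; push_cast; ring
    simp only [h5]
    rw [geom_sum_eq h1, ← h5, mul_div_cancel₀ _ hQp, unitExp_intCast, sub_self, zero_div]

lemma periodic_eq_emod {w : ℤ → ℂ} {Q : ℕ} (hw : ∀ j, w (j + Q) = w j) (j : ℤ) :
    w (j % Q) = w j := by
  have h : Function.Periodic w (Q : ℤ) := hw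
  rw [Int.emod_def, mul_comm]
  exact h.sub_int_mul_eq (j / Q)

/-- Finite Fourier expansion of a periodic sequence. -/
lemma periodic_eq_sum {w : ℤ → ℂ} {Q : ℕ} (hQ : 0 < Q) (hw : ∀ j, w (j + Q) = w j) (j : ℤ) :
    w j = ∑ r ∈ Finset.range Q, ((Q : ℂ)⁻¹ * ∑ l ∈ Finset.range Q, w l * unitExp (r * (l / Q))) *
      unitExp (-(r * (j / Q))) := by
  have hQp : (Q : ℂ) ≠ 0 := by exact_mod_cast hQ.ne'
  have e : ∀ r ∈ Finset.range Q,
      ((Q : ℂ)⁻¹ * ∑ l ∈ Finset.range Q, w l * unitExp (r * (l / Q))) * unitExp (-(r * (j / Q))) =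
      ∑ l ∈ Finset.range Q, (Q : ℂ)⁻¹ * w l * unitExp (r * (((l - j : ℤ) : ℝ) / Q)) := by
    intro r _
    rw [Finset.mul_sum, Finset.sum_mul]
    refine Finset.sum_congr rfl fun l _ => ?_
    have e2 : (r * (((l - j : ℤ) : ℝ) / Q)) = r * (l / Q) + -(r * (j / Q)) := by push_cast; ring
    rw [e2, unitExp_add]; ring
  rw [Finset.sum_congr rfl e, Finset.sum_comm]
  simp only [← Finset.mul_sum, sum_unitExp_div hQ]
  have hQZ : (0 : ℤ) < Q := by exact_mod_cast hQ
  have hnn := Int.emod_nonneg j hQZ.ne'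
  have hlt := Int.emod_lt_of_pos j hQZ
  rw [Finset.sum_eq_single (j % Q).toNat]
  · rw [Int.toNat_of_nonneg hnn, periodic_eq_emod hw, if_pos]
    · field_simp
    · exact ⟨-(j / Q), by rw [Int.emod_def]; ring⟩
  · intro l hl hne
    rw [if_neg, mul_zero]
    intro hdvd
    apply hne
    have h1 : (l : ℤ) % Q = j % Q :=
      Int.emod_eq_emod_iff_emod_sub_eq_zero.mpr (Int.emod_eq_zero_of_dvd hdvd)
    rw [Int.emod_eq_of_lt (by positivity) (by exact_mod_cast Finset.mem_range.mp hl)] at h1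
    omega
  · intro hnot
    exact absurd (Finset.mem_range.mpr (by omega)) hnot

lemma conj_eigenfn_eq_unitExp (θ : ℝ) (j : ℤ) {Q : ℕ} (r : ℕ) :
    (starRingEnd ℂ) (eigenfn θ j (2 * Real.pi * (r / Q))) =
      unitExp (-(r * (j / Q))) * unitExp (-(r * (θ / Q))) := by
  rw [conj_eigenfn, ← unitExp_add, unitExp]
  congr 1
  push_cast
  ring

/-- Revival: for rational `θ` the evolution at a rational time is a finite combination of
translations. -/
theorem exists_revival {θ : ℝ} (hθ : ¬ Irrational θ) (P : Polynomial ℤ) {p q : ℕ} (hq : 0 < q) :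
    ∃ (N : ℕ) (c : Fin N → ℂ) (s : Fin N → ℝ),
      ∀ (u₀ : L2) (u : ℝ → L2), IsWeakSolution θ P u₀ u →
        u (2 * Real.pi * (p / q)) =ᵐ[intervalMeasure]
          fun x => ∑ k, c k * quasiPeriodicExt θ u₀ (x - s k) := by
  rw [Irrational, not_not] at hθ
  obtain ⟨ρ, rfl⟩ := hθ
  set θ : ℝ := (ρ : ℝ) with hθ
  have hθab : θ = ρ.num / ρ.den := by rw [hθ]; exact_mod_cast (Rat.num_div_den ρ).symm
  set w := dispersiveWeight P p q θ with hw
  set Q := q * ρ.den ^ P.natDegree with hQ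
  have hQpos : 0 < Q := Nat.mul_pos hq (pow_pos ρ.den_pos _)
  have hper : ∀ j, w (j + Q) = w j := fun j => by
    rw [hw, hθab]
    exact unitExp_eval_periodic P p hq ρ.den_pos ρ.num j
  set d : ℕ → ℂ := fun r => (Q : ℂ)⁻¹ * ∑ l ∈ Finset.range Q, w l * unitExp (r * (l / Q)) with hd
  -- Translation by 2πr/Q multiplies the j-th coefficient by e(-rj/Q)e(-rθ/Q). The extra factor in c
  -- cancels the second part, leaving the finite Fourier expansion of w.
  set c : ℕ → ℂ := fun r => d r * unitExp (r * (θ / Q)) with hc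
  set s : ℕ → ℝ := fun r => 2 * Real.pi * (r / Q) with hs
  refine ⟨Q, fun k => c k, fun k => s k, fun u₀ u hu => ?_⟩
  have hmem : ∀ r ∈ Finset.range Q,
      MemLp (fun x => c r * quasiPeriodicExt θ u₀ (x - s r)) 2 intervalMeasure := fun r _ =>
    (memLp_quasiPeriodicExt_translate θ (s r) u₀).const_mul (c r)
  have hsumMem := memLp_finsetSum (Finset.range Q) hmem
  have heq : u (2 * Real.pi * (p / q)) = hsumMem.toLp := by
    apply ext_of_eigenCoeff (θ := θ)
    intro j
    rw [hu.eigenCoeff_eq (by positivity), exp_eigenvalue_rational_time,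
      eigenCoeff_congr_ae hsumMem.coeFn_toLp]
    have h1 : eigenCoeff θ (fun x => ∑ r ∈ Finset.range Q,
        c r * quasiPeriodicExt θ u₀ (x - s r)) j =
        ∑ r ∈ Finset.range Q, eigenCoeff θ (fun x => c r * quasiPeriodicExt θ u₀ (x - s r)) j := by
      simp only [eigenCoeff, Finset.mul_sum]
      refine integral_finsetSum _ fun r hr => ?_
      refine ((hmem r hr).integrable (by norm_num)).bdd_mul (c := 1) ?_ ?_
      · exact (Complex.continuous_conj.comp (continuous_eigenfn θ j)).aestronglyMeasurable
      · exact Filter.Eventually.of_forall fun x => by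
          rw [RCLike.norm_conj, norm_eigenfn]
    rw [h1, ← hw, periodic_eq_sum hQpos hper j, Finset.sum_mul]
    refine Finset.sum_congr rfl fun r _ => ?_
    rw [eigenCoeff_const_mul, eigenCoeff_quasiPeriodicExt_translate, conj_eigenfn_eq_unitExp]
    have h2 : unitExp (r * (θ / Q)) * unitExp (-(r * (θ / Q))) = 1 := by
      rw [← unitExp_add, add_neg_cancel, unitExp_zero]
    simp only [hc, hd]
    linear_combination (-((Q : ℂ)⁻¹ * ∑ l ∈ Finset.range Q, w l * unitExp (r * (l / Q))) *
      unitExp (-(r * (j / Q))) * eigenCoeff θ u₀ j) * h2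
  rw [heq]
  filter_upwards [hsumMem.coeFn_toLp] with x hx
  rw [hx, Finset.sum_range]

/-! ### Irrational θ: uniform convergence and continuity. -/

/-- The dyadic symmetric partial sums of the Fourier series `∑ a_j e^{i(j+θ)x}`. -/
def partialSum (θ : ℝ) (a : ℤ → ℂ) (K : ℕ) (x : ℝ) : ℂ :=
  ∑ j ∈ Finset.range (2 ^ K), (a j * eigenfn θ j x + a (-j) * eigenfn θ (-j) x) -
    a 0 * eigenfn θ 0 x

lemma continuous_partialSum (θ : ℝ) (a : ℤ → ℂ) (K : ℕ) : Continuous (partialSum θ a K) := by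
  have := continuous_eigenfn θ
  unfold partialSum
  fun_prop

lemma partialSum_two_pi (θ : ℝ) (a : ℤ → ℂ) (K : ℕ) : partialSum θ a K (2 * Real.pi) =
    Complex.exp (Complex.I * (2 * Real.pi * θ)) * partialSum θ a K 0 := by
  have h0 : ∀ j, eigenfn θ j 0 = 1 := fun j => by simp [eigenfn]
  simp only [partialSum, eigenfn_two_pi, h0]
  rw [mul_sub, Finset.mul_sum]
  congr 1
  · exact Finset.sum_congr rfl fun j _ => by ring
  · ring

lemma partialSum_sub (θ : ℝ) (a : ℤ → ℂ) {K L : ℕ} (h : K ≤ L) (x : ℝ) :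
    partialSum θ a L x - partialSum θ a K x =
      ∑ j ∈ Finset.Ico (2 ^ K : ℕ) (2 ^ L),
        (a j * eigenfn θ j x + a (-j) * eigenfn θ (-j) x) := by
  rw [Finset.sum_Ico_eq_sub _ (Nat.pow_le_pow_right (by norm_num) h), partialSum, partialSum]
  ring

lemma repr_smul_eigenBasis (θ : ℝ) (f : L2) (j : ℤ) :
    ((eigenBasis θ).repr f j • eigenBasis θ j : L2) =ᵐ[intervalMeasure]
      fun x => (2 * Real.pi : ℂ)⁻¹ * eigenCoeff θ f j * eigenfn θ j x := by
  rw [eigenBasis_repr, eigenBasis_apply]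
  filter_upwards [Lp.coeFn_smul ((((Real.sqrt (2 * Real.pi))⁻¹ : ℝ) : ℂ) * eigenCoeff θ f j)
    (eigenLp θ j), coeFn_eigenLp θ j] with x h1 h2
  rw [h1, Pi.smul_apply, h2, smul_eq_mul]
  have h3 := inv_sqrt_two_pi_mul_self
  have h4 : (2 * Real.pi : ℂ) ≠ 0 := by exact_mod_cast Real.two_pi_pos.ne'
  have h5 : (2 * Real.pi : ℂ)⁻¹ = (((Real.sqrt (2 * Real.pi))⁻¹ : ℝ) : ℂ) *
      (((Real.sqrt (2 * Real.pi))⁻¹ : ℝ) : ℂ) := inv_eq_of_mul_eq_one_left h3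
  rw [h5]; ring

/-- A pointwise limit of the dyadic partial sums of the eigenfunction expansion agrees with the
function almost everywhere. -/
lemma ae_eq_of_tendsto_partialSum {θ : ℝ} {f : L2} {g : ℝ → ℂ}
    (h : ∀ x, Filter.Tendsto
      (fun K => partialSum θ (fun j => (2 * Real.pi : ℂ)⁻¹ * eigenCoeff θ f j) K x)
      Filter.atTop (nhds (g x))) :
    f =ᵐ[intervalMeasure] g := by
  set b := eigenBasis θ with hb
  set F : ℤ → L2 := fun j => b.repr f j • b j with hF
  set a : ℤ → ℂ := fun j => (2 * Real.pi : ℂ)⁻¹ * eigenCoeff θ f j with ha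
  have hFae : ∀ j, F j =ᵐ[intervalMeasure] fun x => a j * eigenfn θ j x := repr_smul_eigenBasis θ f
  have hsum : HasSum F f := b.hasSum_repr f
  -- The pairing of j with -j counts j = 0 twice, hence the subtraction.
  set S : ℕ → L2 := fun N => ∑ j ∈ Finset.range N, (F j + F (-j)) - F 0 with hS
  have hlim : Filter.Tendsto (fun K : ℕ => S (2 ^ K)) Filter.atTop (nhds f) := by
    have h1 := (hsum.nat_add_neg.tendsto_sum_nat).sub_const (F 0)
    rw [add_sub_cancel_right] at h1
    exact h1.comp (tendsto_pow_atTop_atTop_of_one_lt (by norm_num : 1 < 2))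
  have hSae : ∀ N : ℕ, (∑ j ∈ Finset.range N, (F j + F (-j)) : L2) =ᵐ[intervalMeasure]
      fun x => ∑ j ∈ Finset.range N, (a j * eigenfn θ j x + a (-j) * eigenfn θ (-j) x) := by
    intro N
    induction N with
    | zero =>
      simp only [Finset.range_zero, Finset.sum_empty]
      exact Lp.coeFn_zero ℂ 2 intervalMeasure
    | succ N ih =>
      rw [Finset.sum_range_succ]
      filter_upwards [Lp.coeFn_add (∑ j ∈ Finset.range N, (F j + F (-j))) (F N + F (-N)),
        Lp.coeFn_add (F N) (F (-N)), hFae N, hFae (-N), ih] with x h1 h2 h3 h4 h5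
      rw [h1, Pi.add_apply, h2, Pi.add_apply, h3, h4, h5, Finset.sum_range_succ]
  have hSK : ∀ K : ℕ, S (2 ^ K) =ᵐ[intervalMeasure] partialSum θ a K := fun K => by
    filter_upwards [Lp.coeFn_sub (∑ j ∈ Finset.range (2 ^ K), (F j + F (-j))) (F 0), hFae 0,
      hSae (2 ^ K)] with x h1 h2 h3
    rw [hS]
    simp only
    rw [h1, Pi.sub_apply, h2, h3, partialSum]
  -- Convergence in L² gives almost everywhere convergence along a subsequence, which identifies the
  -- pointwise limit.
  obtain ⟨ns, hns, hae⟩ := (tendstoInMeasure_of_tendsto_Lp hlim).exists_seq_tendsto_ae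
  filter_upwards [hae, ae_all_iff.mpr hSK] with x h1 h2
  simp only [h2] at h1
  exact tendsto_nhds_unique h1 ((h x).comp hns.tendsto_atTop)

/-- Blocks of the evolved Fourier series of a function of bounded variation are uniformly small. -/
lemma norm_sum_coeff_le {θ η V : ℝ} (hθ : θ ∈ Ioo (0 : ℝ) 1) {w : ℤ → ℂ} {A : Finset ℕ}
    (hsmall : ∀ z : ℝ, ‖∑ j ∈ A, (w j * unitExp (j * z) / (j + θ) +
      w (-j) * unitExp (-(j * z)) / (-j + θ))‖ ≤ η)
    {f : ℝ → ℂ} {v : ℝ → ℝ} (hf : IntervalIntegrable f volume 0 (2 * Real.pi))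
    (hv : ∀ x ∈ Icc 0 (2 * Real.pi), ∀ y ∈ Icc 0 (2 * Real.pi), x ≤ y → ‖f y - f x‖ ≤ v y - v x)
    (hV : V = ‖f 0‖ + ‖f (2 * Real.pi)‖ + (v (2 * Real.pi) - v 0)) (x : ℝ) :
    ‖∑ j ∈ A, (w j * eigenCoeff θ f j * eigenfn θ j x +
      w (-j) * eigenCoeff θ f (-j) * eigenfn θ (-j) x)‖ ≤ η * V := by
  have hne : ∀ j : ℤ, ((j + θ : ℝ) : ℂ) ≠ 0 := fun j => by
    have : (j + θ : ℝ) ≠ 0 := by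
      intro h0
      have h1 : (j : ℝ) < 0 := by linarith [hθ.1]
      have h2 : (-1 : ℝ) < j := by linarith [hθ.2]
      have h3 : j < 0 := by exact_mod_cast h1
      have h4 : -1 < j := by exact_mod_cast h2
      omega
    exact_mod_cast this
  set E : ℤ → ℝ → ℂ := fun j y => eigenfn θ j (x - y) with hE
  have hEd : ∀ j y, HasDerivAt (E j) (-(((j + θ : ℝ) * Complex.I) * E j y)) y := fun j y =>
    (hasDerivAt_eigenfn θ j (x - y)).comp_const_sub x y
  have hEc : ∀ j, Continuous (E j) := fun j =>
    (continuous_eigenfn θ j).comp (continuous_const.sub continuous_id)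
  -- An antiderivative in y of w_j e^{i(j+θ)(x-y)}; the division by j + θ is legitimate since 0 < θ
  -- < 1.
  set B : ℤ → ℝ → ℂ := fun j y => w j * (Complex.I * (E j y / (j + θ : ℝ))) with hB
  have hBd : ∀ j y, HasDerivAt (B j) (w j * E j y) y := fun j y => by
    have := (((hEd j y).div_const ((j + θ : ℝ) : ℂ)).const_mul Complex.I).const_mul (w j)
    refine this.congr_deriv ?_
    have hI := Complex.I_mul_I
    have := hne j
    field_simp
    linear_combination (-(w j * E j y)) * hI
  set Φ : ℝ → ℂ := fun y => ∑ j ∈ A, (B j y + B (-j) y) with hΦdef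
  set Φ' : ℝ → ℂ := fun y => ∑ j ∈ A, (w j * E j y + w (-j) * E (-j) y) with hΦ'def
  have hΦ : ∀ y, HasDerivAt Φ (Φ' y) y := fun y =>
    HasDerivAt.fun_sum fun j _ => (hBd j y).add (hBd (-j) y)
  have hΦ' : Continuous Φ' := by
    simp only [hΦ'def]; fun_prop
  -- Up to a unimodular factor, Φ y is the kernel sum at z = (x - y)/(2π); this is why `hsmall` must
  -- hold for every z.
  have hbound : ∀ y, ‖Φ y‖ ≤ η := by
    intro y
    have hEu : ∀ j : ℤ, E j y = Complex.exp ((θ * (x - y) : ℝ) * Complex.I) *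
        unitExp (j * ((x - y) / (2 * Real.pi))) := fun j => by
      simp only [hE]
      rw [eigenfn, unitExp, ← Complex.exp_add]
      congr 1
      have : (Real.pi : ℂ) ≠ 0 := by exact_mod_cast Real.pi_ne_zero
      push_cast; field_simp; ring
    have e : Φ y = Complex.I * Complex.exp ((θ * (x - y) : ℝ) * Complex.I) *
        ∑ j ∈ A, (w j * unitExp (j * ((x - y) / (2 * Real.pi))) / (j + θ) +
          w (-j) * unitExp (-(j * ((x - y) / (2 * Real.pi)))) / (-j + θ)) := by
      rw [Finset.mul_sum]
      refine Finset.sum_congr rfl fun j _ => ?_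
      simp only [hB]
      rw [hEu, hEu]
      push_cast
      rw [neg_mul]
      ring
    rw [e, norm_mul, norm_mul, Complex.norm_I, Complex.norm_exp_ofReal_mul_I, one_mul, one_mul]
    exact hsmall _
  have hmain := norm_integral_deriv_mul_le Real.two_pi_pos hf hv hΦ hΦ' hbound
  rw [← hV] at hmain
  refine le_trans (le_of_eq ?_) hmain
  congr 1
  have hterm : ∀ j : ℤ, w j * eigenCoeff θ f j * eigenfn θ j x =
      ∫ y in (0 : ℝ)..(2 * Real.pi), w j * E j y * f y := fun j => by
    rw [eigenCoeff, integral_intervalMeasure, mul_right_comm,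
      ← intervalIntegral.integral_const_mul]
    congr 1; ext y
    have h1 : eigenfn θ j x = E j y * eigenfn θ j y := by
      simp only [hE]; rw [← eigenfn_add, sub_add_cancel]
    rw [h1]
    linear_combination (w j * E j y * f y) * eigenfn_mul_conj θ j y
  have hint : ∀ j : ℤ, IntervalIntegrable (fun y => w j * E j y * f y) volume 0 (2 * Real.pi) :=
    fun j => hf.continuousOn_mul (continuous_const.mul (hEc j)).continuousOn
  simp only [hΦ'def, Finset.sum_mul]
  rw [intervalIntegral.integral_finsetSum fun j _ => by
    simp only [add_mul]; exact (hint j).add (hint (-j))]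
  refine Finset.sum_congr rfl fun j _ => ?_
  simp only [add_mul]
  rw [intervalIntegral.integral_add (hint j) (hint (-j)), hterm, hterm]

/-- For irrational `θ`, initial data of bounded variation evolve into continuous functions at
rational times. -/
theorem exists_continuous_representative {θ : ℝ} (hθ : θ ∈ Ioo (0 : ℝ) 1) (hirr : Irrational θ)
    {P : Polynomial ℤ} (hP : 3 ≤ P.natDegree) {p q : ℕ} (hp : 0 < p) (hq : 0 < q) {u₀ : L2}
    {u : ℝ → L2} (hu : IsWeakSolution θ P u₀ u) (hbv : HasBoundedVariation u₀) :
    ∃ g : ℝ → ℂ, Continuous g ∧ u (2 * Real.pi * (p / q)) =ᵐ[intervalMeasure] g ∧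
      Complex.exp (Complex.I * (2 * Real.pi * θ)) * g 0 = g (2 * Real.pi) := by
  obtain ⟨f, hfbv, hf⟩ := hbv
  obtain ⟨d, hd⟩ : ∃ d, P.natDegree = d + 2 := ⟨P.natDegree - 2, by omega⟩
  have hd1 : 1 ≤ d := by omega
  obtain ⟨v, hv⟩ := hfbv.exists_variation_bound Real.two_pi_pos.le
  have hfint : IntervalIntegrable f volume 0 (2 * Real.pi) :=
    intervalIntegrable_iff_integrable_intervalMeasure.mpr ((integrable_of_L2 u₀).congr hf)
  set V : ℝ := ‖f 0‖ + ‖f (2 * Real.pi)‖ + (v (2 * Real.pi) - v 0) with hV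
  have hV0 : 0 ≤ V := by
    have := (norm_nonneg _).trans (hv 0 ⟨le_rfl, Real.two_pi_pos.le⟩ (2 * Real.pi)
      ⟨Real.two_pi_pos.le, le_rfl⟩ Real.two_pi_pos.le)
    positivity
  set w := dispersiveWeight P p q θ with hw
  set ut := u (2 * Real.pi * (p / q)) with hut
  have hcoeff : ∀ j, eigenCoeff θ ut j = w j * eigenCoeff θ f j := fun j => by
    rw [hut, hu.eigenCoeff_eq (by positivity), exp_eigenvalue_rational_time,
      eigenCoeff_congr_ae hf]
  set a : ℤ → ℂ := fun j => (2 * Real.pi : ℂ)⁻¹ * eigenCoeff θ ut j with ha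
  have hpi : ‖(2 * Real.pi : ℂ)⁻¹‖ ≤ 1 := by
    have e : (2 * Real.pi : ℂ)⁻¹ = ((2 * Real.pi)⁻¹ : ℝ) := by push_cast; rfl
    rw [e, Complex.norm_real, Real.norm_of_nonneg (by positivity)]
    exact inv_le_one_of_one_le₀ (by linarith [Real.pi_gt_three])
  -- The uniform limit inherits continuity, and also the boundary relation, which each partial sum
  -- satisfies exactly.
  have hcauchy : UniformCauchySeqOn (partialSum θ a) Filter.atTop univ := by
    rw [Metric.uniformCauchySeqOn_iff]
    intro ε hε
    -- The tolerance is divided by V + 1 rather than V because V may vanish.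
    obtain ⟨K, hK⟩ := exists_forall_tail_le hd1 hd hp hq hθ hirr
      (η := ε / (2 * (V + 1))) (by positivity)
    have hkey : ∀ m n, K ≤ m → m ≤ n → ∀ x, dist (partialSum θ a n x) (partialSum θ a m x) < ε := by
      intro m n hm hmn x
      rw [dist_eq_norm, partialSum_sub _ _ hmn]
      have h1 := norm_sum_coeff_le hθ (A := Finset.Ico (2 ^ m : ℕ) (2 ^ n)) (w := w)
        (hK m n hm hmn) hfint hv hV x
      have e : ∑ j ∈ Finset.Ico (2 ^ m : ℕ) (2 ^ n),
          (a j * eigenfn θ j x + a (-j) * eigenfn θ (-j) x) = (2 * Real.pi : ℂ)⁻¹ *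
          ∑ j ∈ Finset.Ico (2 ^ m : ℕ) (2 ^ n), (w j * eigenCoeff θ f j * eigenfn θ j x +
            w (-j) * eigenCoeff θ f (-j) * eigenfn θ (-j) x) := by
        rw [Finset.mul_sum]
        refine Finset.sum_congr rfl fun j _ => ?_
        simp only [ha, hcoeff]; ring
      rw [e, norm_mul]
      calc _ ≤ 1 * (ε / (2 * (V + 1)) * V) := by gcongr
        _ < ε := by
          rw [one_mul, div_mul_eq_mul_div, div_lt_iff₀ (by positivity)]
          nlinarith
    refine ⟨K, fun m hm n hn x _ => ?_⟩
    rcases le_total m n with h | h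
    · rw [dist_comm]; exact hkey m n hm h x
    · exact hkey n m hn h x
  have hlim : ∀ x, ∃ y, Filter.Tendsto (fun K => partialSum θ a K x) Filter.atTop (nhds y) :=
    fun x => cauchySeq_tendsto_of_complete (hcauchy.cauchy_map (mem_univ x))
  choose g hg using hlim
  have hunif : TendstoUniformlyOn (partialSum θ a) g Filter.atTop univ :=
    hcauchy.tendstoUniformlyOn_of_tendsto fun x _ => hg x
  refine ⟨g, ?_, ae_eq_of_tendsto_partialSum hg, ?_⟩
  · rw [← continuousOn_univ]
    exact hunif.continuousOn (Filter.Frequently.of_forall fun K =>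
      (continuous_partialSum θ a K).continuousOn)
  · refine tendsto_nhds_unique ((hg 0).const_mul _) ?_
    refine (hg (2 * Real.pi)).congr fun K => ?_
    rw [partialSum_two_pi]

end

theorem theorem1 (θ : ℝ) (hθ : θ ∈ Ioo (0 : ℝ) 1) (n : ℕ) (hn : 3 ≤ n)
    (P : Polynomial ℤ) (hP : P.natDegree = n)
    (p q : ℕ) (hp : 0 < p) (hq : 0 < q) (hpq : p.Coprime q) :
    -- existence and uniqueness of the solution
    (∀ u₀ : L2, ∃ u : ℝ → L2, IsWeakSolution θ P u₀ u ∧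
      ∀ v : ℝ → L2, IsWeakSolution θ P u₀ v → EqOn v u (Ici 0)) ∧
    -- (i) rational `θ`: revival
    (¬ Irrational θ → ∃ (N : ℕ) (c : Fin N → ℂ) (s : Fin N → ℝ),
      ∀ (u₀ : L2) (u : ℝ → L2), IsWeakSolution θ P u₀ u →
        u (2 * Real.pi * (p / q)) =ᵐ[intervalMeasure]
          fun x => ∑ k, c k * quasiPeriodicExt θ u₀ (x - s k)) ∧
    -- (ii) irrational `θ`: continuity
    (Irrational θ → ∀ (u₀ : L2) (u : ℝ → L2), IsWeakSolution θ P u₀ u →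
      HasBoundedVariation u₀ →
        ∃ g : ℝ → ℂ, ContinuousOn g (Icc 0 (2 * Real.pi)) ∧
          u (2 * Real.pi * (p / q)) =ᵐ[intervalMeasure] g ∧
          Complex.exp (Complex.I * (2 * Real.pi * θ)) * g 0 = g (2 * Real.pi)) := by
  refine ⟨fun u₀ => ⟨evolution P θ u₀, isWeakSolution_evolution P θ u₀, fun v hv =>
    (isWeakSolution_evolution P θ u₀).eqOn hv⟩, fun h => exists_revival h P hq,
    fun h u₀ u hu hbv => ?_⟩
  obtain ⟨g, hg, hae, hq⟩ := exists_continuous_representative hθ h (hP ▸ hn) hp hq hu hbv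
  exact ⟨g, hg.continuousOn, hae, hq⟩
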